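/- **Setting.** Let $\Omega\subset\mathbb R^2$ be a bounded, open, connected region whose boundary is a disjoint union of $m\ge 2$ simple closed curves: the outer one $E_1$, and inner ones $E_2^1,\dots,E_2^{m-1}$; put $E_2=\bigcup_i E_2^i$. Let $\mathcal T$ be a finite cellular decomposition of $\Omega\cup\partial\Omega$ into straight triangles and quadrilaterals, with a conductance $c(x,y)=c(y,x)>0$ on every edge, and let $k>0$. Let $g$ be the solution of the Dirichlet problem on the vertices: $g=k$ on $E_1$, $g=0$ on $E_2$, and $\Delta g(x)=\sum_{y\sim x}c(x,y)(g(x)-g(y))=0$ at every vertex $x\in\Omega$. Cut every quadrilateral along one of its diagonals (the diagonals are not edges of the network) and extend $g$ affinely over each of the resulting triangles. Assume that $g$ takes different values at any two vertices joined by an edge or by a chosen diagonal, unless that edge lies in $\partial\Omega$. **Definitions.** For a vertex $v\in\Omega$ let $\mathrm{Sgc}_g(v)$ be the number of sign changes of $g(w)-g(v)$ as $w$ runs once cyclically through the neighbours of $v$ in the triangulation; $v$ is *singular* if $\mathrm{Ind}_g(v)=1-\tfrac12\mathrm{Sgc}_g(v)\neq0$, and then $g(v)$ is a *critical value*. A *level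 curve* is a level set $g^{-1}(t)\subset\Omega\cup\partial\Omega$; a *simple cycle* of it is a simple closed curve contained in it. A set *encloses* another one if the latter lies in the union of the bounded components of the complement of the former. To a simple cycle $L$ of, or a connected component $L$ of, a level curve add a new vertex $x=e\cap L$ wherever $L$ crosses an edge $e=[u,v]$ in its interior, with conductances $$\tilde c(x,v)=\frac{c(u,v)\,(g(v)-g(u))}{g(v)-g(x)},\qquad \tilde c(x,u)=\frac{c(u,v)\,(g(u)-g(v))}{g(u)-g(x)} .$$ The *flux-gradient length* of $L$ computed on a side $\mathcal O$ of $L$ (the interior side: the union of the bounded components of the complement of $L$; the exterior side: the unbounded component) is $\bigl|\sum_{x\in L}\sum_{y\sim x,\ y\in\mathcal O}\tilde c(x,y)(g(x)-g(y))\bigr|$, where $x$ runs over the old and new vertices on $L$ and $\tilde c=c$ on edges that are not subdivided. **Theorem.** The set $\mathcal K$ consisting of $0$, $k$ and the critical values of $g$ is a finite set of non-negative numbers with largest element $k$. Write it in decreasing order as $k=\kappa_0>\kappa_1>\dots>\kappa_N=0$. Then: 1. For every $t\notin\mathcal K$ the level curve $g^{-1}(t)$ is simple: each of its connected components is a simple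 closed curve. 2. Let $\kappa_{i+1}<t<\kappa_i$ and let $L$ be a connected component of $g^{-1}(t)$. There is exactly one simple cycle $C$ of $g^{-1}(\kappa_i)$ that encloses $L$, and $L$ and $C$ have the same flux-gradient length. 3. Let $C$ be a simple cycle of $g^{-1}(\kappa_i)$, $0\le i<N$. Then $C$ encloses exactly one connected component $S$ of $g^{-1}(\kappa_{i+1})$, and $C$ and $S$ have the same flux-gradient length. In 2 and 3 the length of each curve is the same on its two sides (on the only side that meets $\Omega$, for components of $\partial\Omega$), so that it is well defined. -/

import Mathlib

namespace PlanarNetwork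

/-- The Euclidean plane. -/
abbrev Plane : Type := EuclideanSpace ℝ (Fin 2)

/-- A simple closed curve: the image of the circle under a continuous injective map. -/
def IsSimpleClosedCurve (C : Set Plane) : Prop :=
  ∃ γ : Circle → Plane, Continuous γ ∧ Function.Injective γ ∧ Set.range γ = C

/-- The points enclosed by `C`: the union of the bounded connected components of the complement
of `C`. -/
def inside (C : Set Plane) : Set Plane :=
  {x | x ∈ Cᶜ ∧ Bornology.IsBounded (connectedComponentIn Cᶜ x)}

/-- The union of the unbounded connected components of the complement of `C`. -/
def outside (C : Set Plane) : Set Plane :=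
  {x | x ∈ Cᶜ ∧ ¬ Bornology.IsBounded (connectedComponentIn Cᶜ x)}

/-- `C` encloses `L`. -/
def Encloses (C L : Set Plane) : Prop := L ⊆ inside C

/-- A bounded planar region `region = Ω` whose boundary consists of the outer simple closed curve
`outer = E₁` and of `holes + 1 ≥ 1` inner ones `inner i = E₂ⁱ` (so `Ω` is `m`-connected with
`m = holes + 2`), together with a cellular decomposition `𝒯` of `Ω ∪ ∂Ω` into finitely many
straight triangles and quadrilaterals.

The decomposition is recorded by the triangulation `complex` in which every quadrilateral has
been cut by one of its diagonals into two triangles, and by the set `diag` of these diagonals.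
The `1`-cells of `𝒯` are the edges of `complex` that do not lie in `diag`; its `2`-cells are the
triangles without an edge in `diag` and the unions of two triangles along an edge in `diag`. -/
structure CellularDomain where
  /-- The open region `Ω`. -/
  region : Set Plane
  isOpen_region : IsOpen region
  isConnected_region : IsConnected region
  isBounded_region : Bornology.IsBounded region
  /-- The outer boundary component `E₁`. -/
  outer : Set Plane
  /-- The number of inner boundary components, minus one. -/
  holes : ℕ
  /-- The inner boundary components `E₂ⁱ`. -/
  inner : Fin (holes + 1) → Set Plane
  outer_simple : IsSimpleClosedCurve outer
  inner_simple : ∀ i, IsSimpleClosedCurve (inner i)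
  outer_disjoint_inner : ∀ i, Disjoint outer (inner i)
  inner_disjoint : ∀ i j, i ≠ j → Disjoint (inner i) (inner j)
  frontier_region : frontier region = outer ∪ ⋃ i, inner i
  region_enclosed : Encloses outer region
  /-- The triangulation of `Ω ∪ ∂Ω`. -/
  complex : Geometry.SimplicialComplex ℝ Plane
  finite_faces : complex.faces.Finite
  space_eq : complex.space = closure region
  /-- The diagonals of the quadrilaterals. -/
  diag : Set (Finset Plane)
  diag_edge : ∀ e ∈ diag, e ∈ complex.faces ∧ e.card = 2
  /-- A diagonal is not a boundary edge. -/
  diag_interior : ∀ e ∈ diag, ¬ convexHull ℝ (e : Set Plane) ⊆ frontier region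
  /-- A triangle belongs to at most one quadrilateral. -/
  diag_unique : ∀ s ∈ complex.faces, ∀ e ∈ diag, ∀ e' ∈ diag, s.card = 3 → e ⊆ s → e' ⊆ s → e = e'

namespace CellularDomain

variable (D : CellularDomain)

theorem finite_vertices : D.complex.vertices.Finite := by
  have h : D.complex.vertices = (fun v : Plane => ({v} : Finset Plane)) ⁻¹' D.complex.faces := rfl
  rw [h]
  exact D.finite_faces.preimage (Finset.singleton_injective.injOn)

/-- The vertex set `𝒯⁽⁰⁾`. -/
noncomputable def verts : Finset Plane := D.finite_vertices.toFinset

open Classical in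
/-- `x` and `y` are joined by an edge of the triangulation (possibly a diagonal). -/
def Joined (x y : Plane) : Prop := x ≠ y ∧ ({x, y} : Finset Plane) ∈ D.complex.faces

open Classical in
/-- `x` and `y` are joined by an edge of `𝒯`: the edges of the network. -/
def Adj (x y : Plane) : Prop := D.Joined x y ∧ ({x, y} : Finset Plane) ∉ D.diag

/-- A conductance function on the edges of `𝒯`. -/
structure IsConductance (c : Plane → Plane → ℝ) : Prop where
  symm : ∀ x y, c x y = c y x
  pos : ∀ x y, D.Adj x y → 0 < c x y

open Classical in
/-- The combinatorial Laplacian `Δg(x) = ∑_{y ∼ x} c(x,y) (g(x) - g(y))`. -/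
noncomputable def laplacian (c : Plane → Plane → ℝ) (g : Plane → ℝ) (x : Plane) : ℝ :=
  ∑ y ∈ D.verts with D.Adj x y, c x y * (g x - g y)

/-- `g` is the solution of the Dirichlet boundary value problem with value `k` on `E₁` and `0` on
`E₂`, harmonic at the interior vertices, extended to `Ω ∪ ∂Ω` affinely over every triangle. -/
structure IsDirichletSolution (c : Plane → Plane → ℝ) (k : ℝ) (g : Plane → ℝ) : Prop where
  harmonic : ∀ x ∈ D.verts, x ∈ D.region → D.laplacian c g x = 0
  outer_value : ∀ x ∈ D.verts, x ∈ D.outer → g x = k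
  inner_value : ∀ x ∈ D.verts, ∀ i, x ∈ D.inner i → g x = 0
  affine : ∀ s ∈ D.complex.faces, ∀ x ∈ convexHull ℝ (s : Set Plane),
    ∀ y ∈ convexHull ℝ (s : Set Plane), ∀ a b : ℝ, 0 ≤ a → 0 ≤ b → a + b = 1 →
      g (a • x + b • y) = a * g x + b * g y

/-- The standing assumption on `g`: two vertices joined by an edge take different values, unless
the edge is part of the boundary `∂Ω` (on whose components `g` is constant). -/
def Nondegenerate (g : Plane → ℝ) : Prop :=
  ∀ x y, D.Joined x y → ¬ segment ℝ x y ⊆ frontier D.region → g x ≠ g y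

/-- The number of sign changes of `g(w₁) - g(v), …, g(w_d) - g(v), g(w₁) - g(v)` along the
neighbours `w₁, …, w_d` of an interior vertex `v` in cyclic order. Two neighbours of `v` are
cyclically consecutive exactly if they span a triangle with `v`, so this is the number of
triangles at `v` whose two other vertices have `g`-values on different sides of `g(v)`. -/
noncomputable def signChanges (g : Plane → ℝ) (v : Plane) : ℕ :=
  {s : Finset Plane | s ∈ D.complex.faces ∧ s.card = 3 ∧ v ∈ s ∧
    ∃ a ∈ s, ∃ b ∈ s, g a < g v ∧ g v < g b}.ncard

/-- The index of a vertex. -/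
noncomputable def index (g : Plane → ℝ) (v : Plane) : ℝ := 1 - (D.signChanges g v : ℝ) / 2

/-- The critical values of `g`: its values at the singular vertices, which are the interior
vertices of nonzero index. -/
def criticalValues (g : Plane → ℝ) : Set ℝ :=
  {t | ∃ v ∈ D.verts, v ∈ D.region ∧ D.index g v ≠ 0 ∧ g v = t}

/-- The level set of `g` in `Ω ∪ ∂Ω` for the value `t`. -/
def levelSet (g : Plane → ℝ) (t : ℝ) : Set Plane := {x | x ∈ closure D.region ∧ g x = t}

/-- `L` is a connected component of the level set of `g` for the value `t`. -/
def IsLevelComponent (g : Plane → ℝ) (t : ℝ) (L : Set Plane) : Prop :=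
  ∃ x ∈ D.levelSet g t, L = connectedComponentIn (D.levelSet g t) x

/-- `C` is a simple cycle contained in the level set of `g` for the value `t`. -/
def IsLevelCycle (g : Plane → ℝ) (t : ℝ) (C : Set Plane) : Prop :=
  IsSimpleClosedCurve C ∧ C ⊆ D.levelSet g t

/-- The vertices on `L` of the cellular decomposition induced by `L`: the vertices of `𝒯` on `L`,
and one new vertex `x = e ∩ L` for every edge `e` of `𝒯` that `L` meets in a single point in its
interior. -/
def inducedVerts (L : Set Plane) : Set Plane :=
  {x | x ∈ L ∧ (x ∈ D.verts ∨
    ∃ y z, D.Adj y z ∧ x ∈ openSegment ℝ y z ∧ L ∩ segment ℝ y z = {x})}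

open Classical in
/-- The modified conductance of the edge joining `x`, a vertex of the induced decomposition, to
the vertex `y` of `𝒯`. If `x` is a vertex of `𝒯`, it is `c(x,y)` (or `0` if there is no edge). If
`x` is a new vertex on the edge `[y,z]`, it is `c(y,z) (g(y) - g(z)) / (g(y) - g(x))`. -/
noncomputable def inducedConductance (c : Plane → Plane → ℝ) (g : Plane → ℝ) (x y : Plane) : ℝ :=
  if x ∈ D.verts then (if D.Adj x y then c x y else 0)
  else ∑ z ∈ D.verts with D.Adj y z ∧ x ∈ openSegment ℝ y z,
    c y z * (g y - g z) / (g y - g x)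

open Classical in
/-- The normal derivative at the vertex `x` of the induced decomposition, the neighbours being
taken in the set `A` only. -/
noncomputable def normalDerivative (c : Plane → Plane → ℝ) (g : Plane → ℝ) (A : Set Plane)
    (x : Plane) : ℝ :=
  ∑ y ∈ D.verts with y ∈ A, D.inducedConductance c g x y * (g x - g y)

/-- The length of `L` in the flux-gradient metric of `g`, computed on the side `A` of `L`. -/
noncomputable def fluxLength (c : Plane → Plane → ℝ) (g : Plane → ℝ) (A L : Set Plane) : ℝ :=
  |∑ᶠ x ∈ D.inducedVerts L, D.normalDerivative c g A x|

/-- `ℓ` is the flux-gradient length of `L`: it is the length of `L` computed on the interior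
side of `L` and on the exterior side of `L`, for each of these that meets `Ω` (for the
components of `∂Ω` only one of them does). -/
def HasFluxLength (c : Plane → Plane → ℝ) (g : Plane → ℝ) (L : Set Plane) (ℓ : ℝ) : Prop :=
  ((inside L ∩ D.region).Nonempty → D.fluxLength c g (inside L) L = ℓ) ∧
  ((outside L ∩ D.region).Nonempty → D.fluxLength c g (outside L) L = ℓ)

end CellularDomain

end PlanarNetwork

/-! Extend g continuously to the plane by k beyond E₁ and by 0 in the holes (`ext`). Harmonicity and
nondegeneracy give a strict maximum and minimum principle: near every point of Ω, g takes both
larger and smaller values (`exists_near_region`). Hence everything enclosed by a compact subset of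
g⁻¹(t), t > 0, has value < t (`ext_lt_of_mem_inside`).

The heart of the proof is that for 0 < t ≤ k the components of {ext < t} are exactly the interiors
of the simple cycles of g⁻¹(t). The interior of a cycle is a component because ext < t inside and
ext = t on the cycle (`IsLevelCycle.isLowComp`). Conversely, let V be a component and t < k. A
triangle with a vertex in V and a vertex above t is crossed by one chord of the level curve, and
each end of the chord lies on another such triangle; at a vertex this is a parity count around the
vertex (`two_le_turnTris`). Walking along the chords therefore closes up to a polygon, whose
interior is a component meeting V, hence V itself (`IsLowComp.exists_cycle`). Nesting of curves thus
becomes inclusion of components of sublevel sets.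

A vertex of index zero has two sign changes, and each low component at the vertex uses at least two,
so only one component is adjacent to it. Consequently, near a cycle of a regular value, {ext ≤ t} is
just the closed interior of the cycle (`eventually_mem`), and level components are cycles.
Compactness then shows that two points of value < t which share a component at all levels slightly
above a regular t share one at t. Since a path between them stays strictly below its level, the
infimum of the common levels can be pushed down through all regular values (`SameLow.of_regular`).
So inside a cycle of level κᵢ each level strictly between κᵢ₊₁ and κᵢ is one single cycle, and the
level κᵢ₊₁ is connected there: two separated pieces would separate the nearby cycles
(`isPreconnected_inside_levelSet`).

For the lengths, the modified conductances leave the flux through a cut edge unchanged, so the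
length on a side A is |∑ Δg(v)| over the vertices v in A (`fluxLength_eq`). Since Δg vanishes at
interior vertices and has total sum zero, only the distribution of the boundary vertices matters,
and the curves being compared separate them in the same way: the vertices of E₁ from those of the
same inner components.

The planar topology (Jordan curve theorem, separation by disjoint compact sets) rests on continuous
logarithms and Eilenberg's criterion (`eq_zero_of_hasLogOn`). -/

namespace PlanarNetwork

open Set Topology

/-! ### Continuous logarithms through the covering exp. -/

section Logarithms

/-- `f` has a continuous logarithm on `s`. -/
def HasLogOn {X : Type*} [TopologicalSpace X] (f : X → ℂ) (s : Set X) : Prop :=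
  ∃ l : X → ℂ, ContinuousOn l s ∧ ∀ x ∈ s, Complex.exp (l x) = f x

theorem HasLogOn.mono {X : Type*} [TopologicalSpace X] {f : X → ℂ} {s t : Set X}
    (h : HasLogOn f s) (hts : t ⊆ s) : HasLogOn f t := by
  obtain ⟨l, hl, hf⟩ := h
  exact ⟨l, hl.mono hts, fun x hx => hf x (hts hx)⟩

/-- A continuous nowhere vanishing function on a simply connected space has a logarithm. -/
theorem exists_log {X : Type*} [TopologicalSpace X] [SimplyConnectedSpace X]
    [LocallyPathConnectedSpace X] {f : X → ℂ} (hf : Continuous f) (h0 : ∀ x, f x ≠ 0) :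
    ∃ l : X → ℂ, Continuous l ∧ ∀ x, Complex.exp (l x) = f x := by
  obtain ⟨x₀⟩ : Nonempty X := inferInstance
  obtain ⟨F, ⟨-, hF⟩, -⟩ := Complex.isCoveringMapOn_exp.existsUnique_continuousMap_lifts
    ⟨f, hf⟩ (a₀ := x₀) (e₀ := Complex.log (f x₀)) (Complex.exp_log (h0 x₀)) (fun a => h0 a)
  exact ⟨F, F.continuous, fun x => congrFun hF x⟩

/-- A continuous function with `exp ∘ f = 1` on a preconnected set is constant there. -/
theorem eq_of_exp_eq_one {X : Type*} [TopologicalSpace X] {f : X → ℂ} {s : Set X}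
    (hs : IsPreconnected s) (hf : ContinuousOn f s) (h1 : ∀ x ∈ s, Complex.exp (f x) = 1)
    {x y : X} (hx : x ∈ s) (hy : y ∈ s) : f x = f y := by
  have := Complex.isCoveringMap_exp.eqOn_of_comp_eqOn hs hf
    (continuousOn_const (c := f y)) (fun z hz => by
      apply Subtype.ext
      simp [h1 z hz, h1 y hy]) hy rfl
  exact this hx

/-- The covering exp carries the logarithm 0 of H(0, ·) = 1 along the homotopy; its end is the
logarithm sought. -/
theorem hasLogOn_of_homotopy {X : Type*} [TopologicalSpace X] {s : Set X}
    (H : unitInterval × s → ℂ) (hH : Continuous H) (h0 : ∀ a, H a ≠ 0)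
    (h1 : ∀ x, H (0, x) = 1) : ∃ l : s → ℂ, Continuous l ∧ ∀ x, Complex.exp (l x) = H (1, x) := by
  let H' : C(unitInterval × s, {z : ℂ // z ≠ 0}) :=
    ⟨fun a => ⟨H a, h0 a⟩, hH.subtype_mk _⟩
  let L := Complex.isCoveringMap_exp.liftHomotopy H' (ContinuousMap.const s 0) (fun a => by
    apply Subtype.ext
    simp [H', h1])
  refine ⟨fun x => L (1, x), by fun_prop, fun x => ?_⟩
  have := congrFun (Complex.isCoveringMap_exp.liftHomotopy_lifts H' (ContinuousMap.const s 0)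
    (fun a => by
      apply Subtype.ext
      simp [H', h1])) (1, x)
  exact congrArg Subtype.val this

theorem hasLogOn_of_subtype {X : Type*} [TopologicalSpace X] {s : Set X} {f : X → ℂ}
    (h : ∃ l : s → ℂ, Continuous l ∧ ∀ x, Complex.exp (l x) = f x) : HasLogOn f s := by
  classical
  obtain ⟨l, hl, hf⟩ := h
  refine ⟨fun x => if hx : x ∈ s then l ⟨x, hx⟩ else 0, ?_, fun x hx => ?_⟩
  · rw [continuousOn_iff_continuous_domRestrict]
    convert! hl with x
    simp
  · simp [hx, hf]

end Logarithms

/-! ### Eilenberg's criterion. -/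

section Criterion

/-- The plane as the complex line. -/
noncomputable def cx : Plane ≃ₗᵢ[ℝ] ℂ := Complex.orthonormalBasisOneI.repr.symm

theorem cx_sub_ne_zero {z a : Plane} (h : z ≠ a) : cx z - cx a ≠ 0 :=
  sub_ne_zero.2 fun h' => h (cx.injective h')

theorem one_lt_rank_plane : 1 < Module.rank ℝ Plane := by
  apply Module.one_lt_rank_of_one_lt_finrank
  simp

/-- If `p` and `q` are joined in the complement of `s`, then `(z - p) / (z - q)` has a logarithm
on `s`. -/
theorem hasLogOn_of_joinedIn {s : Set Plane} {p q : Plane} (h : JoinedIn sᶜ p q) :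
    HasLogOn (fun z => (cx z - cx p) / (cx z - cx q)) s := by
  apply hasLogOn_of_subtype
  have hq : ∀ z : s, cx z - cx q ≠ 0 := fun z =>
    cx_sub_ne_zero fun e => h.target_mem (e ▸ z.2)
  obtain ⟨γ, hγ⟩ := h.symm
  -- The zero of the numerator travels along the path from q to p: the quotient starts as 1 and
  -- never vanishes on s, because the path avoids s.
  have := hasLogOn_of_homotopy (s := s)
    (fun a => (cx a.2 - cx (γ a.1)) / (cx a.2 - cx q)) (by
      refine Continuous.div (by fun_prop) (by fun_prop) fun a => hq a.2) (fun a => by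
        refine div_ne_zero (cx_sub_ne_zero fun e => hγ a.1 (e ▸ a.2.2)) (hq a.2)) (fun x => by
        simpa using div_self (hq x))
  simpa using this

/-- Eilenberg's criterion: a logarithm on the frontier of a bounded open set. -/
theorem eq_zero_of_hasLogOn {U : Set Plane} (hU : IsOpen U) (hb : Bornology.IsBounded U)
    {a b : Plane} (ha : a ∈ U) (hbU : b ∉ closure U) {n m : ℤ}
    (h : HasLogOn (fun z => (cx z - cx a) ^ n * (cx z - cx b) ^ m) (frontier U)) : n = 0 := by
  classical
  obtain ⟨l, hl, hexp⟩ := h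
  obtain ⟨Φ, hΦ⟩ := ContinuousMap.exists_restrict_eq (s := frontier U) isClosed_frontier
    ⟨_, continuousOn_iff_continuous_domRestrict.1 hl⟩
  have hΦ' : ∀ z ∈ frontier U, Φ z = l z := fun z hz => by
    have := congrArg (fun F => F ⟨z, hz⟩) hΦ
    simpa using this
  -- On the frontier exp Φ = (z - a)^n (z - b)^m, so both formulas agree there. Thus (z - a)^n,
  -- restricted to the complement of U, extends to a nowhere vanishing function on the plane, which
  -- has a logarithm.
  let H : Plane → ℂ := U.piecewise (fun z => Complex.exp (Φ z) * (cx z - cx b) ^ (-m))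
    (fun z => (cx z - cx a) ^ n)
  have hzb : ∀ z ∈ closure U, cx z - cx b ≠ 0 := fun z hz =>
    cx_sub_ne_zero fun e => hbU (e ▸ hz)
  have hza : ∀ z ∈ Uᶜ, cx z - cx a ≠ 0 := fun z hz =>
    cx_sub_ne_zero fun e => hz (e ▸ ha)
  have hH : Continuous H := by
    refine continuous_piecewise (fun z hz => ?_) ?_ ?_
    · have h1 := hzb z hz.1
      rw [hΦ' z hz, hexp z hz, mul_assoc, ← zpow_add₀ h1]
      simp
    · refine ContinuousOn.mul (by fun_prop) ?_
      refine ContinuousOn.zpow₀ (by fun_prop) _ fun z hz => Or.inl (hzb z hz)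
    · rw [hU.isClosed_compl.closure_eq]
      refine ContinuousOn.zpow₀ (by fun_prop) _ fun z hz => Or.inl (hza z hz)
  have hH0 : ∀ z, H z ≠ 0 := fun z => by
    by_cases hz : z ∈ U
    · simp only [H, piecewise_eq_of_mem _ _ _ hz]
      exact mul_ne_zero (Complex.exp_ne_zero _) (zpow_ne_zero _ (hzb z (subset_closure hz)))
    · simp only [H, piecewise_eq_of_notMem _ _ _ hz]
      exact zpow_ne_zero _ (hza z hz)
  obtain ⟨L, hL, hLH⟩ := exists_log hH hH0
  obtain ⟨R, hR0, hR⟩ := hb.subset_ball_lt 0 a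
  let w : ℝ → Plane := fun θ => cx.symm (cx a + R * Complex.exp (θ * Complex.I))
  have hw : Continuous w := by
    refine cx.symm.continuous.comp ?_
    fun_prop
  have hwU : ∀ θ, w θ ∉ U := fun θ hθ => by
    have := hR hθ
    rw [Metric.mem_ball, ← cx.dist_map] at this
    simp [w, Complex.norm_exp_ofReal_mul_I, abs_of_pos hR0] at this
  have hwH : ∀ θ, H (w θ) = (R * Complex.exp (θ * Complex.I)) ^ n := fun θ => by
    simp only [H, piecewise_eq_of_notMem _ _ _ (hwU θ)]
    simp [w]
  -- On a circle around U both terms are logarithms of (R e^{iθ})^n. Over one turn the first returns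
  -- to its value while the second gains 2πin.
  have key := eq_of_exp_eq_one (s := univ) (f := fun θ : ℝ => L (w θ) -
    n * (Real.log R + θ * Complex.I)) isPreconnected_univ (by fun_prop) (fun θ _ => by
      have hRexp : Complex.exp (Real.log R) = R := by
        rw [← Complex.ofReal_exp, Real.exp_log hR0]
      rw [Complex.exp_sub, hLH, hwH, Complex.exp_int_mul, Complex.exp_add, hRexp]
      refine div_self (zpow_ne_zero _ (mul_ne_zero ?_ (Complex.exp_ne_zero _)))
      exact_mod_cast hR0.ne') (mem_univ 0) (mem_univ (2 * Real.pi))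
  have hw2 : w (2 * Real.pi) = w 0 := by simp [w]
  simp only [hw2] at key
  have : (n : ℂ) * (2 * Real.pi * Complex.I) = 0 := by
    have h2 := sub_right_injective key
    push_cast at h2
    linear_combination -h2
  simpa [Real.pi_ne_zero] using this

/-- A continuous nowhere vanishing function on an arc has a logarithm. -/
theorem hasLogOn_arc {e : unitInterval → Plane} (he : Continuous e) (hi : Function.Injective e)
    {f : Plane → ℂ} (hf : ContinuousOn f (range e)) (h0 : ∀ z ∈ range e, f z ≠ 0) :
    HasLogOn f (range e) := by
  have hc : Continuous fun t : ℝ => f (e (projIcc 0 1 zero_le_one t)) := by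
    refine hf.comp_continuous (by fun_prop) fun t => mem_range_self _
  obtain ⟨l, hl, hlf⟩ := exists_log hc fun t => h0 _ (mem_range_self _)
  obtain ⟨g, hg⟩ := ContinuousMap.exists_extension (he.isClosedEmbedding hi)
    (⟨fun t => l t, by fun_prop⟩ : C(unitInterval, ℂ))
  refine ⟨g, g.continuous.continuousOn, ?_⟩
  rintro _ ⟨t, rfl⟩
  have := congrArg (fun F => F t) hg
  simp only [ContinuousMap.comp_apply, ContinuousMap.coe_mk] at this
  rw [this, hlf]
  simp

end Criterion

/-! ### Bounded and unbounded components of a complement. -/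

section Complement

/-- Components of the open set Kᶜ are open, so a frontier point off K would have a component that
meets, hence equals, the given one. -/
theorem frontier_connectedComponentIn_subset {K : Set Plane} (hK : IsClosed K) (x : Plane) :
    frontier (connectedComponentIn Kᶜ x) ⊆ K := by
  intro p hp
  by_contra hpK
  have ho : IsOpen (connectedComponentIn Kᶜ p) := hK.isOpen_compl.connectedComponentIn
  have hpp : p ∈ connectedComponentIn Kᶜ p := mem_connectedComponentIn hpK
  obtain ⟨y, hy1, hy2⟩ := mem_closure_iff.1 hp.1 _ ho hpp
  have := connectedComponentIn_eq hy1
  rw [← connectedComponentIn_eq hy2] at this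
  exact hp.2 (by
    rw [(hK.isOpen_compl.connectedComponentIn).interior_eq, ← this]
    exact hpp)

theorem isConnected_compl_closedBall (x : Plane) (R : ℝ) (hR : 0 ≤ R) :
    IsConnected (Metric.closedBall x R)ᶜ := by
  have h0 : (Metric.closedBall x R)ᶜ =
      (fun a : ℝ × Plane => x + a.1 • a.2) '' (Ioi R ×ˢ Metric.sphere 0 1) := by
    ext y
    simp only [mem_compl_iff, Metric.mem_closedBall, not_le, mem_image, mem_prod, mem_Ioi,
      mem_sphere_zero_iff_norm, Prod.exists]
    constructor
    · intro h
      have hne : ‖y - x‖ ≠ 0 := by rw [← dist_eq_norm]; linarith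
      refine ⟨‖y - x‖, ‖y - x‖⁻¹ • (y - x), ⟨by rwa [← dist_eq_norm], ?_⟩, ?_⟩
      · rw [norm_smul, norm_inv, norm_norm, inv_mul_cancel₀ hne]
      · rw [smul_smul, mul_inv_cancel₀ hne]; simp
    · rintro ⟨r, u, ⟨hr, hu⟩, rfl⟩
      simp [norm_smul, hu, abs_of_pos (lt_of_le_of_lt hR hr), hr]
  rw [h0]
  exact (isConnected_Ioi.prod (isConnected_sphere one_lt_rank_plane 0 zero_le_one)).image _
    (by fun_prop)

theorem compl_closedBall_not_isBounded (x : Plane) (R : ℝ) :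
    ¬ Bornology.IsBounded (Metric.closedBall x R)ᶜ := by
  intro h
  have h2 : Bornology.IsBounded (univ : Set Plane) := by
    rw [← union_compl_self (Metric.closedBall x R)]
    exact Metric.isBounded_closedBall.union h
  exact NormedSpace.unbounded_univ ℝ Plane h2

variable {K : Set Plane}

/-- An unbounded component leaves every ball around K, so it absorbs the connected complement of
such a ball. -/
theorem connectedComponentIn_eq_of_mem_outside (hb : Bornology.IsBounded K) {x y : Plane}
    (hx : x ∈ outside K) (hy : y ∈ outside K) :
    connectedComponentIn Kᶜ x = connectedComponentIn Kᶜ y := by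
  obtain ⟨R, hR0, hR⟩ := hb.subset_closedBall_lt 0 0
  have key : ∀ x ∈ outside K, (Metric.closedBall (0 : Plane) R)ᶜ ⊆ connectedComponentIn Kᶜ x := by
    intro x hx
    have : ¬ connectedComponentIn Kᶜ x ⊆ Metric.closedBall 0 R := fun h =>
      hx.2 (Metric.isBounded_closedBall.subset h)
    obtain ⟨w, hw, hwR⟩ := not_subset.1 this
    rw [connectedComponentIn_eq hw]
    exact (isConnected_compl_closedBall 0 R hR0.le).isPreconnected.subset_connectedComponentIn
      hwR (compl_subset_compl.2 hR)
  obtain ⟨w, hw⟩ := (isConnected_compl_closedBall (0 : Plane) R hR0.le).nonempty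
  rw [connectedComponentIn_eq (key x hx hw), connectedComponentIn_eq (key y hy hw)]

theorem compl_eq_inside_union_outside : Kᶜ = inside K ∪ outside K := by
  ext x
  simp only [inside, outside, mem_union, mem_ofPred_eq]
  tauto

theorem disjoint_inside_outside : Disjoint (inside K) (outside K) :=
  disjoint_left.2 fun _ h h' => h'.2 h.2

theorem connectedComponentIn_subset_inside {x : Plane} (hx : x ∈ inside K) :
    connectedComponentIn Kᶜ x ⊆ inside K := fun y hy =>
  ⟨connectedComponentIn_subset _ _ hy, by rw [← connectedComponentIn_eq hy]; exact hx.2⟩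

theorem connectedComponentIn_subset_outside {x : Plane} (hx : x ∈ outside K) :
    connectedComponentIn Kᶜ x ⊆ outside K := fun y hy =>
  ⟨connectedComponentIn_subset _ _ hy, by rw [← connectedComponentIn_eq hy]; exact hx.2⟩

theorem isOpen_inside (hK : IsClosed K) : IsOpen (inside K) :=
  isOpen_iff_mem_nhds.2 fun _ hx => Filter.mem_of_superset
    ((hK.isOpen_compl.connectedComponentIn).mem_nhds (mem_connectedComponentIn hx.1))
    (connectedComponentIn_subset_inside hx)

theorem isOpen_outside (hK : IsClosed K) : IsOpen (outside K) :=
  isOpen_iff_mem_nhds.2 fun _ hx => Filter.mem_of_superset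
    ((hK.isOpen_compl.connectedComponentIn).mem_nhds (mem_connectedComponentIn hx.1))
    (connectedComponentIn_subset_outside hx)

theorem inside_subset_closedBall {R : ℝ} (hR0 : 0 ≤ R) (hR : K ⊆ Metric.closedBall 0 R) :
    inside K ⊆ Metric.closedBall 0 R := by
  intro x hx
  by_contra hxR
  refine compl_closedBall_not_isBounded 0 R (hx.2.subset ?_)
  exact (isConnected_compl_closedBall 0 R hR0).isPreconnected.subset_connectedComponentIn
      hxR (compl_subset_compl.2 hR)

theorem isBounded_inside (hb : Bornology.IsBounded K) : Bornology.IsBounded (inside K) := by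
  obtain ⟨R, hR0, hR⟩ := hb.subset_closedBall_lt 0 0
  exact Metric.isBounded_closedBall.subset (inside_subset_closedBall hR0.le hR)

theorem outside_nonempty (hb : Bornology.IsBounded K) : (outside K).Nonempty := by
  obtain ⟨R, hR0, hR⟩ := hb.subset_closedBall_lt 0 0
  obtain ⟨w, hw⟩ := (isConnected_compl_closedBall (0 : Plane) R hR0.le).nonempty
  have hwK : w ∈ Kᶜ := fun h => hw (hR h)
  rw [compl_eq_inside_union_outside] at hwK
  exact ⟨w, hwK.resolve_left fun h => hw (inside_subset_closedBall hR0.le hR h)⟩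

theorem outside_eq_connectedComponentIn (hb : Bornology.IsBounded K) {x : Plane}
    (hx : x ∈ outside K) : outside K = connectedComponentIn Kᶜ x := by
  refine Subset.antisymm (fun y hy => ?_) (connectedComponentIn_subset_outside hx)
  rw [← connectedComponentIn_eq_of_mem_outside hb hy hx]
  exact mem_connectedComponentIn hy.1

theorem isConnected_outside (hb : Bornology.IsBounded K) : IsConnected (outside K) := by
  obtain ⟨x, hx⟩ := outside_nonempty hb
  rw [outside_eq_connectedComponentIn hb hx, isConnected_connectedComponentIn_iff]
  exact hx.1

theorem outside_not_isBounded (hb : Bornology.IsBounded K) :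
    ¬ Bornology.IsBounded (outside K) := by
  obtain ⟨x, hx⟩ := outside_nonempty hb
  rw [outside_eq_connectedComponentIn hb hx]
  exact hx.2

theorem subset_outside_of_isPreconnected {S : Set Plane} (hS : IsPreconnected S)
    (hu : ¬ Bornology.IsBounded S) (hSK : Disjoint S K) : S ⊆ outside K := fun _ hx =>
  ⟨disjoint_left.1 hSK hx, fun h => hu (h.subset
    (hS.subset_connectedComponentIn hx (disjoint_left.1 hSK)))⟩

theorem frontier_inside_subset (hK : IsClosed K) : frontier (inside K) ⊆ K := by
  intro p hp
  by_contra hpK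
  rw [(isOpen_inside hK).frontier_eq] at hp
  have : p ∈ outside K := by
    have : p ∈ Kᶜ := hpK
    rw [compl_eq_inside_union_outside] at this
    exact this.resolve_left hp.2
  obtain ⟨y, hy1, hy2⟩ := mem_closure_iff.1 hp.1 _ (isOpen_outside hK) this
  exact disjoint_left.1 disjoint_inside_outside hy2 hy1

theorem frontier_outside_subset (hK : IsClosed K) : frontier (outside K) ⊆ K := by
  intro p hp
  by_contra hpK
  rw [(isOpen_outside hK).frontier_eq] at hp
  have : p ∈ inside K := by
    have : p ∈ Kᶜ := hpK
    rw [compl_eq_inside_union_outside] at this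
    exact this.resolve_right hp.2
  obtain ⟨y, hy1, hy2⟩ := mem_closure_iff.1 hp.1 _ (isOpen_inside hK) this
  exact disjoint_left.1 disjoint_inside_outside hy1 hy2

/-- For a point a enclosed by K, the function z - a has no zero on K, but by Eilenberg's criterion
it has no logarithm on the frontier of `inside K`. -/
theorem inside_eq_empty_of_hasLogOn (hK : IsClosed K) (hb : Bornology.IsBounded K)
    (h : ∀ f : Plane → ℂ, ContinuousOn f K → (∀ z ∈ K, f z ≠ 0) → HasLogOn f K) :
    inside K = ∅ := by
  rw [eq_empty_iff_forall_notMem]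
  intro a ha
  obtain ⟨b, hbo⟩ := outside_nonempty hb
  have hao := isOpen_inside hK
  have := eq_zero_of_hasLogOn (n := 1) (m := 0) hao (isBounded_inside hb) ha (b := b)
    (fun hbc => by
      rw [closure_eq_self_union_frontier] at hbc
      exact hbc.elim (fun h => disjoint_left.1 disjoint_inside_outside h hbo)
        fun h => hbo.1 (frontier_inside_subset hK h)) (by
      refine (h _ ?_ fun z hz => ?_).mono (frontier_inside_subset hK)
      · simp only [zpow_one, zpow_zero, mul_one]; fun_prop
      · simp only [zpow_one, zpow_zero, mul_one]
        exact cx_sub_ne_zero fun e => ha.1 (e ▸ hz))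
  exact one_ne_zero this

/-- An arc does not separate the plane. -/
theorem isConnected_compl_arc {e : unitInterval → Plane} (he : Continuous e)
    (hi : Function.Injective e) : IsConnected (range e)ᶜ := by
  have hc : IsCompact (range e) := isCompact_range he
  have := inside_eq_empty_of_hasLogOn hc.isClosed hc.isBounded
    fun f hf h0 => hasLogOn_arc he hi hf h0
  rw [compl_eq_inside_union_outside, this, empty_union]
  exact isConnected_outside hc.isBounded

end Complement

/-- The disjoint open sets `interior u` and `(closure u)ᶜ` cover s, so s lies in one of them. -/
theorem subset_of_disjoint_frontier {X : Type*} [TopologicalSpace X] {s u : Set X}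
    (hs : IsPreconnected s) (hne : (s ∩ u).Nonempty) (hd : Disjoint s (frontier u)) : s ⊆ u := by
  have h1 : s ⊆ interior u ∪ (closure u)ᶜ := fun x hx => by
    by_cases hc : x ∈ closure u
    · left
      by_contra hi
      exact disjoint_left.1 hd hx ⟨hc, hi⟩
    · exact Or.inr hc
  obtain ⟨x, hxs, hxu⟩ := hne
  have hxi : x ∈ interior u := (h1 hxs).resolve_right fun h => h (subset_closure hxu)
  have := hs.subset_left_of_subset_union isOpen_interior isClosed_closure.isOpen_compl
    (disjoint_left.2 fun y hy hy' => hy' (interior_subset_closure hy)) h1 ⟨x, hxs, hxi⟩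
  exact this.trans interior_subset

/-! ### The Jordan curve theorem. -/

section JordanCurve

/-- The map θ ↦ e^{iθ} is a quotient map, so continuity may be tested upstairs; arg serves as a
section that need not be continuous. -/
theorem exists_circle_lift {Y : Type*} [TopologicalSpace Y] {ψ : ℝ → Y} (hψ : Continuous ψ)
    (hp : Function.Periodic ψ (2 * Real.pi)) :
    ∃ φ : Circle → Y, Continuous φ ∧ ∀ θ, φ (Circle.exp θ) = ψ θ := by
  have hψe : ∀ θ, ψ (Complex.arg (Circle.exp θ)) = ψ θ := fun θ => by
    obtain ⟨m, hm⟩ := Circle.exp_eq_exp.1 (Circle.exp_arg (Circle.exp θ))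
    rw [hm]
    exact hp.int_mul m θ
  have hq : IsQuotientMap Circle.exp := Circle.isCoveringMap_exp.isQuotientMap fun w =>
    ⟨Complex.arg w, Circle.exp_arg w⟩
  refine ⟨fun w => ψ (Complex.arg w), hq.continuous_iff.2 ?_, hψe⟩
  have : (fun w : Circle => ψ (Complex.arg w)) ∘ Circle.exp = ψ := funext hψe
  rw [this]; exact hψ

/-- A continuous nowhere vanishing function on the circle is a power times an exponential. -/
theorem exists_degree {F : Circle → ℂ} (hF : Continuous F) (h0 : ∀ w, F w ≠ 0) :
    ∃ (n : ℤ) (φ : C(Circle, ℂ)), ∀ w : Circle, F w = (w : ℂ) ^ n * Complex.exp (φ w) := by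
  obtain ⟨l, hl, hlF⟩ := exists_log (f := fun θ : ℝ => F (Circle.exp θ)) (by fun_prop)
    fun θ => h0 _
  have hper : ∀ θ : ℝ, Complex.exp (l (θ + 2 * Real.pi) - l θ) = 1 := fun θ => by
    rw [Complex.exp_sub, hlF, hlF, Circle.periodic_exp]
    exact div_self (h0 _)
  obtain ⟨n, hn⟩ := Complex.exp_eq_one_iff.1 (hper 0)
  have hn' : ∀ θ : ℝ, l (θ + 2 * Real.pi) - l θ = n * (2 * Real.pi * Complex.I) := fun θ => by
    rw [← hn]
    exact eq_of_exp_eq_one (s := univ) (f := fun θ : ℝ => l (θ + 2 * Real.pi) - l θ)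
      isPreconnected_univ (by fun_prop) (fun θ _ => hper θ) (mem_univ θ) (mem_univ 0)
  -- The logarithm gains 2πin over each period; subtracting inθ makes it periodic.
  let ψ : ℝ → ℂ := fun θ => l θ - n * (θ * Complex.I)
  have hψ : Continuous ψ := by fun_prop
  have hψp : Function.Periodic ψ (2 * Real.pi) := fun θ => by
    simp only [ψ]
    have := hn' θ
    push_cast
    linear_combination this
  obtain ⟨φ, hφ, hφψ⟩ := exists_circle_lift hψ hψp
  refine ⟨n, ⟨φ, hφ⟩, fun w => ?_⟩
  obtain ⟨θ, hθ⟩ : ∃ θ : ℝ, w = Circle.exp θ := ⟨Complex.arg w, (Circle.exp_arg w).symm⟩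
  change F w = (w : ℂ) ^ n * Complex.exp (φ w)
  rw [hθ, hφψ, ← hlF, Circle.coe_exp, ← Complex.exp_int_mul, ← Complex.exp_add]
  congr 1
  simp only [ψ]
  ring

/-- The arc `γ (w e^{iθ})`, `a ≤ θ ≤ b`, of a closed curve. -/
noncomputable def arcMap (γ : Circle → Plane) (w : Circle) (a b : ℝ) (s : unitInterval) : Plane :=
  γ (w * Circle.exp (a + s * (b - a)))

variable {γ : Circle → Plane}

theorem continuous_arcMap (hγ : Continuous γ) (w : Circle) (a b : ℝ) : Continuous (arcMap γ w a b) := by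
  unfold arcMap
  fun_prop

theorem injective_arcMap (hi : Function.Injective γ) (w : Circle) {a b : ℝ} (hab : a < b) (hb : b < a + 2 * Real.pi) :
    Function.Injective (arcMap γ w a b) := by
  intro s t h
  have h1 := mul_left_cancel (hi h)
  obtain ⟨m, hm⟩ := Circle.exp_eq_exp.1 h1
  have h2 : ((s : ℝ) - t) * (b - a) = m * (2 * Real.pi) := by linarith
  have hs := s.2
  have ht := t.2
  have hba : 0 < b - a := by linarith
  have hm0 : m = 0 := by
    have hpi := Real.pi_pos
    have u1 : (m : ℝ) * (2 * Real.pi) < 1 * (2 * Real.pi) := by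
      rw [← h2]; nlinarith [hs.2, ht.1]
    have u2 : (-1 : ℝ) * (2 * Real.pi) < m * (2 * Real.pi) := by
      rw [← h2]; nlinarith [ht.2, hs.1]
    have v1 := lt_of_mul_lt_mul_right u1 (by positivity)
    have v2 := lt_of_mul_lt_mul_right u2 (by positivity)
    have v1' : m < 1 := by exact_mod_cast v1
    have v2' : -1 < m := by exact_mod_cast v2
    omega
  rw [hm0] at h2
  simp only [Int.cast_zero, zero_mul, mul_eq_zero] at h2
  rcases h2 with h2 | h2
  · exact Subtype.ext (by linarith)
  · linarith

theorem mem_range_arcMap (w : Circle) {a b θ : ℝ} (hab : a < b) (h : θ ∈ Icc a b) :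
    γ (w * Circle.exp θ) ∈ range (arcMap γ w a b) := by
  have hba : 0 < b - a := by linarith
  refine ⟨⟨(θ - a) / (b - a), div_nonneg (by linarith [h.1]) hba.le,
    (div_le_one hba).2 (by linarith [h.2])⟩, ?_⟩
  simp only [arcMap]
  rw [div_mul_cancel₀ _ hba.ne']
  ring_nf

theorem exists_angle (w v : Circle) (a : ℝ) :
    ∃ θ ∈ Ico a (a + 2 * Real.pi), v = w * Circle.exp θ := by
  have h2 : (0 : ℝ) < 2 * Real.pi := by positivity
  refine ⟨toIcoMod h2 a (Complex.arg (w⁻¹ * v : Circle)), toIcoMod_mem_Ico h2 _ _, ?_⟩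
  rw [toIcoMod, Circle.periodic_exp.sub_zsmul_eq, Circle.exp_arg]
  simp

/-- Cut the curve at p and q into arcs A and B. Each arc joins p to q, so (z - p)/(z - q) has a
logarithm off A and another off B. If the curve did not separate the plane, the two would differ by
a constant off the curve and could be glued to a logarithm off {p, q}; but the function winds once
around p. -/
theorem exists_inside_of_simple (hγ : Continuous γ) (hi : Function.Injective γ) : (inside (range γ)).Nonempty := by
  rw [nonempty_iff_ne_empty]
  intro hempty
  have hC : IsCompact (range γ) := isCompact_range hγ
  have hconn : IsPreconnected (range γ)ᶜ := by
    rw [compl_eq_inside_union_outside, hempty, empty_union]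
    exact (isConnected_outside hC.isBounded).isPreconnected
  have hpi := Real.pi_pos
  set p := γ 1 with hp
  set q := γ (Circle.exp Real.pi) with hq
  set A := range (arcMap γ 1 0 Real.pi) with hA
  set B := range (arcMap γ 1 Real.pi (2 * Real.pi)) with hB
  have hpq : p ≠ q := fun h => by
    have h2 : Circle.exp 0 = Circle.exp Real.pi := by rw [Circle.exp_zero]; exact hi h
    obtain ⟨m, hm⟩ := Circle.exp_eq_exp.1 h2
    have : (Real.pi) * (1 + 2 * m) = 0 := by linarith
    rcases mul_eq_zero.1 this with h | h
    · exact hpi.ne' h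
    · have : (1 + 2 * m : ℤ) = 0 := by exact_mod_cast h
      omega
  have hAC : A ⊆ range γ := by rintro _ ⟨s, rfl⟩; exact mem_range_self _
  have hBC : B ⊆ range γ := by rintro _ ⟨s, rfl⟩; exact mem_range_self _
  have hcov : range γ ⊆ A ∪ B := by
    rintro _ ⟨v, rfl⟩
    obtain ⟨θ, hθ, rfl⟩ := exists_angle 1 v 0
    rcases le_total θ Real.pi with h | h
    · exact Or.inl (mem_range_arcMap 1 hpi ⟨hθ.1, h⟩)
    · exact Or.inr (mem_range_arcMap 1 (by linarith) ⟨h, by linarith [hθ.2]⟩)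
  have hinter : A ∩ B ⊆ {p, q} := by
    rintro _ ⟨⟨s, rfl⟩, ⟨t, ht⟩⟩
    have h1 := mul_left_cancel (hi ht)
    obtain ⟨m, hm⟩ := Circle.exp_eq_exp.1 h1
    simp only [sub_zero, zero_add] at hm
    have hs := s.2
    have ht' := t.2
    -- With s, t in [0, 1] the only solutions are s = 1, t = 0 (the point q) and s = 0, t = 1 (the
    -- point p).
    have e1 : (1 : ℝ) + t = s + 2 * m := by
      have : Real.pi * (1 + t) = Real.pi * (s + 2 * m) := by linarith
      exact mul_left_cancel₀ hpi.ne' this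
    have hm0 : m = 0 ∨ m = 1 := by
      have u1 : (-1 : ℝ) < m := by linarith [hs.2, ht'.1]
      have u2 : (m : ℝ) < 2 := by linarith [hs.1, ht'.2]
      have u1' : -1 < m := by exact_mod_cast u1
      have u2' : m < 2 := by exact_mod_cast u2
      omega
    rcases hm0 with rfl | rfl
    · right
      have : (s : ℝ) = 1 := by push_cast at e1; linarith [hs.2, ht'.1]
      simp [arcMap, this, hq]
    · left
      have : (s : ℝ) = 0 := by push_cast at e1; linarith [hs.1, ht'.2]
      simp [arcMap, this, hp]
  have hjA : JoinedIn (Aᶜ)ᶜ p q := by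
    rw [compl_compl]
    refine ⟨⟨⟨arcMap γ 1 0 Real.pi, continuous_arcMap hγ _ _ _⟩, ?_, ?_⟩, fun t => ?_⟩
    · simp [arcMap, hp]
    · simp [arcMap, hq]
    · exact mem_range_self t
  have hjB : JoinedIn (Bᶜ)ᶜ p q := by
    rw [compl_compl]
    refine JoinedIn.symm ⟨⟨⟨arcMap γ 1 Real.pi (2 * Real.pi), continuous_arcMap hγ _ _ _⟩, ?_, ?_⟩,
      fun t => ?_⟩
    · simp [arcMap, hq]
    · simp [arcMap, hp]
    · exact mem_range_self t
  obtain ⟨l₁, hl₁, he₁⟩ := hasLogOn_of_joinedIn hjA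
  obtain ⟨l₂, hl₂, he₂⟩ := hasLogOn_of_joinedIn hjB
  have hoA : IsOpen Aᶜ := (isCompact_range (continuous_arcMap hγ _ _ _)).isClosed.isOpen_compl
  have hoB : IsOpen Bᶜ := (isCompact_range (continuous_arcMap hγ _ _ _)).isClosed.isOpen_compl
  have hCA : (range γ)ᶜ ⊆ Aᶜ := compl_subset_compl.2 hAC
  have hCB : (range γ)ᶜ ⊆ Bᶜ := compl_subset_compl.2 hBC
  obtain ⟨b, hb⟩ := outside_nonempty hC.isBounded
  -- The assumed connectedness of the complement of the curve enters here.
  have hdiff : ∀ z ∈ (range γ)ᶜ, l₁ z - l₂ z = l₁ b - l₂ b := fun z hz =>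
    eq_of_exp_eq_one (f := fun z => l₁ z - l₂ z) hconn ((hl₁.mono hCA).sub (hl₂.mono hCB))
      (fun z hz => by
        rw [Complex.exp_sub, he₁ z (hCA hz), he₂ z (hCB hz)]
        refine div_self (div_ne_zero ?_ ?_)
        · exact cx_sub_ne_zero fun e => hz (e ▸ mem_range_self _)
        · exact cx_sub_ne_zero fun e => hz (e ▸ mem_range_self _)) hz hb.1
  have hexpc : Complex.exp (l₁ b - l₂ b) = 1 := by
    rw [Complex.exp_sub, he₁ b (hCA hb.1), he₂ b (hCB hb.1)]
    refine div_self (div_ne_zero ?_ ?_)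
    · exact cx_sub_ne_zero fun e => hb.1 (e ▸ mem_range_self _)
    · exact cx_sub_ne_zero fun e => hb.1 (e ▸ mem_range_self _)
  classical
  let l : Plane → ℂ := fun z => if z ∈ A then l₂ z + (l₁ b - l₂ b) else l₁ z
  have hlA : ∀ z ∈ Aᶜ, l z = l₁ z := fun z hz => if_neg hz
  have hlB : ∀ z ∈ Bᶜ, l z = l₂ z + (l₁ b - l₂ b) := fun z hz => by
    by_cases hzA : z ∈ A
    · exact if_pos hzA
    · rw [hlA z hzA, ← hdiff z fun h => (hcov h).elim hzA hz]
      ring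
  have hlog : HasLogOn (fun z => (cx z - cx p) ^ (1 : ℤ) * (cx z - cx q) ^ (-1 : ℤ)) {p, q}ᶜ := by
    have hsub : ({p, q} : Set Plane)ᶜ ⊆ Aᶜ ∪ Bᶜ := by
      rw [← compl_inter]; exact compl_subset_compl.2 hinter
    refine ⟨l, fun z hz => ?_, fun z hz => ?_⟩
    · rcases hsub hz with h | h
      · refine ContinuousAt.continuousWithinAt ?_
        refine (hl₁.continuousAt (hoA.mem_nhds h)).congr ?_
        filter_upwards [hoA.mem_nhds h] with y hy
        exact (hlA y hy).symm
      · refine ContinuousAt.continuousWithinAt ?_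
        refine ((hl₂.continuousAt (hoB.mem_nhds h)).add_const (l₁ b - l₂ b)).congr ?_
        filter_upwards [hoB.mem_nhds h] with y hy
        exact (hlB y hy).symm
    · simp only [zpow_one, zpow_neg_one, ← div_eq_mul_inv]
      rcases hsub hz with h | h
      · rw [hlA z h, he₁ z h]
      · rw [hlB z h, Complex.exp_add, hexpc, mul_one, he₂ z h]
  have hd : 0 < dist q p := dist_pos.2 hpq.symm
  -- Half the distance from p to q as radius keeps q off the closed disc and both points off the
  -- circle.
  have := eq_zero_of_hasLogOn (U := Metric.ball p (dist q p / 2)) Metric.isOpen_ball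
    Metric.isBounded_ball (a := p) (b := q) (Metric.mem_ball_self (by positivity))
    (fun h => by
      have := Metric.closure_ball_subset_closedBall h
      rw [Metric.mem_closedBall] at this
      linarith) (hlog.mono fun z hz => by
      have := Metric.frontier_ball_subset_sphere hz
      rw [Metric.mem_sphere] at this
      rintro (rfl | rfl)
      · rw [dist_self] at this; linarith
      · linarith)
  exact one_ne_zero this

/-- Let z - x and z - y have degrees m and n along the curve. Then (z - x)^n (z - y)^(-m) has degree
0, hence a logarithm on the curve. If x and y were in different components, the criterion for that
of x would give n = 0; then z - y itself has a logarithm, which the criterion for the component of y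
forbids. -/
theorem connectedComponentIn_eq_of_mem_inside (hγ : Continuous γ) (hi : Function.Injective γ) {x y : Plane}
    (hx : x ∈ inside (range γ)) (hy : y ∈ inside (range γ)) :
    connectedComponentIn (range γ)ᶜ x = connectedComponentIn (range γ)ᶜ y := by
  have hC : IsCompact (range γ) := isCompact_range hγ
  by_contra hne
  have hnotin : ∀ {x y : Plane}, y ∈ inside (range γ) →
      connectedComponentIn (range γ)ᶜ x ≠ connectedComponentIn (range γ)ᶜ y →
      y ∉ closure (connectedComponentIn (range γ)ᶜ x) := by
    intro x y hy hne hcl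
    rw [closure_eq_self_union_frontier] at hcl
    rcases hcl with h | h
    · exact hne (connectedComponentIn_eq h)
    · exact hy.1 (frontier_connectedComponentIn_subset hC.isClosed x h)
  have hF : ∀ {x : Plane}, x ∈ inside (range γ) → ∀ w : Circle, cx (γ w) - cx x ≠ 0 :=
    fun {x} hx w => cx_sub_ne_zero fun e => hx.1 (e ▸ mem_range_self _)
  have hcx : ∀ x : Plane, Continuous fun w : Circle => cx (γ w) - cx x := fun x => by fun_prop
  obtain ⟨m, φ, hφ⟩ := exists_degree (hcx x) (hF hx)
  obtain ⟨n, ψ, hψ⟩ := exists_degree (hcx y) (hF hy)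
  have hlog : HasLogOn (fun z => (cx z - cx x) ^ n * (cx z - cx y) ^ (-m)) (range γ) := by
    obtain ⟨g, hg⟩ := ContinuousMap.exists_extension (hγ.isClosedEmbedding hi)
      (⟨fun w => n * φ w - m * ψ w, by fun_prop⟩ : C(Circle, ℂ))
    refine ⟨g, g.continuous.continuousOn, ?_⟩
    rintro _ ⟨w, rfl⟩
    have := congrArg (fun F => F w) hg
    simp only [ContinuousMap.comp_apply, ContinuousMap.coe_mk] at this
    simp only [this, hφ, hψ]
    rw [Complex.exp_sub, Complex.exp_int_mul, Complex.exp_int_mul, mul_zpow,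
      mul_zpow, ← zpow_mul, ← zpow_mul, zpow_neg (Complex.exp _), mul_comm n (-m), mul_comm m n]
    have hw : (w : ℂ) ^ (n * m) ≠ 0 := zpow_ne_zero _ w.coe_ne_zero
    rw [show -m * n = -(n * m) by ring, zpow_neg]
    rw [div_eq_mul_inv]
    field_simp
  have hn : n = 0 := eq_zero_of_hasLogOn hC.isClosed.isOpen_compl.connectedComponentIn hx.2
    (mem_connectedComponentIn hx.1) (hnotin hy hne)
    (hlog.mono (frontier_connectedComponentIn_subset hC.isClosed x))
  have hlog' : HasLogOn (fun z => (cx z - cx y) ^ (1 : ℤ) * (cx z - cx x) ^ (0 : ℤ))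
      (range γ) := by
    obtain ⟨g, hg⟩ := ContinuousMap.exists_extension (hγ.isClosedEmbedding hi) ψ
    refine ⟨g, g.continuous.continuousOn, ?_⟩
    rintro _ ⟨w, rfl⟩
    have := congrArg (fun F => F w) hg
    simp only [ContinuousMap.comp_apply, ContinuousMap.coe_mk] at this
    simp only [this, zpow_one, zpow_zero, mul_one, hψ, hn, one_mul]
  have := eq_zero_of_hasLogOn hC.isClosed.isOpen_compl.connectedComponentIn hy.2
    (mem_connectedComponentIn hy.1) (hnotin hx (Ne.symm hne))
    (hlog'.mono (frontier_connectedComponentIn_subset hC.isClosed y))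
  exact one_ne_zero this

/-- If a point of the curve were outside `closure W`, so would a short arc around it be, and the
frontier of W would lie in the complementary arc. That arc does not separate the plane, so W would
contain everything off it, in particular W'. -/
theorem range_subset_closure (hγ : Continuous γ) (hi : Function.Injective γ) {W W' : Set Plane} (hW : W.Nonempty) (hW' : W'.Nonempty)
    (hd : Disjoint W W') (hWC : W ⊆ (range γ)ᶜ) (hWC' : W' ⊆ (range γ)ᶜ)
    (hf : frontier W ⊆ range γ) : range γ ⊆ closure W := by
  rintro _ ⟨w, rfl⟩
  by_contra hcl
  have hc : Continuous fun θ : ℝ => γ (w * Circle.exp θ) := by fun_prop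
  have hnhds : (fun θ : ℝ => γ (w * Circle.exp θ)) ⁻¹' (closure W)ᶜ ∈ 𝓝 (0 : ℝ) := by
    refine hc.continuousAt.preimage_mem_nhds ?_
    rw [Circle.exp_zero, mul_one]
    exact isClosed_closure.isOpen_compl.mem_nhds hcl
  obtain ⟨ε, hε, hball⟩ := Metric.mem_nhds_iff.1 hnhds
  have hpi := Real.pi_pos
  set δ := min (ε / 2) (Real.pi / 2) with hδ
  have hδ0 : 0 < δ := lt_min (by linarith) (by linarith)
  have hδε : δ < ε := lt_of_le_of_lt (min_le_left _ _) (by linarith)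
  have hδπ : δ ≤ Real.pi / 2 := min_le_right _ _
  have harc := isConnected_compl_arc (continuous_arcMap hγ w δ (2 * Real.pi - δ))
    (injective_arcMap hi w (by linarith) (by linarith))
  have hsub : range (arcMap γ w δ (2 * Real.pi - δ)) ⊆ range γ := by
    rintro _ ⟨s, rfl⟩; exact mem_range_self _
  have hfront : frontier W ⊆ range (arcMap γ w δ (2 * Real.pi - δ)) := by
    intro z hz
    obtain ⟨v, rfl⟩ := hf hz
    obtain ⟨θ, hθ, rfl⟩ := exists_angle w v (-δ)
    have hθδ : δ ≤ θ := by
      by_contra h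
      push Not at h
      have := hball (a := θ) (by
        rw [Metric.mem_ball, Real.dist_eq, sub_zero, abs_lt]
        exact ⟨by linarith [hθ.1], by linarith⟩)
      exact this hz.1
    exact mem_range_arcMap w (by linarith) ⟨hθδ, by linarith [hθ.2]⟩
  obtain ⟨x, hx⟩ := hW
  obtain ⟨y, hy⟩ := hW'
  have := subset_of_disjoint_frontier harc.isPreconnected (u := W)
    ⟨x, fun h => hWC hx (hsub h), hx⟩ (disjoint_left.2 fun z hz hz' => hz (hfront hz'))
  exact disjoint_left.1 hd (this fun h => hWC' hy (hsub h)) hy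

end JordanCurve

namespace IsSimpleClosedCurve

variable {C : Set Plane}

protected theorem isCompact (hC : IsSimpleClosedCurve C) : IsCompact C := by
  obtain ⟨γ, hγ, -, rfl⟩ := hC
  exact isCompact_range hγ

protected theorem isConnected (hC : IsSimpleClosedCurve C) : IsConnected C := by
  obtain ⟨γ, hγ, -, rfl⟩ := hC
  have : ConnectedSpace Circle := by
    have hs : range Circle.exp = univ :=
      Set.range_eq_univ.2 fun w => ⟨Complex.arg w, Circle.exp_arg w⟩
    rw [connectedSpace_iff_univ, ← hs]
    exact isConnected_range Circle.exp.continuous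
  exact isConnected_range hγ

theorem isBounded (hC : IsSimpleClosedCurve C) : Bornology.IsBounded C := hC.isCompact.isBounded

protected theorem isClosed (hC : IsSimpleClosedCurve C) : IsClosed C := hC.isCompact.isClosed

theorem inside_nonempty (hC : IsSimpleClosedCurve C) : (inside C).Nonempty := by
  obtain ⟨γ, hγ, hi, rfl⟩ := hC
  exact exists_inside_of_simple hγ hi

theorem inside_eq_connectedComponentIn (hC : IsSimpleClosedCurve C) {x : Plane} (hx : x ∈ inside C) :
    inside C = connectedComponentIn Cᶜ x := by
  obtain ⟨γ, hγ, hi, rfl⟩ := hC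
  refine Subset.antisymm (fun y hy => ?_) (connectedComponentIn_subset_inside hx)
  rw [← connectedComponentIn_eq_of_mem_inside hγ hi hy hx]
  exact mem_connectedComponentIn hy.1

/-- The Jordan curve theorem: the interior of a simple closed curve is connected. -/
theorem isConnected_inside (hC : IsSimpleClosedCurve C) : IsConnected (inside C) := by
  obtain ⟨x, hx⟩ := hC.inside_nonempty
  rw [hC.inside_eq_connectedComponentIn hx, isConnected_connectedComponentIn_iff]
  exact hx.1

theorem subset_closure_inside (hC : IsSimpleClosedCurve C) : C ⊆ closure (inside C) := by
  have h := hC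
  obtain ⟨γ, hγ, hi, rfl⟩ := hC
  exact range_subset_closure hγ hi h.inside_nonempty (outside_nonempty h.isBounded)
    disjoint_inside_outside (fun x hx => hx.1) (fun x hx => hx.1) (frontier_inside_subset h.isClosed)

theorem subset_closure_outside (hC : IsSimpleClosedCurve C) : C ⊆ closure (outside C) := by
  have h := hC
  obtain ⟨γ, hγ, hi, rfl⟩ := hC
  exact range_subset_closure hγ hi (outside_nonempty h.isBounded) h.inside_nonempty
    disjoint_inside_outside.symm (fun x hx => hx.1) (fun x hx => hx.1)
    (frontier_outside_subset h.isClosed)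

theorem frontier_inside (hC : IsSimpleClosedCurve C) : frontier (inside C) = C := by
  refine (frontier_inside_subset hC.isClosed).antisymm fun x hx => ?_
  rw [(isOpen_inside hC.isClosed).frontier_eq]
  exact ⟨hC.subset_closure_inside hx, fun h => h.1 hx⟩

theorem closure_inside (hC : IsSimpleClosedCurve C) : closure (inside C) = inside C ∪ C := by
  rw [closure_eq_self_union_frontier, hC.frontier_inside]

theorem closure_outside (hC : IsSimpleClosedCurve C) : closure (outside C) = outside C ∪ C := by
  rw [closure_eq_self_union_frontier]
  refine Subset.antisymm (union_subset_union_right _ (frontier_outside_subset hC.isClosed)) ?_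
  rw [← closure_eq_self_union_frontier]
  exact union_subset subset_closure hC.subset_closure_outside

end IsSimpleClosedCurve

/-- Two points in different components of the complement of a finite disjoint union of compact sets
are in different components of the complement of one of them. -/
theorem exists_separating {ι : Type*} [Finite ι] {J : ι → Set Plane} (hJ : ∀ i, IsCompact (J i))
    (hd : Pairwise (Function.onFun Disjoint J)) {a b : Plane} (ha : a ∉ ⋃ i, J i)
    (hb : b ∉ ⋃ i, J i)
    (hU : Bornology.IsBounded (connectedComponentIn (⋃ i, J i)ᶜ a))
    (hab : connectedComponentIn (⋃ i, J i)ᶜ a ≠ connectedComponentIn (⋃ i, J i)ᶜ b) :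
    ∃ i, connectedComponentIn (J i)ᶜ a ≠ connectedComponentIn (J i)ᶜ b := by
  classical
  -- If no J i separates a from b, then (z - a)/(z - b) has a logarithm on each J i. By disjointness
  -- these paste to a logarithm on the union, against the criterion for the bounded component of a.
  by_contra! hall
  have hK : IsClosed (⋃ i, J i) := isClosed_iUnion_of_finite fun i => (hJ i).isClosed
  have hlog : ∀ i, HasLogOn (fun z => (cx z - cx a) / (cx z - cx b)) (J i) := fun i => by
    refine hasLogOn_of_joinedIn ?_
    have hai : a ∈ (J i)ᶜ := fun h => ha (mem_iUnion.2 ⟨i, h⟩)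
    have hbi : b ∈ (J i)ᶜ := fun h => hb (mem_iUnion.2 ⟨i, h⟩)
    have ho : IsOpen (connectedComponentIn (J i)ᶜ a) :=
      (hJ i).isClosed.isOpen_compl.connectedComponentIn
    have hpc := ho.isConnected_iff_isPathConnected.1 (isConnected_connectedComponentIn_iff.2 hai)
    refine (hpc.joinedIn a (mem_connectedComponentIn hai) b ?_).mono
      (connectedComponentIn_subset _ _)
    rw [hall i]
    exact mem_connectedComponentIn hbi
  choose l hl he using hlog
  have huniq : ∀ {i j z}, z ∈ J i → z ∈ J j → i = j := fun {i j z} h h' => by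
    by_contra hij
    exact disjoint_left.1 (hd hij) h h'
  have hlogK : HasLogOn (fun z => (cx z - cx a) ^ (1 : ℤ) * (cx z - cx b) ^ (-1 : ℤ))
      (⋃ i, J i) := by
    let L : Plane → ℂ := fun z => if h : ∃ i, z ∈ J i then l h.choose z else 0
    have hL : ∀ i, ∀ z ∈ J i, L z = l i z := fun i z hz => by
      have h : ∃ i, z ∈ J i := ⟨i, hz⟩
      simp only [L, dif_pos h]
      rw [huniq h.choose_spec hz]
    refine ⟨L, ?_, fun z hz => ?_⟩
    · refine LocallyFinite.continuousOn_iUnion (locallyFinite_of_finite J)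
        (fun i => (hJ i).isClosed) fun i => (hl i).congr (hL i)
    · obtain ⟨i, hi⟩ := mem_iUnion.1 hz
      simp only [hL i z hi, he i z hi, zpow_one, zpow_neg_one, div_eq_mul_inv]
  have := eq_zero_of_hasLogOn hK.isOpen_compl.connectedComponentIn hU (mem_connectedComponentIn ha)
    (b := b) (fun h => by
      rw [closure_eq_self_union_frontier] at h
      rcases h with h | h
      · exact hab (connectedComponentIn_eq h)
      · exact hb (frontier_connectedComponentIn_subset hK a h))
    (hlogK.mono (frontier_connectedComponentIn_subset hK a))
  exact one_ne_zero this

/-! ### Closed polygons as simple closed curves. -/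

section Polygon

/-- The piecewise linear path through the points `p i`. -/
noncomputable def polyPath (p : ℤ → Plane) (x : ℝ) : Plane :=
  AffineMap.lineMap (p ⌊x⌋) (p (⌊x⌋ + 1)) (Int.fract x)

theorem polyPath_eq {p : ℤ → Plane} {i : ℤ} {x : ℝ} (hx : x ∈ Icc (i : ℝ) (i + 1)) :
    polyPath p x = AffineMap.lineMap (p i) (p (i + 1)) (x - i) := by
  rcases hx.2.eq_or_lt with h | h
  · have : ⌊x⌋ = i + 1 := by rw [h]; exact_mod_cast Int.floor_intCast (i + 1)
    rw [polyPath, this, Int.fract, this, h]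
    simp
  · have : ⌊x⌋ = i := Int.floor_eq_iff.2 ⟨hx.1, h⟩
    rw [polyPath, Int.fract, this]

theorem continuous_polyPath (p : ℤ → Plane) : Continuous (polyPath p) := by
  have hlf : LocallyFinite fun i : ℤ => Icc (i : ℝ) (i + 1) := fun x => by
    refine ⟨Ioo (x - 1) (x + 1), Ioo_mem_nhds (by linarith) (by linarith), ?_⟩
    refine (finite_Icc (⌊x⌋ - 2) (⌊x⌋ + 2)).subset ?_
    rintro i ⟨y, hy1, hy2⟩
    have h1 := Int.floor_le x
    have h2 := Int.lt_floor_add_one x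
    have u1 : (i : ℝ) < ⌊x⌋ + 2 := by linarith [hy1.1, hy2.2]
    have u2 : (⌊x⌋ : ℝ) - 2 < i := by linarith [hy1.2, hy2.1]
    have u1' : i < ⌊x⌋ + 2 := by exact_mod_cast u1
    have u2' : ⌊x⌋ - 2 < i := by exact_mod_cast u2
    exact ⟨u2'.le, u1'.le⟩
  refine hlf.continuous (iUnion_eq_univ_iff.2 fun x => ⟨⌊x⌋, Int.floor_le x,
    (Int.lt_floor_add_one x).le⟩) (fun i => isClosed_Icc) fun i => ?_
  refine ContinuousOn.congr (f := fun x : ℝ => AffineMap.lineMap (p i) (p (i + 1)) (x - i)) ?_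
    fun x hx => polyPath_eq hx
  exact Continuous.continuousOn (AffineMap.lineMap_continuous.comp (by fun_prop))

/-- A closed polygon without self-intersections is a simple closed curve. -/
theorem isSimpleClosedCurve_polygon {p : ℤ → Plane} {n : ℕ} (hn : 0 < n)
    (hp : ∀ i, p (i + n) = p i)
    (hinj : ∀ i ∈ Ico (0 : ℤ) n, ∀ j ∈ Ico (0 : ℤ) n, ∀ u ∈ Ico (0 : ℝ) 1, ∀ v ∈ Ico (0 : ℝ) 1,
      AffineMap.lineMap (p i) (p (i + 1)) u = AffineMap.lineMap (p j) (p (j + 1)) v →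
        i = j ∧ u = v) :
    IsSimpleClosedCurve (⋃ i, segment ℝ (p i) (p (i + 1))) := by
  have hpi := Real.pi_pos
  have hn' : (0 : ℝ) < n := by exact_mod_cast hn
  let ψ : ℝ → Plane := fun θ => polyPath p (n / (2 * Real.pi) * θ)
  have hψ : Continuous ψ := (continuous_polyPath p).comp (by fun_prop)
  have hperp : ∀ x, polyPath p (x + n) = polyPath p x := fun x => by
    simp only [polyPath, Int.floor_add_natCast, Int.fract_add_natCast, hp]
    rw [show ⌊x⌋ + (n : ℤ) + 1 = ⌊x⌋ + 1 + n by ring, hp]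
  have hper : Function.Periodic ψ (2 * Real.pi) := fun θ => by
    simp only [ψ]
    rw [mul_add, div_mul_cancel₀ _ (by positivity), hperp]
  obtain ⟨φ, hφ, hφψ⟩ := exists_circle_lift hψ hper
  refine ⟨φ, hφ, ?_, ?_⟩
  · intro w w' hww
    obtain ⟨θ, hθ, rfl⟩ := exists_angle 1 w 0
    obtain ⟨θ', hθ', rfl⟩ := exists_angle 1 w' 0
    simp only [one_mul] at hww ⊢
    rw [hφψ, hφψ] at hww
    simp only [ψ] at hww
    have hrange : ∀ θ ∈ Ico (0 : ℝ) (0 + 2 * Real.pi),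
        ⌊n / (2 * Real.pi) * θ⌋ ∈ Ico (0 : ℤ) n := fun θ hθ => by
      have h0 : 0 ≤ n / (2 * Real.pi) * θ := mul_nonneg (by positivity) hθ.1
      refine ⟨Int.floor_nonneg.2 h0, Int.floor_lt.2 ?_⟩
      have : n / (2 * Real.pi) * θ < n / (2 * Real.pi) * (2 * Real.pi) :=
        mul_lt_mul_of_pos_left (by linarith [hθ.2]) (by positivity)
      rw [div_mul_cancel₀ _ (by positivity)] at this
      exact_mod_cast this
    obtain ⟨h1, h2⟩ := hinj _ (hrange θ hθ) _ (hrange θ' hθ') _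
      ⟨Int.fract_nonneg _, Int.fract_lt_one _⟩ _ ⟨Int.fract_nonneg _, Int.fract_lt_one _⟩ hww
    have h3 : n / (2 * Real.pi) * θ = n / (2 * Real.pi) * θ' := by
      rw [← Int.floor_add_fract (n / (2 * Real.pi) * θ), h1, h2, Int.floor_add_fract]
    rw [mul_left_cancel₀ (by positivity) h3]
  · ext z
    simp only [mem_range, mem_iUnion]
    constructor
    · rintro ⟨w, rfl⟩
      obtain ⟨θ, hθ, rfl⟩ := exists_angle 1 w 0
      refine ⟨⌊n / (2 * Real.pi) * θ⌋, ?_⟩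
      rw [one_mul, hφψ, segment_eq_image_lineMap]
      exact ⟨_, ⟨Int.fract_nonneg _, (Int.fract_lt_one _).le⟩, rfl⟩
    · rintro ⟨i, hz⟩
      rw [segment_eq_image_lineMap] at hz
      obtain ⟨u, hu, rfl⟩ := hz
      refine ⟨Circle.exp (2 * Real.pi / n * (i + u)), ?_⟩
      rw [hφψ]
      simp only [ψ]
      have : (n : ℝ) / (2 * Real.pi) * (2 * Real.pi / n * (i + u)) = i + u := by
        field_simp
      rw [this, polyPath_eq (i := i) ⟨by linarith [hu.1], by linarith [hu.2]⟩]
      simp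

end Polygon

/-! ### Local structure of planar simplicial complexes. -/

section PlanarComplex

open scoped Classical

/-- The closed simplex spanned by a finite set of points. -/
abbrev hull (s : Finset Plane) : Set Plane := convexHull ℝ (s : Set Plane)

/-- The open simplex spanned by a finite set of points. -/
def openHull (s : Finset Plane) : Set Plane :=
  {x | ∃ w : Plane → ℝ, (∀ v ∈ s, 0 < w v) ∧ ∑ v ∈ s, w v = 1 ∧ ∑ v ∈ s, w v • v = x}

theorem openHull_subset_hull (s : Finset Plane) : openHull s ⊆ hull s := by
  rintro x ⟨w, h0, h1, h2⟩
  exact Finset.mem_convexHull'.2 ⟨w, fun v hv => (h0 v hv).le, h1, h2⟩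

theorem isClosed_hull (s : Finset Plane) : IsClosed (hull s) :=
  (s.finite_toSet.isCompact_convexHull ℝ).isClosed

/-- Discard the vertices of weight zero. -/
theorem exists_mem_openHull {s : Finset Plane} {x : Plane} (hx : x ∈ hull s) :
    ∃ t ⊆ s, t.Nonempty ∧ x ∈ openHull t := by
  obtain ⟨w, h0, h1, h2⟩ := Finset.mem_convexHull'.1 hx
  have hz : ∀ v ∈ s, v ∉ s.filter (fun v => w v ≠ 0) → w v = 0 := fun v hv h => by
    by_contra h'
    exact h (Finset.mem_filter.2 ⟨hv, h'⟩)
  have h1' : ∑ v ∈ s.filter (fun v => w v ≠ 0), w v = 1 := by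
    rw [← h1]
    exact Finset.sum_subset (Finset.filter_subset _ _) hz
  refine ⟨s.filter (fun v => w v ≠ 0), Finset.filter_subset _ _, ?_, w, fun v hv => ?_, h1', ?_⟩
  · by_contra he
    rw [Finset.not_nonempty_iff_eq_empty] at he
    rw [he] at h1'
    simp at h1'
  · rw [Finset.mem_filter] at hv
    exact lt_of_le_of_ne (h0 v hv.1) (Ne.symm hv.2)
  · rw [← h2]
    exact Finset.sum_subset (Finset.filter_subset _ _) fun v hv h => by rw [hz v hv h, zero_smul]

theorem mem_openHull_pair {a b x : Plane} (hab : a ≠ b) :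
    x ∈ openHull {a, b} ↔ x ∈ openSegment ℝ a b := by
  constructor
  · rintro ⟨w, h0, h1, h2⟩
    rw [Finset.sum_pair hab] at h1 h2
    exact ⟨w a, w b, h0 a (by simp), h0 b (by simp), h1, h2⟩
  · rintro ⟨u, v, hu, hv, h1, h2⟩
    refine ⟨fun z => if z = a then u else v, fun z _ => ?_, ?_, ?_⟩
    · by_cases h : z = a <;> simp [h, hu, hv]
    · rw [Finset.sum_pair hab]; simpa [hab.symm] using h1
    · rw [Finset.sum_pair hab]; simpa [hab.symm] using h2

theorem hull_pair (a b : Plane) : hull {a, b} = segment ℝ a b := by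
  rw [hull, Finset.coe_pair, convexHull_pair]

/-- A function that is affine along the segments of `hull s` is affine on `hull s`. -/
theorem affine_sum {s : Finset Plane} {g : Plane → ℝ}
    (hg : ∀ x ∈ hull s, ∀ y ∈ hull s, ∀ a b : ℝ, 0 ≤ a → 0 ≤ b → a + b = 1 →
      g (a • x + b • y) = a * g x + b * g y)
    {w : Plane → ℝ} (h0 : ∀ v ∈ s, 0 ≤ w v) (h1 : ∑ v ∈ s, w v = 1) :
    g (∑ v ∈ s, w v • v) = ∑ v ∈ s, w v * g v := by
  -- Affine along segments means convex and concave; Jensen's inequality in both directions gives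
  -- the equality.
  have hc : ConvexOn ℝ (hull s) g := ⟨convex_convexHull ℝ _, fun x hx y hy a b ha hb hab => by
    rw [hg x hx y hy a b ha hb hab]; rfl⟩
  have hc' : ConcaveOn ℝ (hull s) g := ⟨convex_convexHull ℝ _, fun x hx y hy a b ha hb hab => by
    rw [hg x hx y hy a b ha hb hab]; rfl⟩
  have hs : ∀ v ∈ s, v ∈ hull s := fun v hv => subset_convexHull ℝ _ hv
  exact le_antisymm (hc.map_sum_le h0 h1 hs) (hc'.le_map_sum h0 h1 hs)

theorem affineMap_sum (f : Plane →ᵃ[ℝ] ℝ) {s : Finset Plane} {w : Plane → ℝ}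
    (h1 : ∑ v ∈ s, w v = 1) : f (∑ v ∈ s, w v • v) = ∑ v ∈ s, w v * f v := by
  have hf : ∀ x, f x = f.linear x + f 0 := fun x => congrFun f.decomp x
  have hr : ∑ v ∈ s, w v * f v = ∑ v ∈ s, w v * f.linear v + (∑ v ∈ s, w v) * f 0 := by
    rw [Finset.sum_mul, ← Finset.sum_add_distrib]
    exact Finset.sum_congr rfl fun v _ => by rw [hf v]; ring
  rw [hr, h1, one_mul, hf, map_sum]
  congr 1
  exact Finset.sum_congr rfl fun v _ => by rw [map_smul, smul_eq_mul]

/-- `l` are the barycentric coordinates of the triangle `s`. -/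
structure IsBary (s : Finset Plane) (l : Plane → Plane →ᵃ[ℝ] ℝ) : Prop where
  sum_one : ∀ x, ∑ v ∈ s, l v x = 1
  sum_smul : ∀ x, ∑ v ∈ s, l v x • v = x
  self : ∀ v ∈ s, l v v = 1
  other : ∀ u ∈ s, ∀ v ∈ s, u ≠ v → l v u = 0

/-- In the plane three affinely independent points form an affine basis, so the coordinates are
defined beyond the triangle; their signs tell the sides of its edges. -/
theorem exists_isBary {s : Finset Plane} (hs : AffineIndependent ℝ ((↑) : s → Plane))
    (hc : s.card = 3) : ∃ l, IsBary s l := by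
  have htop := hs.affineSpan_eq_top_iff_card_eq_finrank_add_one.2 (by simp [hc])
  let b : AffineBasis s ℝ Plane := ⟨(↑), hs, htop⟩
  have hb : ∀ v : s, b v = (v : Plane) := fun v => rfl
  let l : Plane → Plane →ᵃ[ℝ] ℝ := fun v => if h : v ∈ s then b.coord ⟨v, h⟩ else 0
  have hl : ∀ v : s, l v = b.coord v := fun v => by simp [l]
  refine ⟨l, fun x => ?_, fun x => ?_, fun v hv => ?_, fun u hu v hv huv => ?_⟩
  · rw [← Finset.sum_coe_sort s]
    simp_rw [hl]
    exact b.sum_coord_apply_eq_one x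
  · rw [← Finset.sum_coe_sort s]
    simp_rw [hl]
    exact b.linear_combination_coord_eq_self x
  · have := b.coord_apply_eq ⟨v, hv⟩
    rwa [← hl, hb] at this
  · have := b.coord_apply ⟨v, hv⟩ ⟨u, hu⟩
    rw [← hl, hb, if_neg fun h => huv (congrArg Subtype.val h).symm] at this
    exact this

namespace IsBary

variable {s : Finset Plane} {l : Plane → Plane →ᵃ[ℝ] ℝ}

theorem coord_sum (h : IsBary s l) {w : Plane → ℝ} (h1 : ∑ v ∈ s, w v = 1) {u : Plane}
    (hu : u ∈ s) : l u (∑ v ∈ s, w v • v) = w u := by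
  rw [affineMap_sum _ h1, Finset.sum_eq_single_of_mem u hu fun v hv hvu => by
    rw [h.other v hv u hu hvu, mul_zero], h.self u hu, mul_one]

theorem mem_hull (h : IsBary s l) {x : Plane} : x ∈ hull s ↔ ∀ v ∈ s, 0 ≤ l v x := by
  constructor
  · intro hx v hv
    obtain ⟨w, h0, h1, rfl⟩ := Finset.mem_convexHull'.1 hx
    rw [h.coord_sum h1 hv]
    exact h0 v hv
  · intro hx
    exact Finset.mem_convexHull'.2 ⟨fun v => l v x, hx, h.sum_one x, h.sum_smul x⟩

theorem mem_openHull (h : IsBary s l) {x : Plane} : x ∈ openHull s ↔ ∀ v ∈ s, 0 < l v x := by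
  constructor
  · rintro ⟨w, h0, h1, rfl⟩ v hv
    rw [h.coord_sum h1 hv]
    exact h0 v hv
  · intro hx
    exact ⟨fun v => l v x, hx, h.sum_one x, h.sum_smul x⟩

theorem continuous (_ : IsBary s l) (v : Plane) : Continuous (l v) :=
  (l v).continuous_of_finiteDimensional

theorem isOpen_openHull (h : IsBary s l) : IsOpen (openHull s) := by
  have : openHull s = ⋂ v ∈ s, {x | 0 < l v x} := by
    ext x
    rw [h.mem_openHull]
    simp
  rw [this]
  exact isOpen_biInter_finset fun v _ => isOpen_lt continuous_const (h.continuous v)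

theorem affineMap_eq (h : IsBary s l) (f : Plane →ᵃ[ℝ] ℝ) (x : Plane) :
    f x = ∑ v ∈ s, l v x * f v := by
  conv_lhs => rw [← h.sum_smul x]
  exact affineMap_sum f (h.sum_one x)

end IsBary

theorem exists_third {e s : Finset Plane} (he : e.card = 2) (hs : s.card = 3) (hes : e ⊆ s) :
    ∃ d, d ∉ e ∧ s = insert d e := by
  have h1 : (s \ e).card = 1 := by
    rw [Finset.card_sdiff_of_subset hes]; omega
  obtain ⟨d, hd⟩ := Finset.card_eq_one.1 h1
  have hd' : d ∈ s \ e := by rw [hd]; simp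
  rw [Finset.mem_sdiff] at hd'
  refine ⟨d, hd'.2, ?_⟩
  rw [Finset.insert_eq, ← hd, Finset.sdiff_union_of_subset hes]

variable {K : Geometry.SimplicialComplex ℝ Plane}

theorem weights_eq_zero {s : Finset Plane} (hs : s ∈ K.faces) {w : Plane → ℝ}
    (h1 : ∑ v ∈ s, w v = 0) (h2 : ∑ v ∈ s, w v • v = 0) : ∀ v ∈ s, w v = 0 := by
  intro v hv
  have := affineIndependent_iff.1 (K.indep hs) Finset.univ (fun v => w v)
    (by rw [← h1]; exact Finset.sum_coe_sort s w)
    (by rw [← h2]; exact Finset.sum_coe_sort s fun v => w v • v) ⟨v, hv⟩ (Finset.mem_univ _)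
  exact this

theorem hull_inter {s t : Finset Plane} (hs : s ∈ K.faces) (ht : t ∈ K.faces) {x : Plane}
    (hxs : x ∈ hull s) (hxt : x ∈ hull t) : x ∈ hull (s ∩ t) := by
  have := K.inter_subset_convexHull hs ht ⟨hxs, hxt⟩
  rwa [hull, Finset.coe_inter]

/-- A face that meets the relative interior of `f` contains `f`. -/
theorem subset_of_mem_openHull {f s : Finset Plane} (hf : f ∈ K.faces) (hs : s ∈ K.faces)
    {x : Plane} (hxf : x ∈ openHull f) (hxs : x ∈ hull s) : f ⊆ s := by
  have hx := hull_inter hf hs (openHull_subset_hull f hxf) hxs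
  obtain ⟨w, h0, h1, h2⟩ := hxf
  obtain ⟨w', h0', h1', h2'⟩ := Finset.mem_convexHull'.1 hx
  intro v hv
  by_contra hvs
  -- Extended by zero, the weights over f ∩ s give a second representation of x over f. Uniqueness
  -- makes the positive weight at v vanish.
  let w'' : Plane → ℝ := fun u => if u ∈ f ∩ s then w' u else 0
  have e1 : ∑ u ∈ f, w'' u = 1 := by
    rw [← h1', ← Finset.sum_subset (Finset.inter_subset_left (s₁ := f) (s₂ := s))
      fun u _ hu => by simp only [w'', if_neg hu]]
    exact Finset.sum_congr rfl fun u hu => by simp only [w'', if_pos hu]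
  have e2 : ∑ u ∈ f, w'' u • u = x := by
    rw [← h2', ← Finset.sum_subset (Finset.inter_subset_left (s₁ := f) (s₂ := s))
      fun u _ hu => by simp only [w'', if_neg hu, zero_smul]]
    exact Finset.sum_congr rfl fun u hu => by simp only [w'', if_pos hu]
  have := weights_eq_zero hf (w := fun u => w u - w'' u)
    (by rw [Finset.sum_sub_distrib, h1, e1, sub_self])
    (by simp_rw [sub_smul]; rw [Finset.sum_sub_distrib, h2, e2, sub_self]) v hv
  have hw'' : w'' v = 0 := if_neg fun h => hvs (Finset.mem_inter.1 h).2
  simp only [hw'', sub_zero] at this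
  exact (h0 v hv).ne' this

theorem card_le_three {s : Finset Plane} (hs : s ∈ K.faces) : s.card ≤ 3 := by
  have h1 := (K.indep hs).card_le_finrank_succ
  have h2 := Submodule.finrank_le (vectorSpan ℝ (range ((↑) : s → Plane)))
  rw [finrank_euclideanSpace_fin] at h2
  rw [Fintype.card_coe] at h1
  omega

theorem volume_hull_eq_zero {s : Finset Plane} (hs : s ∈ K.faces) (hc : s.card ≤ 2) :
    MeasureTheory.volume (hull s) = 0 := by
  have hne : affineSpan ℝ (range ((↑) : s → Plane)) ≠ ⊤ := fun h => by
    have := (K.indep hs).affineSpan_eq_top_iff_card_eq_finrank_add_one.1 h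
    rw [finrank_euclideanSpace_fin, Fintype.card_coe] at this
    omega
  refine MeasureTheory.measure_mono_null ?_
    (MeasureTheory.Measure.addHaar_affineSubspace MeasureTheory.volume _ hne)
  rw [Subtype.range_coe]
  exact convexHull_subset_affineSpan _

/-- Every point of an open subset of the complex lies in a triangle. -/
theorem exists_triangle (hfin : K.faces.Finite) {O : Set Plane} (hO : IsOpen O)
    (hOK : O ⊆ K.space) {x : Plane} (hx : x ∈ closure O) :
    ∃ s ∈ K.faces, s.card = 3 ∧ x ∈ hull s := by
  have hTfin : {s | s ∈ K.faces ∧ s.card = 3}.Finite := hfin.subset fun s hs => hs.1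
  have hTc : IsClosed (⋃ s ∈ {s | s ∈ K.faces ∧ s.card = 3}, hull s) :=
    hTfin.isClosed_biUnion fun s _ => isClosed_hull s
  -- The points of O off all triangles form an open set covered by finitely many segments and
  -- points. It has measure zero, so it is empty.
  have hsub : O ⊆ ⋃ s ∈ {s | s ∈ K.faces ∧ s.card = 3}, hull s := by
    by_contra hnot
    have hne : (O \ ⋃ s ∈ {s | s ∈ K.faces ∧ s.card = 3}, hull s).Nonempty :=
      sdiff_nonempty.2 hnot
    have ho := hO.sdiff hTc
    refine (ho.measure_pos MeasureTheory.volume hne).ne' ?_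
    have hnull : MeasureTheory.volume (⋃ s ∈ {s | s ∈ K.faces ∧ s.card ≤ 2}, hull s) = 0 :=
      (MeasureTheory.measure_biUnion_null_iff (hfin.subset fun s hs => hs.1).countable).2
        fun s hs => volume_hull_eq_zero hs.1 hs.2
    refine MeasureTheory.measure_mono_null ?_ hnull
    rintro y ⟨hyO, hyT⟩
    obtain ⟨s, hs, hys⟩ := Geometry.SimplicialComplex.mem_space_iff.1 (hOK hyO)
    refine mem_biUnion (x := s) ⟨hs, ?_⟩ hys
    have h3 := card_le_three hs
    have : s.card ≠ 3 := fun h => hyT (mem_biUnion (x := s) ⟨hs, h⟩ hys)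
    omega
  have := closure_minimal hsub hTc hx
  simp only [mem_iUnion] at this
  obtain ⟨s, hs, hxs⟩ := this
  exact ⟨s, hs.1, hs.2, hxs⟩

/-- Near `p` there are only the faces that contain `p`. -/
theorem eventually_mem_hull (hfin : K.faces.Finite) (p : Plane) :
    ∀ᶠ x in 𝓝 p, ∀ s ∈ K.faces, x ∈ hull s → p ∈ hull s := by
  rw [Filter.eventually_all_finite hfin]
  intro s _
  by_cases h : p ∈ hull s
  · exact Filter.Eventually.of_forall fun _ _ => h
  · filter_upwards [(isClosed_hull s).isOpen_compl.mem_nhds h] with x hx hx'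
    exact absurd hx' hx

/-- Two triangles on the same side of a common edge coincide. -/
theorem eq_of_same_side {e s s' : Finset Plane} {d d' : Plane} {l : Plane → Plane →ᵃ[ℝ] ℝ}
    (he : e.card = 2) (hs : s ∈ K.faces) (hs' : s' ∈ K.faces) (hd : d ∉ e) (hd' : d' ∉ e)
    (hse : s = insert d e) (hse' : s' = insert d' e) (hl : IsBary s l) (hpos : 0 < l d d') :
    s = s' := by
  have hes : e ⊆ s := hse ▸ Finset.subset_insert _ _
  -- The weight is ε at d' and equal at the two ends of e, so y ε tends to the midpoint of e. For
  -- small ε > 0 it lies in the interior of s' and, as d' is on the side of d, also in s.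
  let y : ℝ → Plane := fun ε => ∑ v ∈ s', (if v = d' then ε else (1 - ε) / 2) • v
  have hw : ∀ ε : ℝ, ∑ v ∈ s', (if v = d' then ε else (1 - ε) / 2) = 1 := fun ε => by
    rw [hse', Finset.sum_insert hd', if_pos rfl, Finset.sum_congr rfl (g := fun _ => (1 - ε) / 2)
      fun v hv => if_neg (ne_of_mem_of_not_mem hv hd'), Finset.sum_const, he]
    simp; ring
  have hly : ∀ ε : ℝ, ∀ v, l v (y ε) = ε * l v d' + ∑ u ∈ e, (1 - ε) / 2 * l v u := fun ε v => by
    simp only [y]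
    rw [affineMap_sum _ (hw ε), hse', Finset.sum_insert hd', if_pos rfl]
    congr 1
    exact Finset.sum_congr rfl fun u hu => by rw [if_neg (ne_of_mem_of_not_mem hu hd')]
  have hle : ∀ ε : ℝ, ∀ v ∈ e, l v (y ε) = ε * l v d' + (1 - ε) / 2 := fun ε v hv => by
    rw [hly, Finset.sum_eq_single_of_mem v hv fun u hu huv => by
      rw [hl.other u (hes hu) v (hes hv) huv, mul_zero], hl.self v (hes hv), mul_one]
  have hld : ∀ ε : ℝ, l d (y ε) = ε * l d d' := fun ε => by
    rw [hly, Finset.sum_eq_zero fun u hu => by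
      rw [hl.other u (hes hu) d (hse ▸ Finset.mem_insert_self _ _) fun h => hd (h ▸ hu), mul_zero],
      add_zero]
  have hev : ∀ᶠ ε in 𝓝[>] (0 : ℝ), ε < 1 ∧ ∀ v ∈ e, 0 < ε * l v d' + (1 - ε) / 2 := by
    refine ((gt_mem_nhds one_pos).filter_mono nhdsWithin_le_nhds).and
      ((Filter.eventually_all_finset e).2 fun v _ => ?_)
    refine (ContinuousAt.eventually_lt (f := fun _ : ℝ => (0 : ℝ)) (x₀ := (0 : ℝ))
      (g := fun ε => ε * l v d' + (1 - ε) / 2) continuousAt_const (by fun_prop)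
      (by norm_num)).filter_mono nhdsWithin_le_nhds
  obtain ⟨ε, ⟨hε1, hε⟩, hε0⟩ := (hev.and self_mem_nhdsWithin).exists
  have hε0' : 0 < ε := hε0
  have hys : y ε ∈ hull s := hl.mem_hull.2 fun v hv => by
    rw [hse, Finset.mem_insert] at hv
    rcases hv with rfl | hv
    · rw [hld]; positivity
    · rw [hle ε v hv]; exact (hε v hv).le
  have hys' : y ε ∈ openHull s' := by
    refine ⟨_, fun v _ => ?_, hw ε, rfl⟩
    split_ifs
    · exact hε0'
    · linarith
  have hsub := subset_of_mem_openHull hs' hs hys' hys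
  refine (Finset.eq_of_subset_of_card_le hsub ?_).symm
  rw [hse, hse', Finset.card_insert_of_notMem hd, Finset.card_insert_of_notMem hd']

/-- Otherwise d' would be an affine combination of the points of e, against the independence of
`insert d' e`. -/
theorem third_coord_ne_zero {e s : Finset Plane} {d d' : Plane} {l : Plane → Plane →ᵃ[ℝ] ℝ}
    (hd : d ∉ e) (hd' : d' ∉ e) (hse : s = insert d e) (hs' : insert d' e ∈ K.faces)
    (hl : IsBary s l) : l d d' ≠ 0 := by
  intro h0
  have h1 := hl.sum_one d'
  have h2 := hl.sum_smul d'
  rw [hse, Finset.sum_insert hd, h0] at h1 h2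
  rw [zero_add] at h1
  rw [zero_smul, zero_add] at h2
  have := weights_eq_zero hs' (w := fun v => if v = d' then -1 else l v d') (by
    rw [Finset.sum_insert hd', if_pos rfl, Finset.sum_congr rfl (g := fun v => l v d')
      fun v hv => if_neg (ne_of_mem_of_not_mem hv hd'), h1]
    norm_num) (by
    rw [Finset.sum_insert hd', if_pos rfl, Finset.sum_congr rfl (g := fun v => l v d' • v)
      fun v hv => by rw [if_neg (ne_of_mem_of_not_mem hv hd')], h2]
    simp) d' (Finset.mem_insert_self _ _)
  simp at this

/-- An edge in the interior of the complex lies in exactly two triangles, and these cover a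
neighbourhood of its relative interior. -/
theorem exists_two_triangles (hfin : K.faces.Finite) {O : Set Plane} (hO : IsOpen O)
    (hOK : O ⊆ K.space) {e : Finset Plane} (he : e ∈ K.faces) (hc : e.card = 2) {x : Plane}
    (hx : x ∈ openHull e) (hxO : x ∈ O) :
    ∃ s s', s ∈ K.faces ∧ s.card = 3 ∧ e ⊆ s ∧ s' ∈ K.faces ∧ s'.card = 3 ∧ e ⊆ s' ∧ s ≠ s' ∧
      (∀ t ∈ K.faces, t.card = 3 → e ⊆ t → t = s ∨ t = s') ∧
      ∀ y ∈ openHull e, hull s ∪ hull s' ∈ 𝓝 y := by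
  obtain ⟨s, hs, hs3, hxs⟩ := exists_triangle hfin hO hOK (subset_closure hxO)
  have hes := subset_of_mem_openHull he hs hx hxs
  obtain ⟨d, hd, hse⟩ := exists_third hc hs3 hes
  obtain ⟨l, hl⟩ := exists_isBary (K.indep hs) hs3
  have hds : d ∈ s := hse ▸ Finset.mem_insert_self _ _
  have hle0 : ∀ u ∈ e, l d u = 0 := fun u hu => hl.other u (hes hu) d hds fun h => hd (h ▸ hu)
  have hlx : ∀ y ∈ hull e, l d y = 0 := by
    intro y hy
    obtain ⟨w, -, h1, rfl⟩ := Finset.mem_convexHull'.1 hy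
    rw [affineMap_sum _ h1]
    exact Finset.sum_eq_zero fun u hu => by rw [hle0 u hu, mul_zero]
  have hxe := openHull_subset_hull e hx
  -- The second triangle is found just across e: step from x a little away from d, to a point where
  -- the coordinate of d is negative. A triangle there has e as a side, and its third vertex must be
  -- on the negative side.
  obtain ⟨s', hs', hs3', hes', d', hd', hse', hneg⟩ : ∃ s' ∈ K.faces, s'.card = 3 ∧ e ⊆ s' ∧
      ∃ d', d' ∉ e ∧ s' = insert d' e ∧ l d d' < 0 := by
    have hcont : ContinuousAt (fun ε : ℝ => AffineMap.lineMap x d (-ε)) 0 :=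
      (AffineMap.lineMap_continuous.comp continuous_neg).continuousAt
    have hev1 : ∀ᶠ ε in 𝓝 (0 : ℝ), AffineMap.lineMap x d (-ε) ∈ O ∧
        ∀ s ∈ K.faces, AffineMap.lineMap x d (-ε) ∈ hull s → x ∈ hull s := by
      have hm : (AffineMap.lineMap x d (-(0 : ℝ)) : Plane) = x := by simp
      have hx' : ∀ᶠ z in 𝓝 (AffineMap.lineMap x d (-(0 : ℝ)) : Plane),
          z ∈ O ∧ ∀ s ∈ K.faces, z ∈ hull s → x ∈ hull s := by
        rw [hm]
        exact Filter.Eventually.and (hO.mem_nhds hxO) (eventually_mem_hull hfin x)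
      exact hcont.eventually hx'
    obtain ⟨ε, ⟨hεO, hε⟩, hε0⟩ := ((hev1.filter_mono nhdsWithin_le_nhds).and
      (self_mem_nhdsWithin (a := (0 : ℝ)) (s := Ioi 0))).exists
    have hε0' : 0 < ε := hε0
    obtain ⟨s', hs', hs3', hys'⟩ := exists_triangle hfin hO hOK (subset_closure hεO)
    have hes' := subset_of_mem_openHull he hs' hx (hε s' hs' hys')
    obtain ⟨d', hd', hse'⟩ := exists_third hc hs3' hes'
    refine ⟨s', hs', hs3', hes', d', hd', hse', ?_⟩
    have hval : l d (AffineMap.lineMap x d (-ε)) = -ε := by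
      rw [AffineMap.apply_lineMap, hlx x hxe, hl.self d hds]
      simp [AffineMap.lineMap_apply]
    obtain ⟨w, h0, h1, h2⟩ := Finset.mem_convexHull'.1 hys'
    rw [← h2, affineMap_sum _ h1, hse', Finset.sum_insert hd', Finset.sum_eq_zero fun u hu => by
      rw [hle0 u hu, mul_zero], add_zero] at hval
    have hwd := h0 d' (hse' ▸ Finset.mem_insert_self _ _)
    by_contra hge
    push Not at hge
    have := mul_nonneg hwd hge
    linarith
  obtain ⟨l', hl'⟩ := exists_isBary (K.indep hs') hs3'
  have hds' : d' ∈ s' := hse' ▸ Finset.mem_insert_self _ _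
  -- Both coordinates vanish on e, so they are proportional. The factor is negative: s and s' lie on
  -- opposite sides, which leaves no room for a third triangle.
  have hll' : ∀ z, l d z = l' d' z * l d d' := fun z => by
    rw [hl'.affineMap_eq (l d) z, hse', Finset.sum_insert hd', Finset.sum_eq_zero fun u hu => by
      rw [hle0 u hu, mul_zero], add_zero]
  refine ⟨s, s', hs, hs3, hes, hs', hs3', hes', ?_, ?_, ?_⟩
  · intro h
    have : d = d' := by
      by_contra hdd
      have : d ∈ insert d' e := hse' ▸ h ▸ hds
      rw [Finset.mem_insert] at this
      exact this.elim hdd hd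
    rw [← this, hl.self d hds] at hneg
    linarith
  · intro t ht ht3 het
    obtain ⟨d'', hd'', hte⟩ := exists_third hc ht3 het
    rcases lt_trichotomy (l d d'') 0 with h | h | h
    · right
      refine (eq_of_same_side hc hs' ht hd' hd'' hse' hte hl' ?_).symm
      rw [hll'] at h
      by_contra hle
      push Not at hle
      have := mul_nonneg_of_nonpos_of_nonpos hle hneg.le
      linarith
    · exact absurd h (third_coord_ne_zero hd hd'' hse (hte ▸ ht) hl)
    · left
      exact (eq_of_same_side hc hs ht hd hd'' hse hte hl h).symm
  · intro y hy
    have hpos : ∀ {s d l}, e ⊆ s → s = insert d e → IsBary s l → d ∉ e →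
        ∀ᶠ z in 𝓝 y, ∀ v ∈ e, 0 < l v z := by
      intro s d l hes hse hl hd
      refine (Filter.eventually_all_finset e).2 fun v hv => ?_
      refine ContinuousAt.eventually_lt continuousAt_const (hl.continuous v).continuousAt ?_
      obtain ⟨w, h0, h1, rfl⟩ := hy
      rw [affineMap_sum _ h1, Finset.sum_eq_single_of_mem v hv fun u hu huv => by
        rw [hl.other u (hes hu) v (hes hv) huv, mul_zero], hl.self v (hes hv), mul_one]
      exact h0 v hv
    filter_upwards [hpos hes hse hl hd, hpos hes' hse' hl' hd'] with z hz hz'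
    rcases le_total 0 (l d z) with h | h
    · left
      refine hl.mem_hull.2 fun v hv => ?_
      rw [hse, Finset.mem_insert] at hv
      rcases hv with rfl | hv
      · exact h
      · exact (hz v hv).le
    · right
      refine hl'.mem_hull.2 fun v hv => ?_
      rw [hse', Finset.mem_insert] at hv
      rcases hv with rfl | hv
      · rw [hll'] at h
        by_contra hlt
        push Not at hlt
        have := mul_pos_of_neg_of_neg hlt hneg
        linarith
      · exact (hz' v hv).le

/-- The triangles at an interior vertex are connected through common edges. -/
theorem star_connected (hfin : K.faces.Finite) {O : Set Plane} (hO : IsOpen O)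
    (hOK : O ⊆ K.space) {v : Plane} (hvO : v ∈ O) (P : Finset Plane → Prop)
    (hv : {v} ∈ K.faces)
    (hstep : ∀ s ∈ K.faces, s.card = 3 → v ∈ s → P s → ∀ a ∈ s, a ≠ v →
      ∀ s' ∈ K.faces, s'.card = 3 → v ∈ s' → a ∈ s' → P s')
    (hex : ∃ s ∈ K.faces, s.card = 3 ∧ v ∈ s ∧ P s) :
    ∀ s ∈ K.faces, s.card = 3 → v ∈ s → P s := by
  intro s₂ hs₂ hc₂ hvs₂
  obtain ⟨s₁, hs₁, hc₁, hvs₁, hP₁⟩ := hex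
  by_contra hP₂
  obtain ⟨r, hr0, hr⟩ := Metric.mem_nhds_iff.1 (Filter.inter_mem (hO.mem_nhds hvO)
    (eventually_mem_hull hfin v))
  have hvhull : v ∈ openHull {v} := ⟨fun _ => 1, by simp, by simp, by simp⟩
  let T : Set (Finset Plane) := {s | s ∈ K.faces ∧ s.card = 3 ∧ v ∈ s}
  have hT : T.Finite := hfin.subset fun s hs => hs.1
  have hclosed : ∀ Q : Finset Plane → Prop, IsClosed (⋃ s ∈ {s | s ∈ T ∧ Q s}, hull s) := fun Q =>
    (hT.subset fun s hs => hs.1).isClosed_biUnion fun s _ => isClosed_hull s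
  -- The centre is removed because it lies in every triangle of the star; polar coordinates show
  -- that the punctured disc is still connected.
  have hpre : IsPreconnected (Metric.ball v r \ {v}) := by
    have himg : Metric.ball v r \ {v} =
        (fun a : ℝ × Plane => v + a.1 • a.2) '' (Ioo 0 r ×ˢ Metric.sphere 0 1) := by
      ext y
      simp only [mem_sdiff, Metric.mem_ball, mem_singleton_iff, mem_image, mem_prod, mem_Ioo,
        mem_sphere_zero_iff_norm, Prod.exists]
      constructor
      · rintro ⟨h, hne⟩
        have hne' : 0 < ‖y - v‖ := norm_pos_iff.2 (sub_ne_zero.2 hne)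
        refine ⟨‖y - v‖, ‖y - v‖⁻¹ • (y - v), ⟨⟨hne', by rwa [← dist_eq_norm]⟩, ?_⟩, ?_⟩
        · rw [norm_smul, norm_inv, norm_norm, inv_mul_cancel₀ hne'.ne']
        · rw [smul_smul, mul_inv_cancel₀ hne'.ne']; simp
      · rintro ⟨ρ, u, ⟨⟨hρ, hρr⟩, hu⟩, rfl⟩
        refine ⟨by simp [norm_smul, hu, abs_of_pos hρ, hρr], fun h => ?_⟩
        have : ρ • u = 0 := by simpa using h
        rcases smul_eq_zero.1 this with h | h
        · exact hρ.ne' h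
        · rw [h, norm_zero] at hu
          exact zero_ne_one hu
    rw [himg]
    exact ((isConnected_Ioo hr0).prod
      (isConnected_sphere one_lt_rank_plane 0 zero_le_one)).isPreconnected.image _
      (Continuous.continuousOn (by fun_prop))
  have hmeet : ∀ Q : Finset Plane → Prop, ∀ s ∈ T, Q s →
      ((Metric.ball v r \ {v}) ∩ ⋃ s ∈ {s | s ∈ T ∧ Q s}, hull s).Nonempty := by
    rintro Q s ⟨hs, hc, hvs⟩ hQ
    obtain ⟨a, ha, hav⟩ := Finset.exists_mem_ne (by omega : 1 < s.card) v
    have hcont : ContinuousAt (fun ε : ℝ => (AffineMap.lineMap v a ε : Plane)) 0 :=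
      AffineMap.lineMap_continuous.continuousAt
    have hev : ∀ᶠ ε in 𝓝 (0 : ℝ), AffineMap.lineMap v a ε ∈ Metric.ball v r :=
      hcont.preimage_mem_nhds (by
        rw [AffineMap.lineMap_apply_zero]; exact Metric.ball_mem_nhds v hr0)
    have hmem : Ioo (0 : ℝ) 1 ∈ 𝓝[>] (0 : ℝ) := Ioo_mem_nhdsGT one_pos
    obtain ⟨ε, hε, hε0, hε1⟩ := ((hev.filter_mono nhdsWithin_le_nhds).and hmem).exists
    refine ⟨AffineMap.lineMap v a ε, ⟨hε, fun h => ?_⟩, mem_biUnion (x := s) ⟨⟨hs, hc, hvs⟩, hQ⟩ ?_⟩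
    · have h' : AffineMap.lineMap v a ε = AffineMap.lineMap v a (0 : ℝ) := by
        rw [AffineMap.lineMap_apply_zero]; exact h
      exact hε0.ne' (AffineMap.lineMap_injective ℝ hav.symm h')
    · exact (convex_convexHull ℝ _).segment_subset (subset_convexHull ℝ _ hvs)
        (subset_convexHull ℝ _ ha) (by
          rw [segment_eq_image_lineMap]; exact ⟨ε, ⟨hε0.le, hε1.le⟩, rfl⟩)
  have hcover : Metric.ball v r \ {v} ⊆ (⋃ s ∈ {s | s ∈ T ∧ P s}, hull s) ∪
      ⋃ s ∈ {s | s ∈ T ∧ ¬ P s}, hull s := by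
    rintro y ⟨hy, -⟩
    obtain ⟨s, hs, hc, hys⟩ := exists_triangle hfin hO hOK (subset_closure (hr hy).1)
    have hvs : v ∈ s := by
      have := subset_of_mem_openHull hv hs hvhull ((hr hy).2 s hs hys)
      simpa using this
    by_cases hP : P s
    · exact Or.inl (mem_biUnion (x := s) ⟨⟨hs, hc, hvs⟩, hP⟩ hys)
    · exact Or.inr (mem_biUnion (x := s) ⟨⟨hs, hc, hvs⟩, hP⟩ hys)
  -- The triangles with P and those without form two closed sets covering the punctured disc, so
  -- they share a point y ≠ v. The common face through y has a vertex besides v, across which P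
  -- propagates.
  obtain ⟨y, ⟨-, hyv⟩, hy1, hy2⟩ := isPreconnected_closed_iff.1 hpre _ _ (hclosed P)
    (hclosed fun s => ¬ P s) hcover (hmeet P s₁ ⟨hs₁, hc₁, hvs₁⟩ hP₁)
    (hmeet (fun s => ¬ P s) s₂ ⟨hs₂, hc₂, hvs₂⟩ hP₂)
  simp only [mem_iUnion] at hy1 hy2
  obtain ⟨s, ⟨⟨hs, hc, hvs⟩, hP⟩, hys⟩ := hy1
  obtain ⟨s', ⟨⟨hs', hc', hvs'⟩, hP'⟩, hys'⟩ := hy2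
  have hyi := hull_inter hs hs' hys hys'
  have : ∃ a ∈ s ∩ s', a ≠ v := by
    by_contra! hall
    have : hull (s ∩ s') ⊆ hull {v} :=
      convexHull_mono fun a ha => by simpa using hall a (Finset.mem_coe.1 ha)
    have := this hyi
    simp only [hull, Finset.coe_singleton, convexHull_singleton] at this
    exact hyv this
  obtain ⟨a, ha, hav⟩ := this
  rw [Finset.mem_inter] at ha
  exact hP' (hstep s hs hc hvs hP a ha.1 hav s' hs' hc' hvs' ha.2)

end PlanarComplex

/-- A preconnected subset of a finite disjoint union of closed sets lies in one of them. -/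
theorem subset_of_iUnion_closed {X ι : Type*} [TopologicalSpace X] [Finite ι] {J : ι → Set X}
    (hJ : ∀ i, IsClosed (J i)) (hd : Pairwise (Function.onFun Disjoint J)) {S : Set X}
    (hS : IsPreconnected S) (hSJ : S ⊆ ⋃ i, J i) {i : ι} (hi : (S ∩ J i).Nonempty) :
    S ⊆ J i := by
  intro x hx
  by_contra hxi
  have hc : IsClosed (⋃ j ∈ {j | j ≠ i}, J j) :=
    (Set.toFinite _).isClosed_biUnion fun j _ => hJ j
  have hcov : S ⊆ J i ∪ ⋃ j ∈ {j | j ≠ i}, J j := fun y hy => by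
    obtain ⟨j, hj⟩ := mem_iUnion.1 (hSJ hy)
    by_cases h : j = i
    · exact Or.inl (h ▸ hj)
    · exact Or.inr (mem_biUnion (x := j) h hj)
  obtain ⟨y, -, hy1, hy2⟩ := isPreconnected_closed_iff.1 hS _ _ (hJ i) hc hcov hi
    ⟨x, hx, (hcov hx).resolve_left hxi⟩
  simp only [mem_iUnion] at hy2
  obtain ⟨j, hj, hyj⟩ := hy2
  exact disjoint_left.1 (hd hj) hyj hy1

theorem exists_edge_of_notMem_openHull {s : Finset Plane} (hc : s.card = 3) {x : Plane}
    (hx : x ∈ hull s) (hx' : x ∉ openHull s) : ∃ a ∈ s, ∃ b ∈ s, a ≠ b ∧ x ∈ segment ℝ a b := by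
  classical
  obtain ⟨t, hts, -, hxt⟩ := exists_mem_openHull hx
  have hne : ¬ s ⊆ t := fun h => hx' (Finset.Subset.antisymm hts h ▸ hxt)
  obtain ⟨d, hds, hdt⟩ := Finset.not_subset.1 hne
  have hc2 : (s.erase d).card = 2 := by rw [Finset.card_erase_of_mem hds, hc]
  obtain ⟨a, b, hab, hs⟩ := Finset.card_eq_two.1 hc2
  have hts' : t ⊆ {a, b} := hs ▸ Finset.subset_erase.2 ⟨hts, hdt⟩
  have hmem : ∀ z ∈ ({a, b} : Finset Plane), z ∈ s := fun z hz =>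
    Finset.mem_of_mem_erase (hs ▸ hz)
  refine ⟨a, hmem a (by simp), b, hmem b (by simp), hab, ?_⟩
  rw [← hull_pair]
  exact convexHull_mono (Finset.coe_subset.2 hts') (openHull_subset_hull t hxt)

namespace CellularDomain

variable (D : CellularDomain)

/-! ### The region and its boundary curves. -/

section Boundary

/-- The boundary components. -/
def bdry : Option (Fin (D.holes + 1)) → Set Plane
  | none => D.outer
  | some i => D.inner i

theorem bdry_simple : ∀ o, IsSimpleClosedCurve (D.bdry o)
  | none => D.outer_simple
  | some i => D.inner_simple i

theorem bdry_disjoint : Pairwise (Function.onFun Disjoint D.bdry) := by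
  rintro (_ | i) (_ | j) h
  · exact absurd rfl h
  · exact D.outer_disjoint_inner j
  · exact (D.outer_disjoint_inner i).symm
  · exact D.inner_disjoint i j fun e => h (by rw [e])

theorem frontier_eq_bdry : frontier D.region = ⋃ o, D.bdry o := by
  rw [D.frontier_region, iUnion_option]
  rfl

theorem outer_subset_frontier : D.outer ⊆ frontier D.region := by
  rw [D.frontier_region]; exact subset_union_left

theorem inner_subset_frontier (i) : D.inner i ⊆ frontier D.region := by
  rw [D.frontier_region]; exact (subset_iUnion _ i).trans subset_union_right

theorem disjoint_region_frontier : Disjoint D.region (frontier D.region) :=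
  (disjoint_frontier_iff_isOpen.2 D.isOpen_region).symm

theorem closure_eq : closure D.region = D.region ∪ frontier D.region :=
  closure_eq_self_union_frontier _

theorem closure_subset_outer : closure D.region ⊆ inside D.outer ∪ D.outer := by
  rw [← D.outer_simple.closure_inside]
  exact closure_mono D.region_enclosed

theorem inner_subset_inside_outer (i) : D.inner i ⊆ inside D.outer := fun _ hx =>
  (D.closure_subset_outer (frontier_subset_closure (D.inner_subset_frontier i hx))).resolve_right
    fun h => disjoint_left.1 (D.outer_disjoint_inner i) h hx

theorem region_subset_or {C : Set Plane} (hC : IsClosed C) (hd : Disjoint D.region C) :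
    D.region ⊆ inside C ∨ D.region ⊆ outside C := by
  by_cases h : (D.region ∩ inside C).Nonempty
  · left
    refine subset_of_disjoint_frontier D.isConnected_region.isPreconnected h ?_
    exact hd.mono_right (frontier_inside_subset hC)
  · right
    intro x hx
    have : x ∈ Cᶜ := disjoint_left.1 hd hx
    rw [compl_eq_inside_union_outside] at this
    exact this.resolve_left fun h' => h ⟨x, hx, h'⟩

theorem disjoint_region_inner (i) : Disjoint D.region (D.inner i) :=
  D.disjoint_region_frontier.mono_right (D.inner_subset_frontier i)

/-- Otherwise E₂ⁱ would enclose E₁. But the closed exterior of E₁ is connected, unbounded and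
disjoint from E₂ⁱ, so E₁ lies outside E₂ⁱ. -/
theorem region_subset_outside_inner (i) : D.region ⊆ outside (D.inner i) := by
  have hi := D.inner_simple i
  refine (D.region_subset_or hi.isClosed (D.disjoint_region_inner i)).resolve_left fun h => ?_
  have h1 : D.outer ⊆ inside (D.inner i) := fun x hx => by
    have := closure_mono h (frontier_subset_closure (D.outer_subset_frontier hx))
    rw [hi.closure_inside] at this
    exact this.resolve_right fun h => disjoint_left.1 (D.outer_disjoint_inner i) hx h
  have h2 : closure (outside D.outer) ⊆ outside (D.inner i) := by
    refine subset_outside_of_isPreconnected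
      (isConnected_outside D.outer_simple.isBounded).isPreconnected.closure
      (fun hb => outside_not_isBounded D.outer_simple.isBounded (hb.subset subset_closure)) ?_
    rw [D.outer_simple.closure_outside, disjoint_union_left]
    refine ⟨disjoint_left.2 fun x hx hx' => ?_, D.outer_disjoint_inner i⟩
    exact disjoint_left.1 disjoint_inside_outside (D.inner_subset_inside_outer i hx') hx
  obtain ⟨x, hx⟩ := D.outer_simple.isConnected.nonempty
  exact disjoint_left.1 disjoint_inside_outside (h1 hx)
    (h2 (D.outer_simple.subset_closure_outside hx))

theorem closure_subset_inner (i) : closure D.region ⊆ outside (D.inner i) ∪ D.inner i := by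
  rw [← (D.inner_simple i).closure_outside]
  exact closure_mono (D.region_subset_outside_inner i)

theorem disjoint_closure_outside_outer : Disjoint (closure D.region) (outside D.outer) :=
  disjoint_left.2 fun _ hx hx' => (D.closure_subset_outer hx).elim
    (fun h => disjoint_left.1 disjoint_inside_outside h hx') fun h => hx'.1 h

theorem disjoint_closure_inside_inner (i) : Disjoint (closure D.region) (inside (D.inner i)) :=
  disjoint_left.2 fun _ hx hx' => (D.closure_subset_inner i hx).elim
    (fun h => disjoint_left.1 disjoint_inside_outside hx' h) fun h => hx'.1 h

theorem component_eq_region {a : Plane} (ha : a ∈ D.region) :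
    connectedComponentIn (⋃ o, D.bdry o)ᶜ a = D.region := by
  rw [← D.frontier_eq_bdry]
  have ha' : a ∈ (frontier D.region)ᶜ := disjoint_left.1 D.disjoint_region_frontier ha
  refine Subset.antisymm (subset_of_disjoint_frontier isPreconnected_connectedComponentIn
    ⟨a, mem_connectedComponentIn ha', ha⟩ ?_) ?_
  · exact disjoint_left.2 fun x hx hx' => connectedComponentIn_subset _ _ hx hx'
  · exact D.isConnected_region.isPreconnected.subset_connectedComponentIn ha
      D.disjoint_region_frontier.subset_compl_right

/-- The complement of the closed region consists of the exterior and the holes. -/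
theorem mem_of_notMem_closure {b : Plane} (hb : b ∉ closure D.region) :
    b ∈ outside D.outer ∨ ∃ i, b ∈ inside (D.inner i) := by
  obtain ⟨a, ha⟩ := D.isConnected_region.nonempty
  have haK : a ∉ ⋃ o, D.bdry o := by
    rw [← D.frontier_eq_bdry]; exact disjoint_left.1 D.disjoint_region_frontier ha
  have hbK : b ∉ ⋃ o, D.bdry o := by
    rw [← D.frontier_eq_bdry]; exact fun h => hb (frontier_subset_closure h)
  -- Some boundary curve separates b from a point of Ω. Since Ω is inside E₁ and outside each E₂ⁱ,
  -- the point b is on the other side of that curve.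
  obtain ⟨o, ho⟩ := exists_separating (fun o => (D.bdry_simple o).isCompact) D.bdry_disjoint
    haK hbK (by rw [D.component_eq_region ha]; exact D.isBounded_region) (by
      rw [D.component_eq_region ha]
      intro h
      have : b ∈ D.region := by rw [h]; exact mem_connectedComponentIn hbK
      exact hb (subset_closure this))
  have hbo : b ∈ (D.bdry o)ᶜ := fun h => hbK (mem_iUnion.2 ⟨o, h⟩)
  rw [compl_eq_inside_union_outside] at hbo
  rcases o with _ | i
  · left
    refine hbo.resolve_left fun h => ho ?_
    rw [← (D.bdry_simple none).inside_eq_connectedComponentIn h,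
      ← (D.bdry_simple none).inside_eq_connectedComponentIn (D.region_enclosed ha)]
  · right
    refine ⟨i, hbo.resolve_right fun h => ho ?_⟩
    exact connectedComponentIn_eq_of_mem_outside (D.bdry_simple (some i)).isBounded
      (D.region_subset_outside_inner i ha) h

/-- Every boundary point is a limit of points of the exterior of E₁ or of a hole, and these miss the
closure of Ω. Hence a point with a neighbourhood covered by triangles lies in Ω. -/
theorem interior_closure : interior (closure D.region) = D.region := by
  refine Subset.antisymm (fun x hx => ?_) (D.isOpen_region.subset_interior_iff.2 subset_closure)
  by_contra hxr
  have hxf : x ∈ frontier D.region := by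
    have := interior_subset hx
    rw [D.closure_eq] at this
    exact this.resolve_left hxr
  rw [D.frontier_eq_bdry] at hxf
  obtain ⟨o, ho⟩ := mem_iUnion.1 hxf
  rcases o with _ | i
  · obtain ⟨y, hy, hy'⟩ := mem_closure_iff.1 (D.outer_simple.subset_closure_outside ho) _
      isOpen_interior hx
    exact disjoint_left.1 D.disjoint_closure_outside_outer (interior_subset hy) hy'
  · obtain ⟨y, hy, hy'⟩ := mem_closure_iff.1 ((D.inner_simple i).subset_closure_inside ho) _
      isOpen_interior hx
    exact disjoint_left.1 (D.disjoint_closure_inside_inner i) (interior_subset hy) hy'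

theorem outer_subset_closure : D.outer ⊆ closure D.region :=
  D.outer_subset_frontier.trans frontier_subset_closure

theorem inner_subset_closure (i) : D.inner i ⊆ closure D.region :=
  (D.inner_subset_frontier i).trans frontier_subset_closure

theorem mem_region_of_nhds {x : Plane} {s : Set Plane} (hs : s ∈ 𝓝 x)
    (hsr : s ⊆ closure D.region) : x ∈ D.region := by
  rw [← D.interior_closure]
  exact mem_interior_iff_mem_nhds.2 (Filter.mem_of_superset hs hsr)

end Boundary

/-! ### Faces, edges and triangles of the decomposition. -/

section Faces

open scoped Classical

/-- `s` is a triangle of the triangulation. -/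
def IsTri (s : Finset Plane) : Prop := s ∈ D.complex.faces ∧ s.card = 3

variable {D}

theorem hull_subset_closure {s : Finset Plane} (hs : s ∈ D.complex.faces) :
    hull s ⊆ closure D.region := by
  rw [← D.space_eq]
  exact Geometry.SimplicialComplex.convexHull_subset_space hs

theorem region_subset_space : D.region ⊆ D.complex.space := by
  rw [D.space_eq]; exact subset_closure

theorem exists_tri {x : Plane} (hx : x ∈ closure D.region) : ∃ s, D.IsTri s ∧ x ∈ hull s := by
  obtain ⟨s, hs, hc, hxs⟩ := exists_triangle D.finite_faces D.isOpen_region region_subset_space hx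
  exact ⟨s, ⟨hs, hc⟩, hxs⟩

theorem exists_face {x : Plane} (hx : x ∈ closure D.region) :
    ∃ f ∈ D.complex.faces, x ∈ openHull f := by
  obtain ⟨s, hs, hxs⟩ := exists_tri hx
  obtain ⟨t, hts, htne, hxt⟩ := exists_mem_openHull hxs
  exact ⟨t, D.complex.down_closed hs.1 hts htne, hxt⟩

theorem openHull_subset_region {s : Finset Plane} (hs : D.IsTri s) : openHull s ⊆ D.region := by
  obtain ⟨l, hl⟩ := exists_isBary (D.complex.indep hs.1) hs.2
  intro x hx
  exact D.mem_region_of_nhds (hl.isOpen_openHull.mem_nhds hx)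
    ((openHull_subset_hull s).trans (hull_subset_closure hs.1))

theorem exists_two_tri {e : Finset Plane} (he : e ∈ D.complex.faces) (hc : e.card = 2)
    (hx : (openHull e ∩ D.region).Nonempty) :
    ∃ s s', D.IsTri s ∧ e ⊆ s ∧ D.IsTri s' ∧ e ⊆ s' ∧ s ≠ s' ∧
      ∀ t, D.IsTri t → e ⊆ t → t = s ∨ t = s' := by
  obtain ⟨x, hx, hxr⟩ := hx
  obtain ⟨s, s', h1, h2, h3, h4, h5, h6, h7, h8, -⟩ :=
    exists_two_triangles D.finite_faces D.isOpen_region region_subset_space he hc hx hxr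
  exact ⟨s, s', ⟨h1, h2⟩, h3, ⟨h4, h5⟩, h6, h7, fun t ht => h8 t ht.1 ht.2⟩

/-- The two triangles at an edge that meets Ω cover a neighbourhood of each point of the open edge,
so an open edge lies entirely in Ω or entirely in ∂Ω. -/
theorem openHull_subset_region_of_edge {e : Finset Plane} (he : e ∈ D.complex.faces)
    (hc : e.card = 2) (hx : (openHull e ∩ D.region).Nonempty) : openHull e ⊆ D.region := by
  obtain ⟨x, hx, hxr⟩ := hx
  obtain ⟨s, s', h1, -, -, h4, -, -, -, -, h⟩ :=
    exists_two_triangles D.finite_faces D.isOpen_region region_subset_space he hc hx hxr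
  intro y hy
  exact D.mem_region_of_nhds (h y hy)
    (union_subset (hull_subset_closure h1) (hull_subset_closure h4))

theorem segment_subset_frontier {a b : Plane} (he : {a, b} ∈ D.complex.faces) (hab : a ≠ b)
    (h : ¬ (openHull {a, b} ∩ D.region).Nonempty) : segment ℝ a b ⊆ frontier D.region := by
  have h1 : openSegment ℝ a b ⊆ frontier D.region := fun x hx => by
    have hx' := (mem_openHull_pair hab).2 hx
    have := hull_subset_closure he (openHull_subset_hull _ hx')
    rw [D.closure_eq] at this
    exact this.resolve_left fun hr => h ⟨x, hx', hr⟩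
  rw [← closure_openSegment]
  exact closure_minimal h1 isClosed_frontier

theorem mem_verts {v : Plane} : v ∈ D.verts ↔ {v} ∈ D.complex.faces := by
  rw [verts, Set.Finite.mem_toFinset]; rfl

theorem mem_verts_of_mem {s : Finset Plane} (hs : s ∈ D.complex.faces) {v : Plane} (hv : v ∈ s) :
    v ∈ D.verts :=
  mem_verts.2 (D.complex.down_closed hs (Finset.singleton_subset_iff.2 hv) (by simp))

theorem vert_mem_closure {v : Plane} (hv : v ∈ D.verts) : v ∈ closure D.region :=
  hull_subset_closure (mem_verts.1 hv) (subset_convexHull ℝ _ (by simp))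

theorem mem_openHull_singleton (v : Plane) : v ∈ openHull {v} :=
  ⟨fun _ => 1, by simp, by simp, by simp⟩

theorem vert_mem_of_mem_hull {v : Plane} (hv : v ∈ D.verts) {s : Finset Plane}
    (hs : s ∈ D.complex.faces) (hvs : v ∈ hull s) : v ∈ s := by
  simpa using subset_of_mem_openHull (mem_verts.1 hv) hs (mem_openHull_singleton v) hvs

theorem joined_of_mem {s : Finset Plane} (hs : s ∈ D.complex.faces) {a b : Plane} (ha : a ∈ s)
    (hb : b ∈ s) (hab : a ≠ b) : D.Joined a b :=
  ⟨hab, D.complex.down_closed hs (by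
    intro x hx
    rw [Finset.mem_insert, Finset.mem_singleton] at hx
    rcases hx with rfl | rfl <;> assumption) (by simp)⟩

theorem Joined.symm {a b : Plane} (h : D.Joined a b) : D.Joined b a :=
  ⟨h.1.symm, by rw [Finset.pair_comm]; exact h.2⟩

theorem Adj.symm {a b : Plane} (h : D.Adj a b) : D.Adj b a :=
  ⟨h.1.symm, by rw [Finset.pair_comm]; exact h.2⟩

theorem Joined.mem_verts {a b : Plane} (h : D.Joined a b) : b ∈ D.verts :=
  mem_verts_of_mem h.2 (by simp)

theorem Joined.exists_tri {a b : Plane} (h : D.Joined a b) : ∃ s, D.IsTri s ∧ a ∈ s ∧ b ∈ s := by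
  have hm : midpoint ℝ a b ∈ openHull {a, b} := by
    rw [mem_openHull_pair h.1]
    refine ⟨1 / 2, 1 / 2, by norm_num, by norm_num, by norm_num, ?_⟩
    rw [midpoint_eq_smul_add, smul_add]
    simp
  obtain ⟨s, hs, hxs⟩ := CellularDomain.exists_tri
    (hull_subset_closure h.2 (openHull_subset_hull _ hm))
  have hsub := subset_of_mem_openHull h.2 hs.1 hm hxs
  exact ⟨s, hs, hsub (by simp), hsub (by simp)⟩

theorem joined_not_subset_frontier {v a : Plane} (hv : v ∈ D.region) :
    ¬ segment ℝ v a ⊆ frontier D.region := fun h =>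
  disjoint_left.1 D.disjoint_region_frontier hv (h (left_mem_segment ℝ v a))

/-- A triangle has at most one diagonal among its sides, so one of its two sides at v is an edge of
the network. -/
theorem exists_adj {v : Plane} (hv : v ∈ D.verts) : ∃ a, D.Adj v a := by
  obtain ⟨s, hs, hvs⟩ := exists_tri (vert_mem_closure hv)
  have hvs' := vert_mem_of_mem_hull hv hs.1 hvs
  have hc : (s.erase v).card = 2 := by rw [Finset.card_erase_of_mem hvs', hs.2]
  obtain ⟨a, b, hab, he⟩ := Finset.card_eq_two.1 hc
  have ha : a ∈ s.erase v := by rw [he]; simp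
  have hb : b ∈ s.erase v := by rw [he]; simp
  rw [Finset.mem_erase] at ha hb
  have hja := joined_of_mem hs.1 hvs' ha.2 ha.1.symm
  have hjb := joined_of_mem hs.1 hvs' hb.2 hb.1.symm
  by_cases h1 : ({v, a} : Finset Plane) ∈ D.diag
  · refine ⟨b, hjb, fun h2 => ?_⟩
    have := D.diag_unique s hs.1 _ h1 _ h2 hs.2 (by
      intro x hx
      rw [Finset.mem_insert, Finset.mem_singleton] at hx
      rcases hx with rfl | rfl <;> tauto) (by
      intro x hx
      rw [Finset.mem_insert, Finset.mem_singleton] at hx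
      rcases hx with rfl | rfl <;> tauto)
    have ha' : a ∈ ({v, b} : Finset Plane) := by rw [← this]; simp
    rw [Finset.mem_insert, Finset.mem_singleton] at ha'
    exact ha'.elim ha.1 hab
  · exact ⟨a, hja, h1⟩

end Faces

end CellularDomain

/-! ### The Dirichlet solution, its extremum principle and its extension. -/

namespace CellularDomain

variable (D : CellularDomain)

/-- The standing hypotheses: conductances, and a nondegenerate Dirichlet solution. -/
structure IsSolution (c : Plane → Plane → ℝ) (k : ℝ) (g : Plane → ℝ) : Prop where
  cond : D.IsConductance c
  pos : 0 < k
  sol : D.IsDirichletSolution c k g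
  nondeg : D.Nondegenerate g

open Classical in
/-- The extension of `g` to the plane by `k` outside `E₁` and by `0` in the holes. -/
noncomputable def ext (k : ℝ) (g : Plane → ℝ) (x : Plane) : ℝ :=
  if x ∈ closure D.region then g x else if x ∈ outside D.outer then k else 0

namespace IsSolution

open scoped Classical

variable {D} {c : Plane → Plane → ℝ} {k : ℝ} {g : Plane → ℝ}

/-- The values of `g` on the boundary components. -/
noncomputable def bdryValue (D : CellularDomain) (k : ℝ) : Option (Fin (D.holes + 1)) → ℝ
  | none => k
  | some _ => 0

theorem g_sum (H : D.IsSolution c k g) {s : Finset Plane} (hs : s ∈ D.complex.faces)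
    {w : Plane → ℝ} (h0 : ∀ v ∈ s, 0 ≤ w v) (h1 : ∑ v ∈ s, w v = 1) :
    g (∑ v ∈ s, w v • v) = ∑ v ∈ s, w v * g v :=
  affine_sum (H.sol.affine s hs) h0 h1

theorem value_of_vert (H : D.IsSolution c k g) {v : Plane} (hv : v ∈ D.verts) {o}
    (ho : v ∈ D.bdry o) : g v = bdryValue D k o := by
  rcases o with _ | i
  · exact H.sol.outer_value v hv ho
  · exact H.sol.inner_value v hv i ho

/-- The open face through x is not an open triangle, as those lie in Ω. If it is an edge, the whole
edge lies in ∂Ω and, being connected, in one component. So all its vertices carry the boundary value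
of that component. -/
theorem value_of_bdry (H : D.IsSolution c k g) {x : Plane} {o} (ho : x ∈ D.bdry o) :
    g x = bdryValue D k o := by
  have hxf : x ∈ frontier D.region := by
    rw [D.frontier_eq_bdry]; exact mem_iUnion.2 ⟨o, ho⟩
  have hxr : x ∉ D.region := fun h => disjoint_left.1 D.disjoint_region_frontier h hxf
  obtain ⟨f, hf, hxf'⟩ := exists_face (frontier_subset_closure hxf)
  have hall : ∀ v ∈ f, v ∈ D.bdry o := by
    have hpos := Finset.card_pos.2 (D.complex.nonempty_of_mem_faces hf)
    have h3 := card_le_three hf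
    have hcases : f.card = 1 ∨ f.card = 2 ∨ f.card = 3 := by omega
    rcases hcases with h | h | h
    · obtain ⟨v, rfl⟩ := Finset.card_eq_one.1 h
      have := openHull_subset_hull _ hxf'
      rw [hull, Finset.coe_singleton, convexHull_singleton] at this
      intro u hu
      rw [Finset.mem_singleton] at hu
      rw [hu, ← mem_singleton_iff.1 this]
      exact ho
    · obtain ⟨a, b, hab, rfl⟩ := Finset.card_eq_two.1 h
      have hseg := segment_subset_frontier hf hab fun hne =>
        hxr (openHull_subset_region_of_edge hf h hne hxf')
      rw [D.frontier_eq_bdry] at hseg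
      have hsub := subset_of_iUnion_closed (fun o => (D.bdry_simple o).isClosed) D.bdry_disjoint
        (convex_segment a b).isPreconnected hseg (i := o)
        ⟨x, by rw [← hull_pair]; exact openHull_subset_hull _ hxf', ho⟩
      intro v hv
      rw [Finset.mem_insert, Finset.mem_singleton] at hv
      rcases hv with rfl | rfl
      · exact hsub (left_mem_segment ℝ _ _)
      · exact hsub (right_mem_segment ℝ _ _)
    · exact absurd (openHull_subset_region ⟨hf, h⟩ hxf') hxr
  obtain ⟨w, h0, h1, rfl⟩ := hxf'
  rw [H.g_sum hf (fun v hv => (h0 v hv).le) h1, Finset.sum_congr rfl fun v hv => by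
    rw [H.value_of_vert (mem_verts_of_mem hf hv) (hall v hv)], ← Finset.sum_mul, h1, one_mul]

theorem value_outer (H : D.IsSolution c k g) {x : Plane} (hx : x ∈ D.outer) : g x = k :=
  H.value_of_bdry (o := none) hx

theorem value_inner (H : D.IsSolution c k g) {x : Plane} {i} (hx : x ∈ D.inner i) : g x = 0 :=
  H.value_of_bdry (o := some i) hx

theorem ne_of_joined (H : D.IsSolution c k g) {v a : Plane} (hv : v ∈ D.region)
    (h : D.Joined v a) : g v ≠ g a :=
  H.nondeg v a h (joined_not_subset_frontier hv)

/-- `g` is not constant on a triangle. -/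
theorem exists_ne (H : D.IsSolution c k g) {s : Finset Plane} (hs : D.IsTri s) :
    ∃ a ∈ s, ∃ b ∈ s, g a ≠ g b := by
  -- By nondegeneracy a triangle with constant values has all its sides in ∂Ω, hence in a single
  -- boundary component. Then Ω is contained in the open triangle and has only one boundary curve,
  -- but there are at least two.
  by_contra! hall
  have hedge : ∀ a ∈ s, ∀ b ∈ s, a ≠ b → segment ℝ a b ⊆ frontier D.region := by
    intro a ha b hb hab
    by_contra hnot
    exact H.nondeg a b (joined_of_mem hs.1 ha hb hab) hnot (hall a ha b hb)
  have hconst : ∀ {a b}, a ∈ s → b ∈ s → a ≠ b → ∀ {o}, a ∈ D.bdry o →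
      segment ℝ a b ⊆ D.bdry o := by
    intro a b ha hb hab o hao
    have h := hedge a ha b hb hab
    rw [D.frontier_eq_bdry] at h
    exact subset_of_iUnion_closed (fun o => (D.bdry_simple o).isClosed) D.bdry_disjoint
      (convex_segment a b).isPreconnected h ⟨a, left_mem_segment ℝ _ _, hao⟩
  have h2 : 1 < s.card := by rw [hs.2]; norm_num
  obtain ⟨a, ha, b, hb, hab⟩ := Finset.one_lt_card.1 h2
  obtain ⟨o, hao⟩ : ∃ o, a ∈ D.bdry o := by
    have := hedge a ha b hb hab (left_mem_segment ℝ _ _)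
    rw [D.frontier_eq_bdry] at this
    exact mem_iUnion.1 this
  have hverts : ∀ v ∈ s, v ∈ D.bdry o := fun v hv => by
    by_cases h : a = v
    · exact h ▸ hao
    · exact hconst ha hv h hao (right_mem_segment ℝ _ _)
  have hboundary : ∀ x ∈ hull s, x ∉ openHull s → x ∈ D.bdry o := fun x hx hx' => by
    obtain ⟨u, hu, v, hv, huv, hxuv⟩ := exists_edge_of_notMem_openHull hs.2 hx hx'
    exact hconst hu hv huv (hverts u hu) hxuv
  have hbf : ∀ o, D.bdry o ⊆ frontier D.region := fun o => by
    rw [D.frontier_eq_bdry]; exact subset_iUnion _ o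
  obtain ⟨l, hl⟩ := exists_isBary (D.complex.indep hs.1) hs.2
  have hregion : D.region ⊆ openHull s := by
    have hne : (openHull s).Nonempty := by
      refine ⟨∑ v ∈ s, (1 / 3 : ℝ) • v, fun _ => 1 / 3, fun _ _ => by norm_num, ?_, rfl⟩
      rw [Finset.sum_const, hs.2]; norm_num
    obtain ⟨x, hx⟩ := hne
    refine subset_of_disjoint_frontier D.isConnected_region.isPreconnected
      ⟨x, openHull_subset_region hs hx, hx⟩ (disjoint_left.2 fun y hy hy' => ?_)
    rw [hl.isOpen_openHull.frontier_eq] at hy'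
    have : y ∈ hull s := closure_minimal (openHull_subset_hull s) (isClosed_hull s) hy'.1
    exact disjoint_left.1 D.disjoint_region_frontier hy (hbf o (hboundary y this hy'.2))
  have hfront : ∀ o', D.bdry o' ⊆ D.bdry o := fun o' x hx => by
    have hxf := hbf o' hx
    have hxs : x ∈ hull s := closure_minimal (hregion.trans (openHull_subset_hull s))
      (isClosed_hull s) (frontier_subset_closure hxf)
    exact hboundary x hxs fun h =>
      disjoint_left.1 D.disjoint_region_frontier (openHull_subset_region hs h) hxf
  have heq : ∀ o', o' = o := fun o' => by
    by_contra hne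
    obtain ⟨x, hx⟩ := (D.bdry_simple o').isConnected.nonempty
    exact disjoint_left.1 (D.bdry_disjoint hne) hx (hfront o' hx)
  exact absurd ((heq none).trans (heq (some 0)).symm) (by simp)

/-- At an interior vertex, some neighbour has a larger and some neighbour a smaller value. -/
theorem exists_joined_lt (H : D.IsSolution c k g) {v : Plane} (hv : v ∈ D.verts)
    (hvr : v ∈ D.region) {σ : ℝ} (hσ : σ ≠ 0) : ∃ a, D.Joined v a ∧ σ * (g a - g v) < 0 := by
  by_contra! hall
  have hsum := H.sol.harmonic v hv hvr
  obtain ⟨a, ha⟩ := D.exists_adj hv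
  -- The sign of σ selects smaller or larger neighbours. If the desired neighbour is missing, the
  -- terms of the vanishing Laplacian all have one sign, so each is zero, against nondegeneracy.
  have hzero : ∑ y ∈ D.verts with D.Adj v y, c v y * (σ * (g y - g v)) = 0 := by
    have h1 : ∑ y ∈ D.verts with D.Adj v y, c v y * (σ * (g y - g v)) =
        (-σ) * D.laplacian c g v := by
      rw [laplacian, Finset.mul_sum]
      exact Finset.sum_congr rfl fun y _ => by ring
    rw [h1, hsum, mul_zero]
  have hnn : ∀ y ∈ D.verts.filter (fun y => D.Adj v y), 0 ≤ c v y * (σ * (g y - g v)) :=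
    fun y hy => by
      rw [Finset.mem_filter] at hy
      exact mul_nonneg (H.cond.pos v y hy.2).le (hall y hy.2.1)
  have := (Finset.sum_eq_zero_iff_of_nonneg hnn).1 hzero a
    (Finset.mem_filter.2 ⟨ha.1.mem_verts, ha⟩)
  rcases mul_eq_zero.1 this with h | h
  · exact (H.cond.pos v a ha).ne' h
  · rcases mul_eq_zero.1 h with h | h
    · exact hσ h
    · exact H.ne_of_joined hvr ha.1 (sub_eq_zero.1 h).symm

/-- At a point of `Ω` that is not a vertex, the smallest face containing it has a vertex of smaller
and a vertex of larger value. -/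
theorem exists_lt_of_mem_openHull (H : D.IsSolution c k g) {p : Plane} (hp : p ∈ D.region)
    {f : Finset Plane} (hf : f ∈ D.complex.faces) (hpf : p ∈ openHull f) (hpv : p ∉ D.verts)
    {σ : ℝ} (hσ : σ ≠ 0) : ∃ a ∈ f, σ * (g a - g p) < 0 := by
  by_contra! hex
  have hconst : ∀ a ∈ f, g a = g p := by
    obtain ⟨w, h0, h1, h2⟩ := hpf
    have hg : ∑ v ∈ f, w v * (σ * (g v - g p)) = 0 := by
      have h3 : g p = ∑ v ∈ f, w v * g v := by
        rw [← h2]; exact H.g_sum hf (fun v hv => (h0 v hv).le) h1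
      have h4 : ∑ v ∈ f, w v * (σ * (g v - g p)) =
          σ * (∑ v ∈ f, w v * g v - (∑ v ∈ f, w v) * g p) := by
        rw [Finset.sum_mul, ← Finset.sum_sub_distrib, Finset.mul_sum]
        exact Finset.sum_congr rfl fun v _ => by ring
      rw [h4, ← h3, h1]; ring
    intro a ha
    have := (Finset.sum_eq_zero_iff_of_nonneg fun v hv =>
      mul_nonneg (h0 v hv).le (hex v hv)).1 hg a ha
    rcases mul_eq_zero.1 this with h | h
    · exact absurd h (h0 a ha).ne'
    · rcases mul_eq_zero.1 h with h | h
      · exact absurd h hσ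
      · exact sub_eq_zero.1 h
  have hpos := Finset.card_pos.2 (D.complex.nonempty_of_mem_faces hf)
  have h3 := card_le_three hf
  have hcases : f.card = 1 ∨ f.card = 2 ∨ f.card = 3 := by omega
  rcases hcases with h | h | h
  · obtain ⟨v, rfl⟩ := Finset.card_eq_one.1 h
    have hpv' := openHull_subset_hull _ hpf
    rw [hull, Finset.coe_singleton, convexHull_singleton, mem_singleton_iff] at hpv'
    exact hpv (hpv' ▸ mem_verts.2 hf)
  · obtain ⟨a, b, hab, rfl⟩ := Finset.card_eq_two.1 h
    refine absurd ((hconst a (by simp)).trans (hconst b (by simp)).symm) ?_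
    refine H.nondeg a b ⟨hab, hf⟩ fun hseg => ?_
    rw [← hull_pair] at hseg
    exact disjoint_left.1 D.disjoint_region_frontier hp (hseg (openHull_subset_hull _ hpf))
  · obtain ⟨a, ha, b, hb, hab⟩ := H.exists_ne ⟨hf, h⟩
    exact absurd ((hconst a ha).trans (hconst b hb).symm) hab

/-- Every interior point lies in a triangle with a vertex of smaller value, and in one with a
vertex of larger value. -/
theorem exists_tri_lt (H : D.IsSolution c k g) {p : Plane} (hp : p ∈ D.region) {σ : ℝ}
    (hσ : σ ≠ 0) : ∃ s, D.IsTri s ∧ p ∈ hull s ∧ ∃ a ∈ s, σ * (g a - g p) < 0 := by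
  by_cases hpv : p ∈ D.verts
  · obtain ⟨a, hja, hlt⟩ := H.exists_joined_lt hpv hp hσ
    obtain ⟨s, hs, hps, has⟩ := hja.exists_tri
    exact ⟨s, hs, subset_convexHull ℝ _ hps, a, has, hlt⟩
  · obtain ⟨f, hf, hpf⟩ := exists_face (subset_closure hp)
    obtain ⟨a, ha, hlt⟩ := H.exists_lt_of_mem_openHull hp hf hpf hpv hσ
    obtain ⟨s, hs, hps⟩ := exists_tri (subset_closure hp)
    exact ⟨s, hs, hps, a, subset_of_mem_openHull hf hs.1 hpf hps ha, hlt⟩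

theorem continuousOn_hull (H : D.IsSolution c k g) {s : Finset Plane} (hs : D.IsTri s) :
    ContinuousOn g (hull s) := by
  obtain ⟨l, hl⟩ := exists_isBary (D.complex.indep hs.1) hs.2
  have hc : Continuous fun x => ∑ v ∈ s, l v x * g v :=
    continuous_finsetSum _ fun v _ => (hl.continuous v).mul continuous_const
  refine hc.continuousOn.congr fun x hx => ?_
  conv_lhs => rw [← hl.sum_smul x]
  exact H.g_sum hs.1 (hl.mem_hull.1 hx) (hl.sum_one x)

theorem closure_eq_iUnion : closure D.region = ⋃ s : {s // D.IsTri s}, hull s.1 := by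
  ext x
  constructor
  · intro hx
    obtain ⟨s, hs, hxs⟩ := exists_tri hx
    exact mem_iUnion.2 ⟨⟨s, hs⟩, hxs⟩
  · intro hx
    obtain ⟨s, hs⟩ := mem_iUnion.1 hx
    exact hull_subset_closure s.2.1 hs

theorem finite_tri : {s | D.IsTri s}.Finite := D.finite_faces.subset fun _ hs => hs.1

theorem continuousOn (H : D.IsSolution c k g) : ContinuousOn g (closure D.region) := by
  rw [closure_eq_iUnion]
  have : Finite {s // D.IsTri s} := finite_tri.to_subtype
  exact LocallyFinite.continuousOn_iUnion (locallyFinite_of_finite _)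
    (fun s => isClosed_hull s.1) fun s => H.continuousOn_hull s.2

theorem ext_of_mem {x : Plane} (hx : x ∈ closure D.region) : D.ext k g x = g x := if_pos hx

theorem ext_of_outside {x : Plane} (hx : x ∈ outside D.outer) : D.ext k g x = k := by
  rw [ext, if_neg fun h => disjoint_left.1 D.disjoint_closure_outside_outer h hx, if_pos hx]

theorem ext_of_hole {x : Plane} {i} (hx : x ∈ inside (D.inner i)) : D.ext k g x = 0 := by
  rw [ext, if_neg fun h => disjoint_left.1 (D.disjoint_closure_inside_inner i) h hx, if_neg]
  intro hxo
  have h2 : closure (outside D.outer) ⊆ outside (D.inner i) := by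
    refine subset_outside_of_isPreconnected
      (isConnected_outside D.outer_simple.isBounded).isPreconnected.closure
      (fun hb => outside_not_isBounded D.outer_simple.isBounded (hb.subset subset_closure)) ?_
    rw [D.outer_simple.closure_outside, disjoint_union_left]
    refine ⟨disjoint_left.2 fun x hx hx' => ?_, D.outer_disjoint_inner i⟩
    exact disjoint_left.1 disjoint_inside_outside (D.inner_subset_inside_outer i hx') hx
  exact disjoint_left.1 disjoint_inside_outside hx (h2 (subset_closure hxo))

/-- The closure of Ω, the closed exterior of E₁ and the closed holes cover the plane, and the
prescribed values agree on the boundary curves. -/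
theorem continuous_ext (H : D.IsSolution c k g) : Continuous (D.ext k g) := by
  let S : Option (Option (Fin (D.holes + 1))) → Set Plane
    | none => closure D.region
    | some none => closure (outside D.outer)
    | some (some i) => closure (inside (D.inner i))
  refine (locallyFinite_of_finite S).continuous (iUnion_eq_univ_iff.2 fun x => ?_) ?_ ?_
  · by_cases hx : x ∈ closure D.region
    · exact ⟨none, hx⟩
    · rcases D.mem_of_notMem_closure hx with h | ⟨i, h⟩
      · exact ⟨some none, subset_closure h⟩
      · exact ⟨some (some i), subset_closure h⟩
  · rintro (_ | _ | i) <;> exact isClosed_closure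
  · rintro (_ | _ | i)
    · exact H.continuousOn.congr fun x hx => ext_of_mem hx
    · refine (continuousOn_const (c := k)).congr fun x hx => ?_
      change x ∈ closure (outside D.outer) at hx
      rw [D.outer_simple.closure_outside] at hx
      rcases hx with hx | hx
      · exact ext_of_outside hx
      · rw [ext_of_mem (D.outer_subset_closure hx), H.value_outer hx]
    · refine (continuousOn_const (c := (0 : ℝ))).congr fun x hx => ?_
      change x ∈ closure (inside (D.inner i)) at hx
      rw [(D.inner_simple i).closure_inside] at hx
      rcases hx with hx | hx
      · exact ext_of_hole hx
      · rw [ext_of_mem (D.inner_subset_closure i hx), H.value_inner hx]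

/-- The minimum of σ g over the closure of Ω is attained, but never in Ω, where some triangle has a
vertex of smaller σ g. The cases σ = 1 and σ = -1 give both bounds for g. -/
theorem exists_max (H : D.IsSolution c k g) {σ : ℝ} (hσ : σ ≠ 0) {x : Plane}
    (hx : x ∈ D.region) : ∃ o, σ * bdryValue D k o < σ * g x := by
  have hc : IsCompact (closure D.region) := D.isBounded_region.isCompact_closure
  obtain ⟨p, hp, hmax⟩ := hc.exists_isMinOn ⟨x, subset_closure hx⟩
    (H.continuousOn.const_smul σ)
  have hmin : ∀ y ∈ closure D.region, σ * g p ≤ σ * g y := fun y hy => hmax hy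
  have hnot : ∀ q ∈ D.region, σ * g p < σ * g q := fun q hq => by
    obtain ⟨s, hs, -, a, ha, hlt⟩ := H.exists_tri_lt hq hσ
    have := hmin a (vert_mem_closure (mem_verts_of_mem hs.1 ha))
    rw [mul_sub] at hlt
    linarith
  rw [D.closure_eq] at hp
  rcases hp with hp | hp
  · exact absurd (hnot p hp) (lt_irrefl _)
  · rw [D.frontier_eq_bdry] at hp
    obtain ⟨o, ho⟩ := mem_iUnion.1 hp
    exact ⟨o, by rw [← H.value_of_bdry ho]; exact hnot x hx⟩

theorem pos_of_mem (H : D.IsSolution c k g) {x : Plane} (hx : x ∈ D.region) : 0 < g x := by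
  obtain ⟨o, ho⟩ := H.exists_max one_ne_zero hx
  rw [one_mul, one_mul] at ho
  rcases o with _ | i
  · exact H.pos.trans ho
  · exact ho

theorem lt_of_mem (H : D.IsSolution c k g) {x : Plane} (hx : x ∈ D.region) : g x < k := by
  obtain ⟨o, ho⟩ := H.exists_max (neg_ne_zero.2 one_ne_zero) hx
  rw [neg_one_mul, neg_one_mul, neg_lt_neg_iff] at ho
  rcases o with _ | i
  · exact ho
  · exact ho.trans H.pos

theorem mem_region_of_value (H : D.IsSolution c k g) {x : Plane} (hx : x ∈ closure D.region)
    (h0 : g x ≠ 0) (hk : g x ≠ k) : x ∈ D.region := by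
  rw [D.closure_eq] at hx
  refine hx.resolve_right fun hf => ?_
  rw [D.frontier_eq_bdry] at hf
  obtain ⟨o, ho⟩ := mem_iUnion.1 hf
  have := H.value_of_bdry ho
  rcases o with _ | i
  · exact hk this
  · exact h0 this

theorem mem_outer_of_value (H : D.IsSolution c k g) {x : Plane} (hx : x ∈ closure D.region)
    (hk : g x = k) : x ∈ D.outer := by
  rw [D.closure_eq] at hx
  rcases hx with h | hf
  · exact absurd hk (H.lt_of_mem h).ne
  · rw [D.frontier_eq_bdry] at hf
    obtain ⟨o, ho⟩ := mem_iUnion.1 hf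
    have := H.value_of_bdry ho
    rcases o with _ | i
    · exact ho
    · exact absurd (hk.symm.trans this) H.pos.ne'

theorem mem_inner_of_value (H : D.IsSolution c k g) {x : Plane} (hx : x ∈ closure D.region)
    (h0 : g x = 0) : ∃ i, x ∈ D.inner i := by
  rw [D.closure_eq] at hx
  rcases hx with h | hf
  · exact absurd h0 (H.pos_of_mem h).ne'
  · rw [D.frontier_eq_bdry] at hf
    obtain ⟨o, ho⟩ := mem_iUnion.1 hf
    have := H.value_of_bdry ho
    rcases o with _ | i
    · exact absurd (this.symm.trans h0) H.pos.ne'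
    · exact ⟨i, ho⟩

theorem value_mem_Icc (H : D.IsSolution c k g) {x : Plane} (hx : x ∈ closure D.region) :
    g x ∈ Icc 0 k := by
  rw [D.closure_eq] at hx
  rcases hx with h | hf
  · exact ⟨(H.pos_of_mem h).le, (H.lt_of_mem h).le⟩
  · rw [D.frontier_eq_bdry] at hf
    obtain ⟨o, ho⟩ := mem_iUnion.1 hf
    rw [H.value_of_bdry ho]
    rcases o with _ | i
    · exact ⟨H.pos.le, le_rfl⟩
    · exact ⟨le_rfl, H.pos.le⟩

end IsSolution

end CellularDomain

/-! ### Components of sublevel sets, and their number at a vertex. -/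

namespace CellularDomain

variable (D : CellularDomain)

/-- The sublevel set of the extension of `g`. -/
def sub (k : ℝ) (g : Plane → ℝ) (t : ℝ) : Set Plane := {x | D.ext k g x < t}

/-- `V` is a component of the sublevel set. -/
def IsLowComp (k : ℝ) (g : Plane → ℝ) (t : ℝ) (V : Set Plane) : Prop :=
  ∃ x ∈ D.sub k g t, V = connectedComponentIn (D.sub k g t) x

namespace IsSolution

open scoped Classical

variable {D} {c : Plane → Plane → ℝ} {k : ℝ} {g : Plane → ℝ}

theorem isOpen_sub (H : D.IsSolution c k g) (t : ℝ) : IsOpen (D.sub k g t) :=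
  isOpen_lt H.continuous_ext continuous_const

theorem mem_sub {x : Plane} (hx : x ∈ closure D.region) {t : ℝ} :
    x ∈ D.sub k g t ↔ g x < t := by
  change D.ext k g x < t ↔ _
  rw [ext_of_mem hx]

theorem exists_lowComp {t : ℝ} {x : Plane} (hx : x ∈ D.sub k g t) :
    ∃ V, D.IsLowComp k g t V ∧ x ∈ V :=
  ⟨_, ⟨x, hx, rfl⟩, mem_connectedComponentIn hx⟩

theorem g_vert_lt_of_hull (H : D.IsSolution c k g) {s : Finset Plane} (hs : s ∈ D.complex.faces)
    {x : Plane} (hx : x ∈ hull s) {t : ℝ} (hxt : g x < t) : ∃ a ∈ s, g a < t := by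
  by_contra! hall
  obtain ⟨w, h0, h1, rfl⟩ := Finset.mem_convexHull'.1 hx
  rw [H.g_sum hs h0 h1] at hxt
  have : t = ∑ v ∈ s, w v * t := by rw [← Finset.sum_mul, h1, one_mul]
  have h2 : ∑ v ∈ s, w v * t ≤ ∑ v ∈ s, w v * g v :=
    Finset.sum_le_sum fun v hv => mul_le_mul_of_nonneg_left (hall v hv) (h0 v hv)
  linarith

theorem convex_low (H : D.IsSolution c k g) {s : Finset Plane} (hs : s ∈ D.complex.faces)
    (t : ℝ) : Convex ℝ {x ∈ hull s | g x < t} := by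
  intro x hx y hy a b ha hb hab
  refine ⟨convex_convexHull ℝ _ hx.1 hy.1 ha hb hab, ?_⟩
  rw [H.sol.affine s hs x hx.1 y hy.1 a b ha hb hab]
  have hx2 := hx.2
  have hy2 := hy.2
  rcases ha.eq_or_lt with h | h
  · have : b = 1 := by linarith
    rw [← h, this]; linarith
  · have h1 : a * g x < a * t := mul_lt_mul_of_pos_left hx2 h
    have h2 : b * g y ≤ b * t := mul_le_mul_of_nonneg_left hy2.le hb
    have h3 : a * t + b * t = t := by rw [← add_mul, hab, one_mul]
    linarith

end IsSolution

namespace IsLowComp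

open IsSolution

variable {D} {c : Plane → Plane → ℝ} {k : ℝ} {g : Plane → ℝ} {t : ℝ} {V V' : Set Plane}

theorem subset_sub (hV : D.IsLowComp k g t V) : V ⊆ D.sub k g t := by
  obtain ⟨x, hx, rfl⟩ := hV
  exact connectedComponentIn_subset _ _

theorem isConnected (hV : D.IsLowComp k g t V) : IsConnected V := by
  obtain ⟨x, hx, rfl⟩ := hV
  exact isConnected_connectedComponentIn_iff.2 hx

theorem isOpen (H : D.IsSolution c k g) (hV : D.IsLowComp k g t V) : IsOpen V := by
  obtain ⟨x, hx, rfl⟩ := hV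
  exact (H.isOpen_sub t).connectedComponentIn

theorem subset_of_meets (hV : D.IsLowComp k g t V) {S : Set Plane} (hS : IsPreconnected S)
    (hSt : S ⊆ D.sub k g t) (hne : (S ∩ V).Nonempty) : S ⊆ V := by
  obtain ⟨x, hx, rfl⟩ := hV
  obtain ⟨y, hyS, hyV⟩ := hne
  rw [connectedComponentIn_eq hyV]
  exact hS.subset_connectedComponentIn hyS hSt

theorem eq_of_meets (hV : D.IsLowComp k g t V) (hV' : D.IsLowComp k g t V')
    (h : (V ∩ V').Nonempty) : V = V' :=
  Subset.antisymm (hV'.subset_of_meets hV.isConnected.isPreconnected hV.subset_sub h)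
    (hV.subset_of_meets hV'.isConnected.isPreconnected hV'.subset_sub (by rwa [inter_comm]))

/-- The part of a face with g < t is convex, so it lies in V as soon as it meets V. -/
theorem low_mem (H : D.IsSolution c k g) (hV : D.IsLowComp k g t V) {s : Finset Plane}
    (hs : s ∈ D.complex.faces) {x y : Plane} (hx : x ∈ hull s) (hxV : x ∈ V) (hy : y ∈ hull s)
    (hyt : g y < t) : y ∈ V := by
  have hcl := hull_subset_closure hs
  refine hV.subset_of_meets (H.convex_low hs t).isPreconnected
    (fun z hz => (mem_sub (hcl hz.1)).2 hz.2) ⟨x, ⟨hx, ?_⟩, hxV⟩ ⟨hy, hyt⟩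
  exact (mem_sub (hcl hx)).1 (hV.subset_sub hxV)

theorem g_lt (hV : D.IsLowComp k g t V) {x : Plane} (hx : x ∈ closure D.region) (hxV : x ∈ V) :
    g x < t := (mem_sub hx).1 (hV.subset_sub hxV)

theorem ext_le_of_closure (H : D.IsSolution c k g) (hV : D.IsLowComp k g t V) {x : Plane}
    (hx : x ∈ closure V) : D.ext k g x ≤ t :=
  closure_minimal (fun _ hy => (hV.subset_sub hy).le)
    (isClosed_le H.continuous_ext continuous_const) hx

/-- A frontier point of value < t would have an open component around it, which meets V and so
equals V. -/
theorem ext_eq_of_frontier (H : D.IsSolution c k g) (hV : D.IsLowComp k g t V) {x : Plane}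
    (hx : x ∈ frontier V) : D.ext k g x = t := by
  refine (hV.ext_le_of_closure H hx.1).eq_or_lt.resolve_right fun hlt => ?_
  obtain ⟨V', hV', hxV'⟩ := exists_lowComp (D := D) (k := k) (g := g) (t := t) hlt
  obtain ⟨y, hy', hy⟩ := mem_closure_iff.1 hx.1 V' (hV'.isOpen H) hxV'
  rw [(hV.isOpen H).frontier_eq, hV.eq_of_meets hV' ⟨y, hy, hy'⟩] at hx
  exact hx.2 hxV'

end IsLowComp

namespace IsSolution

open scoped Classical

variable {D} {c : Plane → Plane → ℝ} {k : ℝ} {g : Plane → ℝ}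

theorem openHull_pair_meets {v a : Plane} (hv : v ∈ D.region) (hva : v ≠ a) :
    (openHull {v, a} ∩ D.region).Nonempty := by
  have : v ∈ closure (openSegment ℝ v a) := by
    rw [closure_openSegment]; exact left_mem_segment ℝ v a
  obtain ⟨y, hy1, hy2⟩ := mem_closure_iff.1 this _ D.isOpen_region hv
  exact ⟨y, (mem_openHull_pair hva).2 hy2, hy1⟩

/-- The triangles at `v` that have a vertex in `V` and a vertex of larger value than `v`. -/
def turnTris (D : CellularDomain) (g : Plane → ℝ) (v : Plane) (V : Set Plane) :
    Set (Finset Plane) :=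
  {s | D.IsTri s ∧ v ∈ s ∧ (∃ a ∈ s, a ∈ V) ∧ ∃ b ∈ s, g v < g b}

/-- A component of the sublevel set adjacent to an interior vertex `v` is bounded, near `v`, by at
least two level segments ending at `v`. -/
theorem two_le_turnTris (H : D.IsSolution c k g) {v : Plane} (hv : v ∈ D.verts)
    (hvr : v ∈ D.region) {V : Set Plane} (hV : D.IsLowComp k g (g v) V)
    (hex : ∃ s, D.IsTri s ∧ v ∈ s ∧ ∃ a ∈ s, a ∈ V) : 2 ≤ (turnTris D g v V).ncard := by
  let F : Finset (Finset Plane) := (finite_tri (D := D)).toFinset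
  have hF : ∀ {s}, s ∈ F ↔ D.IsTri s := fun {s} => by simp [F]
  let T : Finset (Finset Plane) := F.filter fun s => v ∈ s ∧ ∃ a ∈ s, a ∈ V
  let E : Finset Plane := D.verts.filter fun a => D.Joined v a ∧ a ∈ V
  let L : Finset (Finset Plane) := T.filter fun s => ∃ b ∈ s, g v < g b
  have hLset : turnTris D g v V = L := by
    ext s
    simp only [turnTris, L, T, Finset.coe_filter, Finset.mem_filter, hF, mem_ofPred_eq]
    tauto
  have hmemV : ∀ {s a}, D.IsTri s → v ∈ s → a ∈ s → a ∈ V → a ≠ v ∧ g a < g v :=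
    fun {s a} hs hvs ha haV => by
      have hlt := hV.g_lt (vert_mem_closure (mem_verts_of_mem hs.1 ha)) haV
      exact ⟨fun h => by rw [h] at hlt; exact lt_irrefl _ hlt, hlt⟩
  have hallV : ∀ {s a u}, D.IsTri s → v ∈ s → a ∈ s → a ∈ V → u ∈ s → u ≠ v →
      (¬ ∃ b ∈ s, g v < g b) → u ∈ V := fun {s a u} hs hvs ha haV hu huv hno => by
    have hne := H.ne_of_joined hvr (joined_of_mem hs.1 hvs hu huv.symm)
    have hlt : g u < g v := lt_of_le_of_ne (not_lt.1 fun h => hno ⟨u, hu, h⟩) hne.symm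
    exact hV.low_mem H hs.1 (subset_convexHull ℝ _ ha) haV (subset_convexHull ℝ _ hu) hlt
  -- Count the pairs of a neighbour a ∈ V of v and a triangle s at v containing a. Each a lies in
  -- two triangles; a triangle of T contains two such a, but only one if it has a vertex above v.
  have hcount := Finset.sum_card_bipartiteAbove_eq_sum_card_bipartiteBelow (s := E) (t := T)
    (fun (a : Plane) (s : Finset Plane) => a ∈ s)
  have hE : ∀ a ∈ E, (T.bipartiteAbove (fun (a : Plane) (s : Finset Plane) => a ∈ s) a).card = 2 := by
    intro a ha
    rw [Finset.mem_filter] at ha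
    obtain ⟨-, hja, haV⟩ := ha
    obtain ⟨s, s', hs, hes, hs', hes', hne, huniq⟩ := exists_two_tri hja.2
      (Finset.card_pair hja.1) (openHull_pair_meets hvr hja.1)
    have : T.bipartiteAbove (fun (a : Plane) (s : Finset Plane) => a ∈ s) a = {s, s'} := by
      ext u
      simp only [Finset.mem_bipartiteAbove, T, Finset.mem_filter, hF, Finset.mem_insert,
        Finset.mem_singleton]
      constructor
      · rintro ⟨⟨hu, hvu, -⟩, hau⟩
        refine huniq u hu fun x hx => ?_
        rw [Finset.mem_insert, Finset.mem_singleton] at hx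
        rcases hx with rfl | rfl <;> assumption
      · rintro (rfl | rfl)
        · exact ⟨⟨hs, hes (by simp), a, hes (by simp), haV⟩, hes (by simp)⟩
        · exact ⟨⟨hs', hes' (by simp), a, hes' (by simp), haV⟩, hes' (by simp)⟩
    rw [this, Finset.card_pair hne]
  have hT : ∀ s ∈ T, (E.bipartiteBelow (fun (a : Plane) (s : Finset Plane) => a ∈ s) s).card +
      (if ∃ b ∈ s, g v < g b then 1 else 0) = 2 := by
    intro s hs
    rw [Finset.mem_filter, hF] at hs
    obtain ⟨hs, hvs, a, ha, haV⟩ := hs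
    obtain ⟨hav, hagv⟩ := hmemV hs hvs ha haV
    have heq : E.bipartiteBelow (fun (a : Plane) (s : Finset Plane) => a ∈ s) s =
        (s.erase v).filter (· ∈ V) := by
      ext u
      simp only [Finset.mem_bipartiteBelow, E, Finset.mem_filter, Finset.mem_erase]
      constructor
      · rintro ⟨⟨-, hju, huV⟩, hus⟩
        exact ⟨⟨hju.1.symm, hus⟩, huV⟩
      · rintro ⟨⟨huv, hus⟩, huV⟩
        exact ⟨⟨mem_verts_of_mem hs.1 hus, joined_of_mem hs.1 hvs hus huv.symm, huV⟩, hus⟩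
    have hc : (s.erase v).card = 2 := by rw [Finset.card_erase_of_mem hvs, hs.2]
    rw [heq]
    split_ifs with hb
    · obtain ⟨b, hb, hgb⟩ := hb
      have hbv : b ≠ v := fun h => by rw [h] at hgb; exact lt_irrefl _ hgb
      have hbV : b ∉ V := fun h => (hmemV hs hvs hb h).2.not_gt hgb
      have hab : a ≠ b := fun h => hbV (h ▸ haV)
      have hs2 : s.erase v = {a, b} := by
        refine (Finset.eq_of_subset_of_card_le (fun x hx => ?_) ?_).symm
        · rw [Finset.mem_insert, Finset.mem_singleton] at hx
          rcases hx with rfl | rfl <;> simp [*]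
        · rw [hc, Finset.card_pair hab]
      rw [hs2, Finset.filter_insert, if_pos haV, Finset.filter_singleton, if_neg hbV]
      simp
    · rw [Finset.filter_true_of_mem fun u hu => by
        rw [Finset.mem_erase] at hu
        exact hallV hs hvs ha haV hu.2 hu.1 hb, hc]
  -- Hence the number of turning triangles is even, and it remains to exclude zero.
  have hsum : 2 * E.card + L.card = 2 * T.card := by
    have h1 := Finset.sum_congr rfl hT
    rw [Finset.sum_add_distrib, ← hcount, Finset.sum_congr rfl hE, Finset.sum_const,
      Finset.sum_const, ← Finset.card_filter] at h1
    simp only [smul_eq_mul] at h1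
    linarith
  -- Without a turning triangle, membership in V spreads through the whole star of v, leaving no
  -- neighbour of larger value.
  have hL0 : L.card ≠ 0 := by
    intro h0
    rw [Finset.card_eq_zero] at h0
    have hnoL : ∀ {s}, D.IsTri s → v ∈ s → (∃ a ∈ s, a ∈ V) → ¬ ∃ b ∈ s, g v < g b :=
      fun {s} hs hvs hP hb => by
        have : s ∈ L := Finset.mem_filter.2 ⟨Finset.mem_filter.2 ⟨hF.2 hs, hvs, hP⟩, hb⟩
        rw [h0] at this
        exact absurd this (Finset.notMem_empty _)
    obtain ⟨s₀, hs₀, hvs₀, hP₀⟩ := hex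
    have hall := star_connected D.finite_faces D.isOpen_region region_subset_space hvr
      (fun s => ∃ a ∈ s, a ∈ V) (mem_verts.1 hv) (by
        rintro s hs hc hvs ⟨a, ha, haV⟩ u hu huv s' hs' hc' hvs' hus'
        exact ⟨u, hus', hallV ⟨hs, hc⟩ hvs ha haV hu huv (hnoL ⟨hs, hc⟩ hvs ⟨a, ha, haV⟩)⟩)
      ⟨s₀, hs₀.1, hs₀.2, hvs₀, hP₀⟩
    obtain ⟨b, hjb, hlt⟩ := H.exists_joined_lt hv hvr (neg_ne_zero.2 one_ne_zero)
    obtain ⟨s, hs, hvs, hbs⟩ := hjb.exists_tri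
    exact hnoL hs hvs (hall s hs.1 hs.2 hvs) ⟨b, hbs, by linarith⟩
  rw [hLset, Set.ncard_coe_finset]
  omega

theorem finite_turnTris (v : Plane) (V : Set Plane) : (turnTris D g v V).Finite :=
  (finite_tri (D := D)).subset fun _ hs => hs.1

/-- Near a point that is not a singular vertex, the sublevel set is connected. -/
theorem mem_lowComp_of_regular (H : D.IsSolution c k g) {p : Plane} (hp : p ∈ D.region)
    (hreg : p ∈ D.verts → D.index g p = 0) {V : Set Plane} (hV : D.IsLowComp k g (g p) V)
    {s s' : Finset Plane} (hs : D.IsTri s) (hps : p ∈ hull s) (hs' : D.IsTri s')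
    (hps' : p ∈ hull s') {a a' : Plane} (ha : a ∈ s) (haV : a ∈ V) (ha' : a' ∈ s')
    (hlt : g a' < g p) : a' ∈ V := by
  by_cases hpv : p ∈ D.verts
  · have hpvs := vert_mem_of_mem_hull hpv hs.1 hps
    have hpvs' := vert_mem_of_mem_hull hpv hs'.1 hps'
    have hcl := vert_mem_closure (mem_verts_of_mem hs'.1 ha')
    obtain ⟨V', hV', haV'⟩ := exists_lowComp (D := D) (k := k) (g := g) ((mem_sub hcl).2 hlt)
    have h1 := H.two_le_turnTris hpv hp hV ⟨s, hs, hpvs, a, ha, haV⟩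
    have h2 := H.two_le_turnTris hpv hp hV' ⟨s', hs', hpvs', a', ha', haV'⟩
    have h3 : D.signChanges g p = 2 := by
      have := hreg hpv
      rw [index] at this
      have h4 : (D.signChanges g p : ℝ) = 2 := by linarith
      exact_mod_cast h4
    -- A triangle shared by the turning triangles of V and V' would join the two components. So they
    -- are disjoint and force at least four sign changes, but index zero means two.
    by_contra hnot
    have hdisj : Disjoint (turnTris D g p V) (turnTris D g p V') := by
      rw [disjoint_left]
      rintro u ⟨hu, -, ⟨x, hx, hxV⟩, -⟩ ⟨-, -, ⟨y, hy, hyV⟩, -⟩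
      have hylt := hV'.g_lt (vert_mem_closure (mem_verts_of_mem hu.1 hy)) hyV
      have hyV2 := hV.low_mem H hu.1 (subset_convexHull ℝ _ hx) hxV (subset_convexHull ℝ _ hy) hylt
      exact hnot (hV.eq_of_meets hV' ⟨y, hyV2, hyV⟩ ▸ haV')
    have hsub : turnTris D g p V ∪ turnTris D g p V' ⊆ {s : Finset Plane | s ∈ D.complex.faces ∧
        s.card = 3 ∧ p ∈ s ∧ ∃ a ∈ s, ∃ b ∈ s, g a < g p ∧ g p < g b} := by
      rintro u (⟨hu, hpu, ⟨x, hx, hxV⟩, b, hb, hgb⟩ | ⟨hu, hpu, ⟨x, hx, hxV⟩, b, hb, hgb⟩)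
      · exact ⟨hu.1, hu.2, hpu, x, hx, b, hb,
          hV.g_lt (vert_mem_closure (mem_verts_of_mem hu.1 hx)) hxV, hgb⟩
      · exact ⟨hu.1, hu.2, hpu, x, hx, b, hb,
          hV'.g_lt (vert_mem_closure (mem_verts_of_mem hu.1 hx)) hxV, hgb⟩
    have h4 := Set.ncard_le_ncard hsub (D.finite_faces.subset fun _ hs => hs.1)
    rw [Set.ncard_union_eq hdisj (finite_turnTris p V) (finite_turnTris p V')] at h4
    rw [signChanges] at h3
    omega
  · obtain ⟨f, hf, hpf⟩ := exists_face (subset_closure hp)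
    -- The open face carrying p belongs to every triangle through p, so its lower vertex b links s
    -- to s'.
    obtain ⟨b, hb, hblt⟩ := H.exists_lt_of_mem_openHull hp hf hpf hpv one_ne_zero
    have hblt' : g b < g p := by linarith
    have hbs := subset_of_mem_openHull hf hs.1 hpf hps hb
    have hbs' := subset_of_mem_openHull hf hs'.1 hpf hps' hb
    have hbV := hV.low_mem H hs.1 (subset_convexHull ℝ _ ha) haV (subset_convexHull ℝ _ hbs) hblt'
    exact hV.low_mem H hs'.1 (subset_convexHull ℝ _ hbs') hbV (subset_convexHull ℝ _ ha') hlt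

end IsSolution

end CellularDomain

/-! ### Chords of the level curve and the walk along them. -/

namespace CellularDomain

namespace IsSolution

open scoped Classical

variable {D : CellularDomain} {c : Plane → Plane → ℝ} {k : ℝ} {g : Plane → ℝ}

/-- The points of the level curve on the boundary of the triangle `s`. -/
def marks (g : Plane → ℝ) (t : ℝ) (s : Finset Plane) : Set Plane :=
  {x | g x = t ∧ ∃ u ∈ s, ∃ v ∈ s, u ≠ v ∧ x ∈ segment ℝ u v}

theorem g_segment (H : D.IsSolution c k g) {s : Finset Plane} (hs : s ∈ D.complex.faces)
    {u v : Plane} (hu : u ∈ s) (hv : v ∈ s) {a b : ℝ} (ha : 0 ≤ a) (hb : 0 ≤ b)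
    (hab : a + b = 1) : g (a • u + b • v) = a * g u + b * g v :=
  H.sol.affine s hs u (subset_convexHull ℝ _ hu) v (subset_convexHull ℝ _ hv) a b ha hb hab

theorem segment_level_unique (H : D.IsSolution c k g) {s : Finset Plane}
    (hs : s ∈ D.complex.faces) {u v : Plane} (hu : u ∈ s) (hv : v ∈ s) (hne : g u ≠ g v)
    {x y : Plane} (hx : x ∈ segment ℝ u v) (hy : y ∈ segment ℝ u v) (hxy : g x = g y) :
    x = y := by
  obtain ⟨a, b, ha, hb, hab, rfl⟩ := hx
  obtain ⟨a', b', ha', hb', hab', rfl⟩ := hy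
  rw [H.g_segment hs hu hv ha hb hab, H.g_segment hs hu hv ha' hb' hab'] at hxy
  have h1 : (a - a') * (g u - g v) = 0 := by
    have e1 : b = 1 - a := by linarith
    have e2 : b' = 1 - a' := by linarith
    rw [e1, e2] at hxy
    linear_combination hxy
  have h2 : a = a' := by
    rcases mul_eq_zero.1 h1 with h | h
    · linarith
    · exact absurd (sub_eq_zero.1 h) hne
  have h3 : b = b' := by linarith
  rw [h2, h3]

theorem exists_level_openSegment (H : D.IsSolution c k g) {s : Finset Plane}
    (hs : s ∈ D.complex.faces) {u v : Plane} (hu : u ∈ s) (hv : v ∈ s) {t : ℝ} (hut : g u < t)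
    (hvt : t < g v) : ∃ m ∈ openSegment ℝ u v, g m = t := by
  have hd : 0 < g v - g u := by linarith
  have h1 : 0 < (g v - t) / (g v - g u) := div_pos (by linarith) hd
  have h2 : 0 < (t - g u) / (g v - g u) := div_pos (by linarith) hd
  have h3 : (g v - t) / (g v - g u) + (t - g u) / (g v - g u) = 1 := by
    field_simp; ring
  refine ⟨_, ⟨_, _, h1, h2, h3, rfl⟩, ?_⟩
  rw [H.g_segment hs hu hv h1.le h2.le h3]
  field_simp
  ring

theorem segment_no_level (H : D.IsSolution c k g) {s : Finset Plane}
    (hs : s ∈ D.complex.faces) {u v : Plane} (hu : u ∈ s) (hv : v ∈ s) {t : ℝ}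
    (h : (g u < t ∧ g v < t) ∨ (t < g u ∧ t < g v)) {x : Plane} (hx : x ∈ segment ℝ u v) :
    g x ≠ t := by
  obtain ⟨a, b, ha, hb, hab, rfl⟩ := hx
  rw [H.g_segment hs hu hv ha hb hab]
  intro he
  have h0 : a * (g u - t) + b * (g v - t) = 0 := by
    have : t = (a + b) * t := by rw [hab, one_mul]
    linear_combination he + this
  rcases ha.eq_or_lt with h1 | h1
  · have : b = 1 := by linarith
    rw [← h1, this] at h0
    rcases h with h | h <;> linarith
  · rcases h with h | h
    · have e1 := mul_neg_of_pos_of_neg h1 (sub_neg.2 h.1)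
      have e2 := mul_nonpos_of_nonneg_of_nonpos hb (sub_neg.2 h.2).le
      linarith
    · have e1 := mul_pos h1 (sub_pos.2 h.1)
      have e2 := mul_nonneg hb (sub_pos.2 h.2).le
      linarith

/-- The level curve enters and leaves a triangle with values on both sides of `t` exactly once. -/
theorem marks_eq_pair (H : D.IsSolution c k g) {s : Finset Plane} (hs : D.IsTri s) {t : ℝ}
    {a d : Plane} (ha : a ∈ s) (hd : d ∈ s) (hat : g a < t) (htd : t < g d) :
    ∃ p q, p ≠ q ∧ marks g t s = {p, q} := by
  have had : a ≠ d := fun h => by rw [h] at hat; linarith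
  obtain ⟨b, hb, hsb⟩ := exists_third (Finset.card_pair had) hs.2 (e := {a, d}) (by
    intro x hx
    rw [Finset.mem_insert, Finset.mem_singleton] at hx
    rcases hx with rfl | rfl <;> assumption)
  have hbs : b ∈ s := by rw [hsb]; simp
  rw [Finset.mem_insert, Finset.mem_singleton, not_or] at hb
  obtain ⟨hba, hbd⟩ := hb
  have hmarks : ∀ x, x ∈ marks g t s ↔ g x = t ∧
      (x ∈ segment ℝ a d ∨ x ∈ segment ℝ a b ∨ x ∈ segment ℝ b d) := by
    intro x
    constructor
    · rintro ⟨hx, u, hu, v, hv, huv, hxuv⟩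
      refine ⟨hx, ?_⟩
      rw [hsb] at hu hv
      simp only [Finset.mem_insert, Finset.mem_singleton] at hu hv
      rcases hu with rfl | rfl | rfl <;> rcases hv with rfl | rfl | rfl <;>
        first
        | exact absurd rfl huv
        | simp [hxuv]
        | (rw [segment_symm] at hxuv; simp [hxuv])
    · rintro ⟨hx, h | h | h⟩
      · exact ⟨hx, a, ha, d, hd, had, h⟩
      · exact ⟨hx, a, ha, b, hbs, Ne.symm hba, h⟩
      · exact ⟨hx, b, hbs, d, hd, hbd, h⟩
  have hface : ∀ {u v}, u ∈ s → v ∈ s → u ≠ v → ({u, v} : Finset Plane) ∈ D.complex.faces :=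
    fun {u v} hu hv huv => (joined_of_mem hs.1 hu hv huv).2
  obtain ⟨m, hm, hmt⟩ := H.exists_level_openSegment hs.1 ha hd hat htd
  have hmo := (mem_openHull_pair had).2 hm
  have had' : g a ≠ g d := by linarith
  have hmnot : ∀ {u v}, u ∈ s → v ∈ s → u ≠ v → m ∈ segment ℝ u v → a ∈ ({u, v} : Finset Plane) ∧
      d ∈ ({u, v} : Finset Plane) := fun {u v} hu hv huv hmuv => by
    rw [← hull_pair] at hmuv
    have := subset_of_mem_openHull (hface ha hd had) (hface hu hv huv) hmo hmuv
    exact ⟨this (by simp), this (by simp)⟩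
  -- One point of the level curve is on the side ad. According to the third vertex, the other is on
  -- bd, at b, or on ab.
  rcases lt_trichotomy (g b) t with h | h | h
  · obtain ⟨m', hm', hmt'⟩ := H.exists_level_openSegment hs.1 hbs hd h htd
    refine ⟨m, m', fun hmm => ?_, ?_⟩
    · have := (hmnot hbs hd hbd (openSegment_subset_segment _ _ _ (hmm ▸ hm'))).1
      rw [Finset.mem_insert, Finset.mem_singleton] at this
      exact this.elim (Ne.symm hba) had
    · ext x
      rw [hmarks, mem_insert_iff, mem_singleton_iff]
      constructor
      · rintro ⟨hx, hx1 | hx1 | hx1⟩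
        · exact Or.inl (H.segment_level_unique hs.1 ha hd had' hx1
            (openSegment_subset_segment _ _ _ hm) (hx.trans hmt.symm))
        · exact absurd hx (H.segment_no_level hs.1 ha hbs (Or.inl ⟨hat, h⟩) hx1)
        · exact Or.inr (H.segment_level_unique hs.1 hbs hd (by linarith) hx1
            (openSegment_subset_segment _ _ _ hm') (hx.trans hmt'.symm))
      · rintro (rfl | rfl)
        · exact ⟨hmt, Or.inl (openSegment_subset_segment _ _ _ hm)⟩
        · exact ⟨hmt', Or.inr (Or.inr (openSegment_subset_segment _ _ _ hm'))⟩
  · refine ⟨m, b, fun hmb => ?_, ?_⟩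
    · have := (hmnot ha hbs (Ne.symm hba) (hmb ▸ right_mem_segment ℝ _ _)).2
      rw [Finset.mem_insert, Finset.mem_singleton] at this
      exact this.elim (Ne.symm had) (Ne.symm hbd)
    · ext x
      rw [hmarks, mem_insert_iff, mem_singleton_iff]
      constructor
      · rintro ⟨hx, hx1 | hx1 | hx1⟩
        · exact Or.inl (H.segment_level_unique hs.1 ha hd had' hx1
            (openSegment_subset_segment _ _ _ hm) (hx.trans hmt.symm))
        · exact Or.inr (H.segment_level_unique hs.1 ha hbs (by linarith) hx1
            (right_mem_segment ℝ _ _) (hx.trans h.symm))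
        · exact Or.inr (H.segment_level_unique hs.1 hbs hd (by linarith) hx1
            (left_mem_segment ℝ _ _) (hx.trans h.symm))
      · rintro (rfl | rfl)
        · exact ⟨hmt, Or.inl (openSegment_subset_segment _ _ _ hm)⟩
        · exact ⟨h, Or.inr (Or.inr (left_mem_segment ℝ _ _))⟩
  · obtain ⟨m', hm', hmt'⟩ := H.exists_level_openSegment hs.1 ha hbs hat h
    refine ⟨m, m', fun hmm => ?_, ?_⟩
    · have := (hmnot ha hbs (Ne.symm hba) (openSegment_subset_segment _ _ _ (hmm ▸ hm'))).2
      rw [Finset.mem_insert, Finset.mem_singleton] at this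
      exact this.elim (Ne.symm had) (Ne.symm hbd)
    · ext x
      rw [hmarks, mem_insert_iff, mem_singleton_iff]
      constructor
      · rintro ⟨hx, hx1 | hx1 | hx1⟩
        · exact Or.inl (H.segment_level_unique hs.1 ha hd had' hx1
            (openSegment_subset_segment _ _ _ hm) (hx.trans hmt.symm))
        · exact Or.inr (H.segment_level_unique hs.1 ha hbs (by linarith) hx1
            (openSegment_subset_segment _ _ _ hm') (hx.trans hmt'.symm))
        · exact absurd hx (H.segment_no_level hs.1 hbs hd (Or.inr ⟨h, htd⟩) hx1)
      · rintro (rfl | rfl)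
        · exact ⟨hmt, Or.inl (openSegment_subset_segment _ _ _ hm)⟩
        · exact ⟨hmt', Or.inr (Or.inl (openSegment_subset_segment _ _ _ hm'))⟩

theorem marks_subset_hull {t : ℝ} {s : Finset Plane} {x : Plane} (hx : x ∈ marks g t s) :
    x ∈ hull s := by
  obtain ⟨-, u, hu, v, hv, -, h⟩ := hx
  exact (convex_convexHull ℝ _).segment_subset (subset_convexHull ℝ _ hu)
    (subset_convexHull ℝ _ hv) h

/-- A chord between two level points crosses the interior of the triangle. -/
theorem openSegment_marks_subset (H : D.IsSolution c k g) {s : Finset Plane} (hs : D.IsTri s)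
    {t : ℝ} {a d : Plane} (ha : a ∈ s) (hd : d ∈ s) (hat : g a < t) (htd : t < g d)
    {p q : Plane} (hp : p ∈ marks g t s) (hq : q ∈ marks g t s) (hpq : p ≠ q) :
    openSegment ℝ p q ⊆ openHull s := by
  intro x hx
  by_contra hxs
  have hps := marks_subset_hull hp
  have hqs := marks_subset_hull hq
  have hxh : x ∈ hull s := (convex_convexHull ℝ _).segment_subset hps hqs
    (openSegment_subset_segment _ _ _ hx)
  obtain ⟨u, hu, v, hv, huv, hxuv⟩ := exists_edge_of_notMem_openHull hs.2 hxh hxs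
  obtain ⟨l, hl⟩ := exists_isBary (D.complex.indep hs.1) hs.2
  obtain ⟨w, hw, hsw⟩ := exists_third (Finset.card_pair huv) hs.2 (e := {u, v}) (by
    intro x hx
    rw [Finset.mem_insert, Finset.mem_singleton] at hx
    rcases hx with rfl | rfl <;> assumption)
  have hws : w ∈ s := by rw [hsw]; simp
  rw [Finset.mem_insert, Finset.mem_singleton, not_or] at hw
  have hedge : ∀ y ∈ hull s, l w y = 0 → y ∈ segment ℝ u v := by
    intro y hy h0
    have hy' := hl.mem_hull.1 hy
    have h1 := hl.sum_one y
    have h2 := hl.sum_smul y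
    rw [hsw, Finset.sum_insert (by simp [hw]), Finset.sum_pair huv, h0] at h1 h2
    rw [zero_smul, zero_add] at h2
    rw [zero_add] at h1
    exact ⟨l u y, l v y, hy' u hu, hy' v hv, h1, h2⟩
  have hwx : l w x = 0 := by
    obtain ⟨α, β, -, -, hαβ, rfl⟩ := hxuv
    have := affineMap_sum (l w) (s := {u, v}) (w := fun z => if z = u then α else β) (by
      rw [Finset.sum_pair huv]; simpa [huv.symm] using hαβ)
    rw [Finset.sum_pair huv, Finset.sum_pair huv, hl.other u hu w hws (Ne.symm hw.1),
      hl.other v hv w hws (Ne.symm hw.2)] at this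
    simpa [huv.symm] using this
  obtain ⟨α, β, hα, hβ, hαβ, rfl⟩ := hx
  -- The coordinate of w vanishes at a point strictly between p and q and is nonnegative at both, so
  -- it vanishes at both, and p, q lie on the side uv.
  have hcomb := affineMap_sum (l w) (s := {p, q}) (w := fun z => if z = p then α else β) (by
      rw [Finset.sum_pair hpq]; simpa [hpq.symm] using hαβ)
  rw [Finset.sum_pair hpq, Finset.sum_pair hpq] at hcomb
  simp only [if_true, if_neg hpq.symm, hwx] at hcomb
  have e1 := hl.mem_hull.1 hps w hws
  have e2 := hl.mem_hull.1 hqs w hws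
  have hp0 : l w p = 0 := by
    have := mul_nonneg hβ.le e2
    have h3 : α * l w p ≤ 0 := by linarith
    nlinarith
  have hq0 : l w q = 0 := by
    have := mul_nonneg hα.le e1
    have h3 : β * l w q ≤ 0 := by linarith
    nlinarith
  have hp' := hedge p hps hp0
  have hq' := hedge q hqs hq0
  -- If g is constant on uv, its value there is t, and both a and d would have to be w. Otherwise
  -- the side has only one point of level t.
  by_cases hne : g u = g v
  · have hgu : g u = t := by
      obtain ⟨α', β', hα', hβ', hαβ', rfl⟩ := hp'
      have := hp.1
      rw [H.g_segment hs.1 hu hv hα' hβ' hαβ', ← hne, ← add_mul, hαβ', one_mul] at this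
      exact this
    have hmem : ∀ z ∈ s, z = w ∨ g z = t := fun z hz => by
      rw [hsw] at hz
      simp only [Finset.mem_insert, Finset.mem_singleton] at hz
      rcases hz with rfl | rfl | rfl
      · exact Or.inl rfl
      · exact Or.inr hgu
      · exact Or.inr (hne ▸ hgu)
    rcases hmem a ha with h | h
    · rcases hmem d hd with h' | h'
      · rw [h] at hat; rw [h'] at htd; linarith
      · linarith
    · linarith
  · exact hpq (H.segment_level_unique hs.1 hu hv hne hp' hq' (hp.1.trans hq.1.symm))

/-- `s` carries a segment of the level curve `t` that bounds `V`. -/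
def Mixed (D : CellularDomain) (g : Plane → ℝ) (t : ℝ) (V : Set Plane) (s : Finset Plane) : Prop :=
  D.IsTri s ∧ (∃ a ∈ s, a ∈ V) ∧ ∃ d ∈ s, t < g d

/-- If q is a vertex, `two_le_turnTris` provides a second turning triangle. If q is interior to an
edge, the other triangle at that edge works, since it shares the low end, which is in V, and the
high end. -/
theorem exists_next (H : D.IsSolution c k g) {t : ℝ} (h0 : 0 < t) (hk : t < k) {V : Set Plane}
    (hV : D.IsLowComp k g t V) {s : Finset Plane} (hs : Mixed D g t V s) {q : Plane}
    (hq : q ∈ marks g t s) : ∃ s', Mixed D g t V s' ∧ q ∈ marks g t s' ∧ s' ≠ s := by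
  obtain ⟨hst, ⟨a, ha, haV⟩, d, hd, htd⟩ := hs
  have hqs := marks_subset_hull hq
  obtain ⟨hqt, u, hu, v, hv, huv, hquv⟩ := hq
  have hqr : q ∈ D.region := H.mem_region_of_value (hull_subset_closure hst.1 hqs)
    (by linarith) (by linarith)
  by_cases hqv : q ∈ D.verts
  · subst hqt
    have hqs' := vert_mem_of_mem_hull hqv hst.1 hqs
    have h2 := H.two_le_turnTris hqv hqr hV ⟨s, hst, hqs', a, ha, haV⟩
    obtain ⟨s', ⟨hs't, hqs'', hs'V, d', hd', hlt⟩, hne⟩ :=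
      Set.exists_ne_of_one_lt_ncard (by omega : 1 < (turnTris D g q V).ncard) s
    refine ⟨s', ⟨hs't, hs'V, d', hd', hlt⟩, ⟨rfl, q, hqs'', d', hd', ?_,
      left_mem_segment ℝ _ _⟩, hne⟩
    rintro rfl
    exact lt_irrefl _ hlt
  · have huvf := (joined_of_mem hst.1 hu hv huv)
    have hqu : q ≠ u := fun h => hqv (h ▸ mem_verts_of_mem hst.1 hu)
    have hqv' : q ≠ v := fun h => hqv (h ▸ mem_verts_of_mem hst.1 hv)
    have hqo : q ∈ openSegment ℝ u v := mem_openSegment_of_ne_left_right hqu.symm hqv'.symm hquv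
    have hqo' := (mem_openHull_pair huv).2 hqo
    have hgne : g u ≠ g v := H.nondeg u v huvf fun h =>
      disjoint_left.1 D.disjoint_region_frontier hqr (h hquv)
    obtain ⟨s₁, s₂, hs₁, he₁, hs₂, he₂, hne, -⟩ := exists_two_tri huvf.2 (Finset.card_pair huv)
      ⟨q, hqo', hqr⟩
    have hgq : ∃ x ∈ ({u, v} : Finset Plane), ∃ y ∈ ({u, v} : Finset Plane), g x < t ∧ t < g y := by
      obtain ⟨α, β, hα, hβ, hαβ, rfl⟩ := hqo
      rw [H.g_segment hst.1 hu hv hα.le hβ.le hαβ] at hqt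
      have e : t = (α + β) * t := by rw [hαβ, one_mul]
      have e' : α * (g u - t) + β * (g v - t) = 0 := by linear_combination hqt + e
      rcases lt_trichotomy (g u) t with h | h | h
      · refine ⟨u, by simp, v, by simp, h, ?_⟩
        have h3 := mul_neg_of_pos_of_neg hα (sub_neg.2 h)
        have h4 : 0 < β * (g v - t) := by linarith
        exact sub_pos.1 (pos_of_mul_pos_right h4 hβ.le)
      · rw [h, sub_self, mul_zero, zero_add] at e'
        rcases mul_eq_zero.1 e' with h' | h'
        · exact absurd h' hβ.ne'
        · exact absurd (h.trans (sub_eq_zero.1 h').symm) hgne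
      · refine ⟨v, by simp, u, by simp, ?_, h⟩
        have h3 := mul_pos hα (sub_pos.2 h)
        have h4 : β * (g v - t) < 0 := by linarith
        by_contra hge
        have := mul_nonneg hβ.le (sub_nonneg.2 (not_lt.1 hge))
        linarith
    obtain ⟨x, hx, y, hy, hxt, hty⟩ := hgq
    have hus : ({u, v} : Finset Plane) ⊆ s := by
      intro x hx
      rw [Finset.mem_insert, Finset.mem_singleton] at hx
      rcases hx with rfl | rfl <;> assumption
    have hxV : x ∈ V := hV.low_mem H hst.1 (subset_convexHull ℝ _ ha) haV
      (subset_convexHull ℝ _ (hus hx)) hxt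
    have hgood : ∀ s', D.IsTri s' → {u, v} ⊆ s' → Mixed D g t V s' ∧ q ∈ marks g t s' :=
      fun s' hs' he' => ⟨⟨hs', ⟨x, he' hx, hxV⟩, y, he' hy, hty⟩, hqt, u, he' (by simp), v,
        he' (by simp), huv, hquv⟩
    by_cases h : s₁ = s
    · exact ⟨s₂, (hgood s₂ hs₂ he₂).1, (hgood s₂ hs₂ he₂).2, fun h' => hne (h.trans h'.symm)⟩
    · exact ⟨s₁, (hgood s₁ hs₁ he₁).1, (hgood s₁ hs₁ he₁).2, h⟩

/-- Walking along the level curve on the boundary of `V` closes up to a simple cycle. -/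
theorem exists_levelCycle (H : D.IsSolution c k g) {t : ℝ} (h0 : 0 < t) (hk : t < k)
    {V : Set Plane} (hV : D.IsLowComp k g t V) {s₀ : Finset Plane} (hs₀ : Mixed D g t V s₀) :
    ∃ C, D.IsLevelCycle g t C ∧ ∃ s, Mixed D g t V s ∧ (C ∩ openHull s).Nonempty := by
  have hlow : ∀ {s}, Mixed D g t V s → ∃ a ∈ s, ∃ d ∈ s, g a < t ∧ t < g d := fun {s} hs => by
    obtain ⟨hst, ⟨a, ha, haV⟩, d, hd, htd⟩ := hs
    exact ⟨a, ha, d, hd, hV.g_lt (vert_mem_closure (mem_verts_of_mem hst.1 ha)) haV, htd⟩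
  have hpair : ∀ {s}, Mixed D g t V s → ∃ p q, p ≠ q ∧ marks g t s = {p, q} := fun {s} hs => by
    obtain ⟨a, ha, d, hd, h1, h2⟩ := hlow hs
    exact H.marks_eq_pair hs.1 ha hd h1 h2
  have hchord : ∀ {s p q}, Mixed D g t V s → p ∈ marks g t s → q ∈ marks g t s → p ≠ q →
      openSegment ℝ p q ⊆ openHull s := fun {s p q} hs hp hq hpq => by
    obtain ⟨a, ha, d, hd, h1, h2⟩ := hlow hs
    exact H.openSegment_marks_subset hs.1 ha hd h1 h2 hp hq hpq
  -- A state of the walk is an entry point together with the triangle about to be crossed.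
  let St := {a : Plane × Finset Plane // Mixed D g t V a.2 ∧ a.1 ∈ marks g t a.2}
  have hnext : ∀ a : St, ∃ b : St, b.1.1 ∈ marks g t a.1.2 ∧ b.1.1 ≠ a.1.1 ∧ b.1.2 ≠ a.1.2 := by
    rintro ⟨⟨p, s⟩, hs, hp⟩
    obtain ⟨x, y, hxy, hm⟩ := hpair hs
    simp only at hp hs hm
    obtain ⟨q, hq, hqp⟩ : ∃ q ∈ marks g t s, q ≠ p := by
      rw [hm] at hp ⊢
      rcases hp with rfl | rfl
      · exact ⟨y, by simp, hxy.symm⟩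
      · exact ⟨x, by simp, hxy⟩
    obtain ⟨s', hs', hqs', hne⟩ := H.exists_next h0 hk hV hs hq
    exact ⟨⟨⟨q, s'⟩, hs', hqs'⟩, hq, hqp, hne⟩
  choose F hF1 hF2 hF3 using hnext
  obtain ⟨x₀, y₀, -, hm₀⟩ := hpair hs₀
  let st : ℕ → St := fun n => F^[n] ⟨⟨x₀, s₀⟩, hs₀, by rw [hm₀]; simp⟩
  have hst : ∀ n, st (n + 1) = F (st n) := fun n => Function.iterate_succ_apply' F n _
  let p : ℕ → Plane := fun n => (st n).1.1
  let T : ℕ → Finset Plane := fun n => (st n).1.2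
  have hT : ∀ n, Mixed D g t V (T n) := fun n => (st n).2.1
  have hp : ∀ n, p n ∈ marks g t (T n) := fun n => (st n).2.2
  have hp1 : ∀ n, p (n + 1) ∈ marks g t (T n) := fun n => by
    simp only [p, hst]; exact hF1 _
  have hp2 : ∀ n, p (n + 1) ≠ p n := fun n => by
    simp only [p, hst]; exact hF2 _
  have hT1 : ∀ n, T (n + 1) ≠ T n := fun n => by
    simp only [T, hst]; exact hF3 _
  have hmk : ∀ n, marks g t (T n) = {p n, p (n + 1)} := fun n => by
    obtain ⟨x, y, hxy, hm⟩ := hpair (hT n)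
    have e1 := hp n
    have e2 := hp1 n
    have e3 := hp2 n
    rw [hm] at e1 e2 ⊢
    rcases e1 with e1 | e1 <;> rcases e2 with e2 | e2
    · exact absurd (e2.trans e1.symm) e3
    · rw [e1, e2]
    · rw [e1, e2, pair_comm]
    · exact absurd (e2.trans e1.symm) e3
  have hopen : ∀ n, openSegment ℝ (p n) (p (n + 1)) ⊆ openHull (T n) := fun n =>
    hchord (hT n) (hp n) (hp1 n) (hp2 n).symm
  have hTeq : ∀ {m n x}, x ∈ openHull (T m) → x ∈ openHull (T n) → T m = T n := fun {m n x} hx hy =>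
    Finset.eq_of_subset_of_card_le (subset_of_mem_openHull (hT m).1.1 (hT n).1.1 hx
      (openHull_subset_hull _ hy)) (by rw [(hT m).1.2, (hT n).1.2])
  have hmid : ∀ n, midpoint ℝ (p n) (p (n + 1)) ∈ openSegment ℝ (p n) (p (n + 1)) := fun n => by
    refine ⟨1 / 2, 1 / 2, by norm_num, by norm_num, by norm_num, ?_⟩
    rw [midpoint_eq_smul_add, smul_add]
    simp
  -- Turning straight back would put the midpoint of one chord into two different open triangles.
  have hp3 : ∀ n, p (n + 2) ≠ p n := fun n h => by
    have e1 := hopen n (hmid n)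
    have e2 : midpoint ℝ (p n) (p (n + 1)) ∈ openHull (T (n + 1)) := by
      refine hopen (n + 1) ?_
      rw [show n + 1 + 1 = n + 2 from rfl, h, openSegment_symm]
      exact hmid n
    exact hT1 n (hTeq e1 e2).symm
  have hfin : (⋃ s ∈ {s | Mixed D g t V s}, marks g t s).Finite := by
    refine Set.Finite.biUnion ((finite_tri (D := D)).subset fun s hs => hs.1) fun s hs => ?_
    obtain ⟨x, y, -, hm⟩ := hpair hs
    rw [hm]
    exact (Set.finite_singleton y).insert x
  have hrep : ∃ n, 0 < n ∧ ∃ i, p i = p (i + n) := by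
    have : ¬ Function.Injective p := fun hinj =>
      (Set.infinite_range_of_injective hinj) (hfin.subset (by
        rintro _ ⟨n, rfl⟩
        exact mem_biUnion (x := T n) (hT n) (hp n)))
    rw [Function.not_injective_iff] at this
    obtain ⟨a, b, hab, hne⟩ := this
    rcases lt_or_gt_of_ne hne with h | h
    · exact ⟨b - a, by omega, a, by rw [hab]; congr 1; omega⟩
    · exact ⟨a - b, by omega, b, by rw [← hab]; congr 1; omega⟩
  -- The least distance between two visits to the same point: any n consecutive points of the walk
  -- are then distinct.
  let n := Nat.find hrep
  obtain ⟨hn0, i, hi⟩ := Nat.find_spec hrep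
  change 0 < n at hn0
  change p i = p (i + n) at hi
  have hmin : ∀ {a b}, a < b → b < a + n → p a ≠ p b := fun {a b} h1 h2 he => by
    refine Nat.find_min hrep (m := b - a) (by omega) ⟨by omega, a, ?_⟩
    rw [he]; congr 1; omega
  have hn3 : 3 ≤ n := by
    by_contra hlt
    have : n = 1 ∨ n = 2 := by omega
    rcases this with h | h
    · rw [h] at hi; exact hp2 i hi.symm
    · rw [h] at hi; exact hp3 i hi.symm
  -- The closed piece of the walk, repeated periodically; it closes because p (i + n) = p i.
  let P : ℤ → Plane := fun m => p (i + (m % n).toNat)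
  have hnz : (0 : ℤ) < n := by exact_mod_cast hn0
  have hPper : ∀ m, P (m + n) = P m := fun m => by simp only [P, Int.add_emod_right]
  have hPval : ∀ m : ℕ, m ≤ n → P m = p (i + m) := fun m hm => by
    simp only [P]
    rcases hm.eq_or_lt with h | h
    · rw [h, Int.emod_self, ← hi]; rfl
    · rw [← Int.natCast_mod, Nat.mod_eq_of_lt h, Int.toNat_natCast]
  have hPseg : ∀ m : ℤ, ∃ j : ℕ, P m = p j ∧ P (m + 1) = p (j + 1) := fun m => by
    have h1 := Int.emod_nonneg m hnz.ne'
    have h2 := Int.emod_lt_of_pos m hnz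
    obtain ⟨r, hr⟩ := Int.eq_ofNat_of_zero_le h1
    have hr' : r < n := by rw [hr] at h2; exact_mod_cast h2
    refine ⟨i + r, ?_, ?_⟩
    · simp only [P, hr]; rfl
    · rw [add_assoc, ← hPval (r + 1) hr']
      simp only [P]
      rw [Int.add_emod, hr, ← Int.add_emod_emod]
      simp
  refine ⟨_, ⟨isSimpleClosedCurve_polygon hn0 hPper ?_, ?_⟩, T i, hT i, ?_⟩
  · have hline : ∀ (j : ℕ) {u : ℝ}, u ∈ Ioo (0 : ℝ) 1 →
        AffineMap.lineMap (p j) (p (j + 1)) u ∈ openHull (T j) := fun j u hu => by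
      refine hopen j ?_
      rw [openSegment_eq_image_lineMap]
      exact ⟨u, hu, rfl⟩
    have hnotmark : ∀ {a b : ℕ}, p a ∉ openHull (T b) := fun {a b} h => by
      obtain ⟨-, u, hu, v, hv, huv, hx⟩ := hp a
      rw [← hull_pair] at hx
      have := Finset.card_le_card (subset_of_mem_openHull (hT b).1.1
        (joined_of_mem (hT a).1.1 hu hv huv).2 h hx)
      rw [(hT b).1.2, Finset.card_pair huv] at this
      omega
    intro m hm m' hm' u hu v hv heq
    obtain ⟨r, rfl⟩ := Int.eq_ofNat_of_zero_le hm.1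
    obtain ⟨r', rfl⟩ := Int.eq_ofNat_of_zero_le hm'.1
    have hr : r < n := by exact_mod_cast hm.2
    have hr' : r' < n := by exact_mod_cast hm'.2
    have e1 := hPval r hr.le
    have e2 := hPval (r + 1) hr
    have e1' := hPval r' hr'.le
    have e2' := hPval (r' + 1) hr'
    push_cast at e2 e2'
    rw [e1, e2, e1', e2', ← add_assoc, ← add_assoc] at heq
    rcases hu.1.eq_or_lt with hu0 | hu0 <;> rcases hv.1.eq_or_lt with hv0 | hv0
    · rw [← hu0, ← hv0, AffineMap.lineMap_apply_zero, AffineMap.lineMap_apply_zero] at heq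
      refine ⟨?_, hu0.symm.trans hv0⟩
      by_contra hne
      have hne' : r ≠ r' := fun h => hne (by rw [h])
      rcases lt_or_gt_of_ne hne' with h | h
      · exact hmin (by omega) (by omega) heq
      · exact hmin (by omega) (by omega) heq.symm
    · rw [← hu0, AffineMap.lineMap_apply_zero] at heq
      exact absurd (by rw [heq]; exact hline _ ⟨hv0, hv.2⟩) (hnotmark (a := i + r) (b := i + r'))
    · rw [← hv0, AffineMap.lineMap_apply_zero] at heq
      exact absurd (by rw [← heq]; exact hline _ ⟨hu0, hu.2⟩) (hnotmark (a := i + r') (b := i + r))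
    · have hTT := hTeq (hline _ ⟨hu0, hu.2⟩) (by rw [heq]; exact hline _ ⟨hv0, hv.2⟩)
      -- A triangle determines the end points of its chord. A second visit to it within one period
      -- would repeat a point at a distance smaller than n, using n ≥ 3.
      have hsets := hmk (i + r)
      rw [hTT, hmk (i + r')] at hsets
      have hrr : r = r' := by
        by_contra hne
        have f1 : p (i + r) ∈ ({p (i + r'), p (i + r' + 1)} : Set Plane) := by rw [hsets]; simp
        have f2 : p (i + r') ∈ ({p (i + r), p (i + r + 1)} : Set Plane) := by rw [← hsets]; simp
        rw [mem_insert_iff, mem_singleton_iff] at f1 f2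
        rcases lt_or_gt_of_ne hne with h | h
        · have f1' := f1.resolve_left (hmin (by omega) (by omega))
          have f2' := f2.resolve_left (hmin (by omega) (by omega)).symm
          by_cases h1 : r' + 1 < r + n
          · exact hmin (by omega) (by omega) f1'
          · exact hmin (a := i + r + 1) (b := i + r') (by omega) (by omega) f2'.symm
        · have f1' := f1.resolve_left (hmin (by omega) (by omega)).symm
          have f2' := f2.resolve_left (hmin (by omega) (by omega))
          by_cases h1 : r + 1 < r' + n
          · exact hmin (by omega) (by omega) f2'
          · exact hmin (a := i + r' + 1) (b := i + r) (by omega) (by omega) f1'.symm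
      subst hrr
      exact ⟨rfl, AffineMap.lineMap_injective ℝ (hp2 _).symm heq⟩
  · rintro x hx
    obtain ⟨m, hx⟩ := mem_iUnion.1 hx
    obtain ⟨j, hj1, hj2⟩ := hPseg m
    rw [hj1, hj2] at hx
    have hj := marks_subset_hull (hp j)
    have hj' := marks_subset_hull (hp1 j)
    refine ⟨hull_subset_closure (hT j).1.1 ((convex_convexHull ℝ _).segment_subset hj hj' hx), ?_⟩
    obtain ⟨α, β, hα, hβ, hαβ, rfl⟩ := hx
    rw [H.sol.affine _ (hT j).1.1 _ hj _ hj' α β hα hβ hαβ, (hp j).1, (hp1 j).1, ← add_mul, hαβ,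
      one_mul]
  · refine ⟨midpoint ℝ (p i) (p (i + 1)), mem_iUnion.2 ⟨0, ?_⟩, hopen i (hmid i)⟩
    have e1 := hPval 0 (by omega)
    have e2 := hPval 1 (by omega)
    push_cast at e1 e2
    rw [zero_add, e1, e2, add_zero]
    exact openSegment_subset_segment _ _ _ (hmid i)

end IsSolution

end CellularDomain

/-! ### Interiors of level cycles are the components of sublevel sets. -/

namespace CellularDomain

variable {D : CellularDomain} {c : Plane → Plane → ℝ} {k : ℝ} {g : Plane → ℝ} {t : ℝ}
  {C C' : Set Plane}

namespace IsSolution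

theorem ext_mem_Icc (H : D.IsSolution c k g) (x : Plane) : D.ext k g x ∈ Icc 0 k := by
  rw [ext]
  split_ifs with h1 h2
  · exact H.value_mem_Icc h1
  · exact ⟨H.pos.le, le_rfl⟩
  · exact ⟨le_rfl, H.pos.le⟩

theorem mem_region_of_ext (H : D.IsSolution c k g) {x : Plane} (h0 : 0 < D.ext k g x)
    (hk : D.ext k g x < k) : x ∈ D.region := by
  have hx : x ∈ closure D.region := by
    by_contra hx
    rw [ext, if_neg hx] at h0 hk
    split_ifs at h0 hk
    · exact lt_irrefl _ hk
    · exact lt_irrefl _ h0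
  rw [ext_of_mem hx] at h0 hk
  exact H.mem_region_of_value hx h0.ne' hk.ne

theorem ext_lt_iff (H : D.IsSolution c k g) {x : Plane} :
    D.ext k g x < k ↔ x ∈ inside D.outer := by
  constructor
  · intro h
    by_contra hx
    by_cases hxo : x ∈ D.outer
    · rw [ext_of_mem (D.outer_subset_closure hxo), H.value_outer hxo] at h
      exact lt_irrefl _ h
    · have : x ∈ D.outerᶜ := hxo
      rw [compl_eq_inside_union_outside] at this
      rw [ext_of_outside (this.resolve_left hx)] at h
      exact lt_irrefl _ h
  · intro h
    refine (H.ext_mem_Icc x).2.lt_of_ne fun he => ?_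
    by_cases hx : x ∈ closure D.region
    · rw [ext_of_mem hx] at he
      exact h.1 (H.mem_outer_of_value hx he)
    · rw [ext, if_neg hx, if_neg fun h' => disjoint_left.1 disjoint_inside_outside h h'] at he
      exact H.pos.ne he

/-- Near a point of a triangle there are points of the triangle of smaller value, if the triangle
has a vertex of smaller value. -/
theorem exists_near (H : D.IsSolution c k g) {s : Finset Plane} (hs : s ∈ D.complex.faces)
    {p a : Plane} (hp : p ∈ hull s) (ha : a ∈ s) {σ : ℝ} (hlt : σ * (g a - g p) < 0)
    {U : Set Plane} (hU : U ∈ 𝓝 p) : ∃ y ∈ U, y ∈ hull s ∧ σ * (g y - g p) < 0 := by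
  have hcont : Filter.Tendsto (fun ε : ℝ => (1 - ε) • p + ε • a) (𝓝[>] 0) (𝓝 p) := by
    have : Continuous fun ε : ℝ => (1 - ε) • p + ε • a := by fun_prop
    have h := this.tendsto 0
    simp only [sub_zero, one_smul, zero_smul, add_zero] at h
    exact h.mono_left nhdsWithin_le_nhds
  have h1 : ∀ᶠ ε : ℝ in 𝓝[>] 0, ε ∈ Ioo (0 : ℝ) 1 := Ioo_mem_nhdsGT one_pos
  obtain ⟨ε, hε, hε0, hε1⟩ := ((hcont.eventually hU).and h1).exists
  have has := subset_convexHull ℝ (s : Set Plane) ha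
  have e1 : 0 ≤ 1 - ε := by linarith
  refine ⟨_, hε, convex_convexHull ℝ _ hp has e1 hε0.le (by ring), ?_⟩
  rw [H.sol.affine s hs p hp a has _ _ e1 hε0.le (by ring)]
  have : σ * ((1 - ε) * g p + ε * g a - g p) = ε * (σ * (g a - g p)) := by ring
  rw [this]
  exact mul_neg_of_pos_of_neg hε0 hlt

theorem exists_near_region (H : D.IsSolution c k g) {p : Plane} (hp : p ∈ D.region) {σ : ℝ}
    (hσ : σ ≠ 0) {U : Set Plane} (hU : U ∈ 𝓝 p) :
    ∃ y ∈ U, y ∈ closure D.region ∧ σ * (g y - g p) < 0 := by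
  obtain ⟨s, hs, hps, a, ha, hlt⟩ := H.exists_tri_lt hp hσ
  obtain ⟨y, hyU, hys, hy⟩ := H.exists_near hs.1 hps ha hlt hU
  exact ⟨y, hyU, hull_subset_closure hs.1 hys, hy⟩

end IsSolution

open IsSolution

theorem isLevelCycle_outer (H : D.IsSolution c k g) : D.IsLevelCycle g k D.outer :=
  ⟨D.outer_simple, fun _ hx => ⟨D.outer_subset_closure hx, H.value_outer hx⟩⟩

/-- The exterior of E₁ is connected, unbounded and misses K, so it lies outside K. As E₁ is in its
closure, the open set `inside K` avoids E₁ too. -/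
theorem inside_subset_inside_outer {K : Set Plane} (hK : IsClosed K)
    (hKD : K ⊆ closure D.region) : inside K ⊆ inside D.outer := by
  have h1 : outside D.outer ⊆ outside K :=
    subset_outside_of_isPreconnected (isConnected_outside D.outer_simple.isBounded).isPreconnected
      (outside_not_isBounded D.outer_simple.isBounded) (disjoint_left.2 fun x hx hxK =>
        disjoint_left.1 D.disjoint_closure_outside_outer (hKD hxK) hx)
  intro x hx
  have h2 : x ∉ closure (outside D.outer) := fun hcl => by
    obtain ⟨y, hy, hy'⟩ := mem_closure_iff.1 hcl _ (isOpen_inside hK) hx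
    exact disjoint_left.1 disjoint_inside_outside hy (h1 hy')
  have h3 : x ∈ D.outerᶜ := fun h => h2 (D.outer_simple.subset_closure_outside h)
  rw [compl_eq_inside_union_outside] at h3
  exact h3.resolve_right fun h => h2 (subset_closure h)

/-- Maximum principle. -/
theorem ext_lt_of_mem_inside (H : D.IsSolution c k g) (ht : 0 < t) {K : Set Plane}
    (hK : IsCompact K) (hKt : K ⊆ D.levelSet g t) {x : Plane} (hx : x ∈ inside K) :
    D.ext k g x < t := by
  by_contra! hge
  have hcomp : IsCompact (closure (inside K)) := (isBounded_inside hK.isBounded).isCompact_closure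
  obtain ⟨p, hp, hmax⟩ := hcomp.exists_isMaxOn ⟨x, subset_closure hx⟩ H.continuous_ext.continuousOn
  have hmax' : ∀ y ∈ inside K, D.ext k g y ≤ D.ext k g p := fun y hy => hmax (subset_closure hy)
  -- A point of `inside K` with value at least t > 0 is not in a hole and not beyond E₁. It lies in
  -- Ω, so larger values occur nearby and it is no maximum.
  have hnot : ∀ q ∈ inside K, t ≤ D.ext k g q → D.ext k g q < D.ext k g p := fun q hq hqt => by
    have hqr := H.mem_region_of_ext (ht.trans_le hqt)
      (H.ext_lt_iff.2 (inside_subset_inside_outer hK.isClosed (fun y hy => (hKt hy).1) hq))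
    obtain ⟨y, hy, hycl, hlt⟩ := H.exists_near_region hqr (neg_ne_zero.2 one_ne_zero)
      ((isOpen_inside hK.isClosed).mem_nhds hq)
    have := hmax' y hy
    rw [ext_of_mem hycl] at this
    rw [ext_of_mem (subset_closure hqr)]
    linarith
  have h1 := hnot x hx hge
  by_cases hpi : p ∈ inside K
  · exact lt_irrefl _ (hnot p hpi (hge.trans h1.le))
  · have hpK := frontier_inside_subset hK.isClosed
      (by rw [(isOpen_inside hK.isClosed).frontier_eq]; exact ⟨hp, hpi⟩)
    rw [ext_of_mem (hKt hpK).1, (hKt hpK).2] at h1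
    linarith

namespace IsLevelCycle

theorem inside_subset_inside_outer (hC : D.IsLevelCycle g t C) : inside C ⊆ inside D.outer :=
  CellularDomain.inside_subset_inside_outer hC.1.isClosed fun _ hx => (hC.2 hx).1

theorem ext_eq (hC : D.IsLevelCycle g t C) {x : Plane} (hx : x ∈ C) : D.ext k g x = t := by
  rw [ext_of_mem (hC.2 hx).1, (hC.2 hx).2]

theorem ext_lt (H : D.IsSolution c k g) (ht : 0 < t) (hC : D.IsLevelCycle g t C) {x : Plane}
    (hx : x ∈ inside C) : D.ext k g x < t :=
  ext_lt_of_mem_inside H ht hC.1.isCompact hC.2 hx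

/-- The connected set `inside C` has values < t, and a larger connected set would have to meet its
frontier C, where the value is t. -/
theorem isLowComp (H : D.IsSolution c k g) (ht : 0 < t) (hC : D.IsLevelCycle g t C) :
    D.IsLowComp k g t (inside C) := by
  obtain ⟨x, hx⟩ := hC.1.inside_nonempty
  have hsub : inside C ⊆ D.sub k g t := fun y hy => hC.ext_lt H ht hy
  refine ⟨x, hsub hx, Subset.antisymm
    (hC.1.isConnected_inside.isPreconnected.subset_connectedComponentIn hx hsub) ?_⟩
  refine subset_of_disjoint_frontier isPreconnected_connectedComponentIn
    ⟨x, mem_connectedComponentIn (hsub hx), hx⟩ (disjoint_left.2 fun y hy hy' => ?_)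
  rw [hC.1.frontier_inside] at hy'
  have hlt : D.ext k g y < t := connectedComponentIn_subset (D.sub k g t) x hy
  exact hlt.ne (hC.ext_eq hy')

/-- A cycle is the frontier of its interior, and components of one sublevel set that meet are equal.
-/
theorem eq_of_meets (H : D.IsSolution c k g) (ht : 0 < t) (hC : D.IsLevelCycle g t C)
    (hC' : D.IsLevelCycle g t C') (h : (inside C ∩ inside C').Nonempty) : C = C' := by
  rw [← hC.1.frontier_inside, ← hC'.1.frontier_inside,
    (hC.isLowComp H ht).eq_of_meets (hC'.isLowComp H ht) h]

end IsLevelCycle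

namespace IsLowComp

variable {V : Set Plane}

theorem frontier_nonempty (H : D.IsSolution c k g) (hk : t ≤ k) (hV : D.IsLowComp k g t V) :
    (frontier V).Nonempty := by
  have hsub : V ⊆ inside D.outer := fun x hx => H.ext_lt_iff.1 ((hV.subset_sub hx).trans_le hk)
  refine nonempty_frontier_iff.2 ⟨hV.isConnected.nonempty, fun h => ?_⟩
  obtain ⟨x, hx⟩ := outside_nonempty D.outer_simple.isBounded
  exact disjoint_left.1 disjoint_inside_outside (hsub (h ▸ mem_univ x)) hx

/-- A frontier point of a component of the sublevel set lies in a triangle with a vertex in the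
component. -/
theorem exists_tri_of_frontier (H : D.IsSolution c k g) (h0 : 0 < t) (hk : t < k)
    (hV : D.IsLowComp k g t V) {p : Plane} (hp : p ∈ frontier V) :
    p ∈ D.region ∧ g p = t ∧ ∃ s, D.IsTri s ∧ p ∈ hull s ∧ ∃ a ∈ s, a ∈ V := by
  have hpt := hV.ext_eq_of_frontier H hp
  have hpr := H.mem_region_of_ext (by rw [hpt]; exact h0) (by rw [hpt]; exact hk)
  refine ⟨hpr, by rw [← hpt, ext_of_mem (subset_closure hpr)], ?_⟩
  obtain ⟨y, hy, hyV⟩ := mem_closure_iff_nhds.1 hp.1 _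
    (Filter.inter_mem (eventually_mem_hull D.finite_faces p) (D.isOpen_region.mem_nhds hpr))
  have hycl := subset_closure hy.2
  obtain ⟨s, hs, hys⟩ := exists_tri hycl
  obtain ⟨a, ha, hat⟩ := H.g_vert_lt_of_hull hs.1 hys (hV.g_lt hycl hyV)
  exact ⟨s, hs, hy.1 s hs.1 hys, a, ha, hV.low_mem H hs.1 hys hyV (subset_convexHull ℝ _ ha) hat⟩

/-- The components of the sublevel sets are the interiors of simple cycles of the level sets. -/
theorem exists_cycle (H : D.IsSolution c k g) (h0 : 0 < t) (hk : t ≤ k)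
    (hV : D.IsLowComp k g t V) : ∃ C, D.IsLevelCycle g t C ∧ V = inside C := by
  rcases hk.eq_or_lt with rfl | hk
  · refine ⟨D.outer, isLevelCycle_outer H, hV.eq_of_meets ((isLevelCycle_outer H).isLowComp H h0) ?_⟩
    obtain ⟨x, hx⟩ := hV.isConnected.nonempty
    exact ⟨x, hx, H.ext_lt_iff.1 (hV.subset_sub hx)⟩
  · obtain ⟨p, hp⟩ := hV.frontier_nonempty H hk.le
    obtain ⟨hpr, hpt, s, hs, hps, a, ha, haV⟩ := hV.exists_tri_of_frontier H h0 hk hp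
    have hmixed : ∃ s, Mixed D g t V s := by
      by_cases hpv : p ∈ D.verts
      · subst hpt
        have := H.two_le_turnTris hpv hpr hV ⟨s, hs, vert_mem_of_mem_hull hpv hs.1 hps, a, ha, haV⟩
        obtain ⟨s', hs', -, hV', hlt⟩ := Set.nonempty_of_ncard_ne_zero
          (by omega : (turnTris D g p V).ncard ≠ 0)
        exact ⟨s', hs', hV', hlt⟩
      · obtain ⟨f, hf, hpf⟩ := exists_face (subset_closure hpr)
        obtain ⟨d, hd, hlt⟩ := H.exists_lt_of_mem_openHull hpr hf hpf hpv (neg_ne_zero.2 one_ne_zero)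
        exact ⟨s, hs, ⟨a, ha, haV⟩, d, subset_of_mem_openHull hf hs.1 hpf hps hd, by linarith⟩
    obtain ⟨s₀, hs₀⟩ := hmixed
    obtain ⟨C, hC, s', ⟨hs', ⟨b, hb, hbV⟩, -⟩, x, hxC, hxs⟩ := H.exists_levelCycle h0 hk hV hs₀
    -- C crosses the open triangle s', so points enclosed by C lie in s'. They have value < t, and
    -- s' has a vertex in V, so they belong to V.
    refine ⟨C, hC, hV.eq_of_meets (hC.isLowComp H h0) ?_⟩
    obtain ⟨l, hl⟩ := exists_isBary (D.complex.indep hs'.1) hs'.2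
    obtain ⟨y, hys, hyC⟩ := mem_closure_iff.1 (hC.1.subset_closure_inside hxC) _
      hl.isOpen_openHull hxs
    have hyh := openHull_subset_hull _ hys
    refine ⟨y, hV.low_mem H hs'.1 (subset_convexHull ℝ _ hb) hbV hyh ?_, hyC⟩
    have := hC.ext_lt H h0 hyC
    rwa [ext_of_mem (hull_subset_closure hs'.1 hyh)] at this

end IsLowComp

end CellularDomain

/-- A relatively open and closed part of a preconnected set. -/
theorem subset_of_relatively_open {X : Type*} [TopologicalSpace X] {S C : Set X}
    (hS : IsPreconnected S) (hC : IsClosed C) (hne : (S ∩ C).Nonempty)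
    (ho : ∀ p ∈ C, ∀ᶠ y in 𝓝 p, y ∈ S → y ∈ C) : S ⊆ C := by
  by_contra hnot
  obtain ⟨y, hyS, hyC⟩ := not_subset.1 hnot
  have hout : ∀ z ∈ S, z ∉ C → z ∈ (interior {z | z ∈ S → z ∈ C})ᶜ := fun z hz hzC h =>
    hzC (interior_subset h hz)
  obtain ⟨z, -, hzC, hz⟩ := isPreconnected_closed_iff.1 hS C _ hC isOpen_interior.isClosed_compl
    (fun z hz => or_iff_not_imp_left.2 (hout z hz)) hne ⟨y, hyS, hout y hyS hyC⟩
  exact hz (mem_interior_iff_mem_nhds.2 (ho z hzC))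

/-! ### Level sets of regular values, and sublevel sets between critical values. -/

namespace CellularDomain

variable {D : CellularDomain} {c : Plane → Plane → ℝ} {k : ℝ} {g : Plane → ℝ} {t b : ℝ}
  {C C' L : Set Plane} {x y : Plane}

open IsSolution

theorem mem_levelSet_of_ext (H : D.IsSolution c k g) (h0 : 0 < t) (hk : t < k)
    (hx : D.ext k g x = t) : x ∈ D.region ∧ x ∈ D.levelSet g t := by
  have hr := H.mem_region_of_ext (by rw [hx]; exact h0) (by rw [hx]; exact hk)
  exact ⟨hr, subset_closure hr, by rw [← hx, ext_of_mem (subset_closure hr)]⟩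

theorem ext_of_levelSet (hx : x ∈ D.levelSet g t) : D.ext k g x = t := by
  rw [ext_of_mem hx.1, hx.2]

theorem isClosed_levelSet (H : D.IsSolution c k g) (t : ℝ) : IsClosed (D.levelSet g t) := by
  have : D.levelSet g t = closure D.region ∩ {x | D.ext k g x = t} := by
    ext x
    exact ⟨fun h => ⟨h.1, ext_of_levelSet h⟩, fun h => ⟨h.1, by rw [← h.2, ext_of_mem h.1]⟩⟩
  rw [this]
  exact isClosed_closure.inter (isClosed_eq H.continuous_ext continuous_const)

namespace IsLevelCycle

/-- Moving from x towards a lowers g within the triangle, so x is a limit of enclosed points; its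
value t keeps it off the interior. -/
theorem mem_of_tri (H : D.IsSolution c k g) (h0 : 0 < t) (hC : D.IsLevelCycle g t C)
    {s : Finset Plane} (hs : s ∈ D.complex.faces) (hx : x ∈ hull s) (hxt : g x = t) {a : Plane}
    (ha : a ∈ s) (haC : a ∈ inside C) : x ∈ C := by
  have hV := hC.isLowComp H h0
  have hat := hV.g_lt (vert_mem_closure (mem_verts_of_mem hs ha)) haC
  have hcl : x ∈ closure (inside C) := by
    rw [mem_closure_iff_nhds]
    intro U hU
    obtain ⟨y, hyU, hys, hy⟩ := H.exists_near hs hx ha (σ := 1) (by linarith) hU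
    exact ⟨y, hyU, hV.low_mem H hs (subset_convexHull ℝ _ ha) haC hys (by linarith)⟩
  rw [hC.1.closure_inside] at hcl
  refine hcl.resolve_left fun h => ?_
  exact (hV.g_lt (hull_subset_closure hs hx) h).ne hxt

/-- Near a level cycle of a regular value, its closed interior is the whole sublevel set. -/
theorem eventually_mem (H : D.IsSolution c k g) (h0 : 0 < t) (hk : t < k)
    (hreg : t ∉ D.criticalValues g) (hC : D.IsLevelCycle g t C) {p : Plane} (hp : p ∈ C) :
    ∀ᶠ y in 𝓝 p, D.ext k g y ≤ t → y ∈ closure (inside C) := by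
  have hV := hC.isLowComp H h0
  obtain ⟨hpr, hpt, s, hs, hps, a, ha, haV⟩ := hV.exists_tri_of_frontier H h0 hk
    (by rw [hC.1.frontier_inside]; exact hp)
  have hregp : p ∈ D.verts → D.index g p = 0 := fun hpv => by
    by_contra h
    exact hreg ⟨p, hpv, hpr, h, hpt⟩
  filter_upwards [eventually_mem_hull D.finite_faces p, D.isOpen_region.mem_nhds hpr]
    with y hy hyr hyt
  rw [ext_of_mem (subset_closure hyr)] at hyt
  -- Regularity enters here: near p all lower vertices of all triangles belong to the one component
  -- enclosed by C.
  have key : ∀ s', D.IsTri s' → y ∈ hull s' → ∀ a' ∈ s', g a' < t → a' ∈ inside C :=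
    fun s' hs' hys' a' ha' hlt => by
      rw [← hpt] at hV
      exact H.mem_lowComp_of_regular hpr hregp hV hs hps hs' (hy s' hs'.1 hys') ha haV ha'
        (by rw [hpt]; exact hlt)
  rcases hyt.eq_or_lt with hyt | hyt
  · obtain ⟨s', hs', hys', a', ha', hlt⟩ := H.exists_tri_lt hyr one_ne_zero
    have := hC.mem_of_tri H h0 hs'.1 hys' hyt ha' (key s' hs' hys' a' ha' (by linarith))
    exact hC.1.subset_closure_inside this
  · obtain ⟨s', hs', hys'⟩ := exists_tri (subset_closure hyr)
    obtain ⟨a', ha', hlt⟩ := H.g_vert_lt_of_hull hs'.1 hys' hyt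
    exact subset_closure (hV.low_mem H hs'.1 (subset_convexHull ℝ _ ha')
      (key s' hs' hys' a' ha' hlt) hys' hyt)

theorem mem_of_closure_inside (H : D.IsSolution c k g) (h0 : 0 < t) (hC : D.IsLevelCycle g t C)
    (hx : x ∈ closure (inside C)) (hxt : D.ext k g x = t) : x ∈ C := by
  rw [hC.1.closure_inside] at hx
  exact hx.resolve_left fun h => (hC.ext_lt H h0 h).ne hxt

theorem subset_inside_of_meets (H : D.IsSolution c k g) (hb : 0 < b) (hC : D.IsLevelCycle g b C)
    (htb : t < b) {S : Set Plane} (hS : IsPreconnected S) (hSt : ∀ x ∈ S, D.ext k g x ≤ t)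
    (hne : (S ∩ inside C).Nonempty) : S ⊆ inside C :=
  (hC.isLowComp H hb).subset_of_meets hS (fun x hx => (hSt x hx).trans_lt htb) hne

end IsLevelCycle

/-- A component of the level set of a regular value is a simple cycle. -/
theorem IsLevelComponent.isLevelCycle (H : D.IsSolution c k g) (h0 : 0 < t) (hk : t < k)
    (hreg : t ∉ D.criticalValues g) (hL : D.IsLevelComponent g t L) : D.IsLevelCycle g t L := by
  obtain ⟨x, hx, rfl⟩ := hL
  have hxr := (mem_levelSet_of_ext H h0 hk (ext_of_levelSet (k := k) hx)).1
  obtain ⟨s, hs, hxs, a, ha, hlt⟩ := H.exists_tri_lt hxr one_ne_zero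
  have hacl := vert_mem_closure (mem_verts_of_mem hs.1 ha)
  rw [hx.2] at hlt
  obtain ⟨V, hV, haV⟩ := exists_lowComp (D := D) (k := k) (g := g) (t := t)
    ((mem_sub hacl).2 (by linarith))
  obtain ⟨C, hC, rfl⟩ := hV.exists_cycle H h0 hk.le
  have hxC := hC.mem_of_tri H h0 hs.1 hxs hx.2 ha haV
  have h1 : C ⊆ connectedComponentIn (D.levelSet g t) x :=
    hC.1.isConnected.isPreconnected.subset_connectedComponentIn hxC hC.2
  -- Near each of its points, C is the entire level set, so the component cannot leave C.
  have h2 : connectedComponentIn (D.levelSet g t) x ⊆ C := by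
    refine subset_of_relatively_open isPreconnected_connectedComponentIn hC.1.isClosed
      ⟨x, mem_connectedComponentIn hx, hxC⟩ fun p hp => ?_
    filter_upwards [hC.eventually_mem H h0 hk hreg hp] with y hy hyL
    have hyt := ext_of_levelSet (k := k) (connectedComponentIn_subset _ _ hyL)
    exact hC.mem_of_closure_inside H h0 (hy hyt.le) hyt
  rw [Subset.antisymm h2 h1]
  exact hC

/-- A level set component is enclosed by exactly one simple cycle of a higher level set. -/
theorem existsUnique_cycle (H : D.IsSolution c k g) (h0 : 0 < t) (htb : t < b) (hb : b ≤ k)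
    (hL : D.IsLevelComponent g t L) : ∃! C, D.IsLevelCycle g b C ∧ Encloses C L := by
  obtain ⟨x, hx, rfl⟩ := hL
  have hsub : ∀ y ∈ connectedComponentIn (D.levelSet g t) x, D.ext k g y = t := fun y hy =>
    ext_of_levelSet (connectedComponentIn_subset _ _ hy)
  have hb0 := h0.trans htb
  have hxx := mem_connectedComponentIn hx
  obtain ⟨V, hV, hxV⟩ := exists_lowComp (D := D) (k := k) (g := g) (t := b) (x := x)
    (by change D.ext k g x < b; rw [hsub x hxx]; exact htb)
  obtain ⟨C, hC, rfl⟩ := hV.exists_cycle H hb0 hb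
  refine ⟨C, ⟨hC, hC.subset_inside_of_meets H hb0 htb isPreconnected_connectedComponentIn
    (fun y hy => (hsub y hy).le) ⟨x, hxx, hxV⟩⟩, fun C' hC' => ?_⟩
  exact hC'.1.eq_of_meets H hb0 hC ⟨x, hC'.2 hxx, hxV⟩

/-- `x` and `y` lie in the same component of the sublevel set. -/
def SameLow (D : CellularDomain) (k : ℝ) (g : Plane → ℝ) (t : ℝ) (x y : Plane) : Prop :=
  ∃ V, D.IsLowComp k g t V ∧ x ∈ V ∧ y ∈ V

theorem SameLow.mono {t' : ℝ} (h : SameLow D k g t x y) (htt : t ≤ t') : SameLow D k g t' x y := by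
  obtain ⟨V, hV, hx, hy⟩ := h
  obtain ⟨V', hV', hxV'⟩ := exists_lowComp (D := D) (k := k) (g := g) (t := t') (x := x)
    (lt_of_lt_of_le (hV.subset_sub hx) htt)
  exact ⟨V', hV', hxV', hV'.subset_of_meets hV.isConnected.isPreconnected
    (fun z hz => lt_of_lt_of_le (hV.subset_sub hz) htt) ⟨x, hx, hxV'⟩ hy⟩

/-- A path joins x to y in the open connected set V; r is the maximum of `ext` on this compact path,
hence < t. -/
theorem SameLow.exists_lt (H : D.IsSolution c k g) (h : SameLow D k g t x y) :
    ∃ r < t, ∀ r', r < r' → SameLow D k g r' x y := by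
  obtain ⟨V, hV, hx, hy⟩ := h
  obtain ⟨γ, hγ⟩ := ((hV.isOpen H).isConnected_iff_isPathConnected.1 hV.isConnected).joinedIn x hx y hy
  have hcomp : IsCompact (range γ) := isCompact_range γ.continuous
  obtain ⟨p, ⟨u, rfl⟩, hmax⟩ := hcomp.exists_isMaxOn ⟨_, mem_range_self 0⟩
    H.continuous_ext.continuousOn
  refine ⟨D.ext k g (γ u), hV.subset_sub (hγ u), fun r' hr' => ?_⟩
  have hlt : ∀ z ∈ range γ, D.ext k g z < r' := fun z hz => lt_of_le_of_lt (hmax hz) hr'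
  have hxγ : x ∈ range γ := ⟨0, γ.source⟩
  obtain ⟨V', hV', hxV'⟩ := exists_lowComp (D := D) (k := k) (g := g) (t := r') (x := x)
    (hlt x hxγ)
  exact ⟨V', hV', hxV', hV'.subset_of_meets (isPreconnected_range γ.continuous) hlt
    ⟨x, hxγ, hxV'⟩ ⟨1, γ.target⟩⟩

/-- Let C be the cycle of level t around x. A neighbourhood U of its closed interior contains no
other points of {ext ≤ t}, so `ext` exceeds t on the compact frontier of U, and is at least some r >
t there. The component of {ext < r} at x is trapped in U; hence y is in U, and y is enclosed by C.
-/
theorem SameLow.of_forall_gt (H : D.IsSolution c k g) (h0 : 0 < t) (hk : t < k) (htb : t < b)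
    (hreg : t ∉ D.criticalValues g) (hx : D.ext k g x < t) (hy : D.ext k g y < t)
    (hall : ∀ r, t < r → r < b → SameLow D k g r x y) : SameLow D k g t x y := by
  obtain ⟨V, hV, hxV⟩ := exists_lowComp (D := D) (k := k) (g := g) (t := t) (x := x) hx
  refine ⟨V, hV, hxV, ?_⟩
  obtain ⟨C, hC, rfl⟩ := hV.exists_cycle H h0 hk.le
  have hK : IsCompact (closure (inside C)) := (isBounded_inside hC.1.isBounded).isCompact_closure
  have hKU : closure (inside C) ⊆
      interior {z | D.ext k g z ≤ t → z ∈ closure (inside C)} := by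
    intro p hp
    rw [mem_interior_iff_mem_nhds]
    rw [hC.1.closure_inside] at hp
    rcases hp with hp | hp
    · filter_upwards [(isOpen_inside hC.1.isClosed).mem_nhds hp] with z hz _ using subset_closure hz
    · exact hC.eventually_mem H h0 hk hreg hp
  obtain ⟨U, hUo, hKU', hUsub, hUc⟩ := exists_open_between_and_isCompact_closure hK isOpen_interior hKU
  have hxU : x ∈ U := hKU' (subset_closure hxV)
  have hfr : ∀ z ∈ frontier U, t < D.ext k g z := fun z hz => by
    by_contra! hle
    have h1 := interior_subset (hUsub hz.1) hle
    rw [hUo.frontier_eq] at hz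
    exact hz.2 (hKU' h1)
  obtain ⟨r, hr, hrb, hrfr⟩ : ∃ r, t < r ∧ r < b ∧ ∀ z ∈ frontier U, r ≤ D.ext k g z := by
    rcases (frontier U).eq_empty_or_nonempty with he | hne
    · obtain ⟨r, h1, h2⟩ := exists_between htb
      exact ⟨r, h1, h2, fun z hz => by rw [he] at hz; exact absurd hz (notMem_empty z)⟩
    · obtain ⟨q, hq, hmin⟩ := (hUc.of_isClosed_subset isClosed_frontier
        frontier_subset_closure).exists_isMinOn hne H.continuous_ext.continuousOn
      obtain ⟨r, h1, h2⟩ := exists_between (lt_min htb (hfr q hq))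
      exact ⟨r, h1, h2.trans_le (min_le_left _ _), fun z hz =>
        (h2.trans_le (min_le_right _ _)).le.trans (hmin hz)⟩
  obtain ⟨V', hV', hxV', hyV'⟩ := hall r hr hrb
  have hVU : V' ⊆ U := subset_of_disjoint_frontier hV'.isConnected.isPreconnected ⟨x, hxV', hxU⟩
    (disjoint_left.2 fun z hz hz' => (hV'.subset_sub hz).not_ge (hrfr z hz'))
  have hycl := interior_subset (hUsub (subset_closure (hVU hyV'))) hy.le
  rw [hC.1.closure_inside] at hycl
  exact hycl.resolve_right fun h => hy.ne (hC.ext_eq h)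

/-- Between two consecutive critical values the sublevel sets do not change their components. -/
theorem SameLow.of_regular (H : D.IsSolution c k g) (h0 : 0 < t) (hb : b ≤ k) (htb : t ≤ b)
    (hreg : ∀ r, t ≤ r → r < b → r ∉ D.criticalValues g) (hx : D.ext k g x < t)
    (hy : D.ext k g y < t) (h : SameLow D k g b x y) : SameLow D k g t x y := by
  -- The infimum of the levels at which x and y are together belongs to S by `SameLow.of_forall_gt`,
  -- and it cannot exceed t by `SameLow.exists_lt`.
  let S : Set ℝ := {r | t ≤ r ∧ r ≤ b ∧ SameLow D k g r x y}
  have hne : S.Nonempty := ⟨b, htb, le_rfl, h⟩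
  have hbdd : BddBelow S := ⟨t, fun r hr => hr.1⟩
  have htS : t ≤ sInf S := le_csInf hne fun r hr => hr.1
  have hSb : sInf S ≤ b := csInf_le hbdd ⟨htb, le_rfl, h⟩
  have hmem : SameLow D k g (sInf S) x y := by
    rcases hSb.eq_or_lt with he | hlt
    · rw [he]; exact h
    · refine SameLow.of_forall_gt H (h0.trans_le htS) (hlt.trans_le hb) hlt (hreg _ htS hlt)
        (hx.trans_le htS) (hy.trans_le htS) fun r hr _ => ?_
      obtain ⟨r', hr', hlt'⟩ := exists_lt_of_csInf_lt hne hr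
      exact hr'.2.2.mono hlt'.le
  rcases htS.eq_or_lt with he | hlt
  · rw [he]; exact hmem
  · obtain ⟨r, hr, hall⟩ := hmem.exists_lt H
    obtain ⟨r', h1, h2⟩ := exists_between (max_lt hr hlt)
    exact absurd (csInf_le hbdd ⟨((le_max_right _ _).trans_lt h1).le, h2.le.trans hSb,
      hall r' ((le_max_left _ _).trans_lt h1)⟩) (not_le.2 h2)

namespace IsLevelCycle

theorem sameLow (H : D.IsSolution c k g) (h0 : 0 < t) (hb : b ≤ k) (htb : t < b)
    (hreg : ∀ r, t ≤ r → r < b → r ∉ D.criticalValues g) (hC : D.IsLevelCycle g b C)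
    (hx : x ∈ inside C) (hy : y ∈ inside C) (hxt : D.ext k g x < t) (hyt : D.ext k g y < t) :
    SameLow D k g t x y :=
  SameLow.of_regular H h0 hb htb.le hreg hxt hyt
    ⟨_, hC.isLowComp H (h0.trans htb), hx, hy⟩

/-- The points of `inside C` on a regular level curve slightly lower than `C` lie on one cycle, and
it encloses the points of lower value. -/
theorem exists_lower_cycle (H : D.IsSolution c k g) (h0 : 0 < t) (hb : b ≤ k) (htb : t < b)
    (hreg : ∀ r, t ≤ r → r < b → r ∉ D.criticalValues g) (hC : D.IsLevelCycle g b C)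
    (hC' : D.IsLevelCycle g t C') (hsub : (C' ∩ inside C).Nonempty) :
    (∀ x ∈ inside C, D.ext k g x = t → x ∈ C') ∧
    ∀ x ∈ inside C, D.ext k g x < t → x ∈ inside C' := by
  have hb0 := h0.trans htb
  have hmeet : ∀ {C'}, D.IsLevelCycle g t C' → (C' ∩ inside C).Nonempty →
      inside C' ⊆ inside C := fun {C'} hC' ⟨p, hp, hpC⟩ => by
    obtain ⟨z, hz, hz'⟩ := mem_closure_iff.1 (hC'.1.subset_closure_inside hp) _
      (isOpen_inside hC.1.isClosed) hpC
    exact hC.subset_inside_of_meets H hb0 htb hC'.1.isConnected_inside.isPreconnected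
      (fun z hz => (hC'.ext_lt H h0 hz).le) ⟨z, hz', hz⟩
  have hlow : ∀ x ∈ inside C, D.ext k g x < t → x ∈ inside C' := fun x hx hxt => by
    obtain ⟨y, hy⟩ := hC'.1.inside_nonempty
    obtain ⟨V, hV, hxV, hyV⟩ := hC.sameLow H h0 hb htb hreg hx (hmeet hC' hsub hy) hxt
      (hC'.ext_lt H h0 hy)
    rwa [hV.eq_of_meets (hC'.isLowComp H h0) ⟨y, hyV, hy⟩] at hxV
  refine ⟨fun x hx hxt => ?_, hlow⟩
  have hxl := (mem_levelSet_of_ext H h0 (htb.trans_le hb) hxt).2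
  have hL := IsLevelComponent.isLevelCycle H h0 (htb.trans_le hb) (hreg t le_rfl htb)
    ⟨x, hxl, rfl⟩
  have hxx := mem_connectedComponentIn hxl
  -- The cycle through x encloses points of value < t. By `hlow` they are also enclosed by C', so
  -- the two cycles coincide.
  obtain ⟨y, hy⟩ := hL.1.inside_nonempty
  have := hlow y (hmeet hL ⟨x, hxx, hx⟩ hy) (hL.ext_lt H h0 hy)
  rw [← hL.eq_of_meets H h0 hC' ⟨y, hy, this⟩]
  exact hxx

end IsLevelCycle

end CellularDomain

/-- The closed exterior of C is connected, unbounded and disjoint from K, hence outside K. -/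
theorem inside_subset_of_subset_inside {K C : Set Plane} (hC : IsSimpleClosedCurve C)
    (hK : K ⊆ inside C) : inside K ⊆ inside C := by
  have h1 : closure (outside C) ⊆ outside K := by
    refine subset_outside_of_isPreconnected (isConnected_outside hC.isBounded).isPreconnected.closure
      (fun hb => outside_not_isBounded hC.isBounded (hb.subset subset_closure)) ?_
    rw [hC.closure_outside]
    refine disjoint_left.2 fun x hx hxK => ?_
    rcases hx with hx | hx
    · exact disjoint_left.1 disjoint_inside_outside (hK hxK) hx
    · exact (hK hxK).1 hx
  intro x hx
  have h2 : x ∉ closure (outside C) := fun h => disjoint_left.1 disjoint_inside_outside hx (h1 h)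
  rw [hC.closure_outside] at h2
  have h3 : x ∈ Cᶜ := fun h => h2 (Or.inr h)
  rw [compl_eq_inside_union_outside] at h3
  exact h3.resolve_right fun h => h2 (Or.inl h)

/-- Removing a larger set only shrinks the components. -/
theorem mem_inside_of_subset {K C : Set Plane} (hCK : C ⊆ K) {x : Plane} (hx : x ∈ inside C)
    (hxK : x ∉ K) : x ∈ inside K :=
  ⟨hxK, hx.2.subset (connectedComponentIn_mono _ (compl_subset_compl.2 hCK))⟩

/-! ### The level set at the next lower critical value. -/

namespace CellularDomain

variable {D : CellularDomain} {c : Plane → Plane → ℝ} {k : ℝ} {g : Plane → ℝ} {a b : ℝ}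
  {C S : Set Plane} {x : Plane}

open IsSolution

namespace IsSolution

theorem exists_higher (H : D.IsSolution c k g) (hak : a < k) (hx : x ∈ D.levelSet g a)
    {U : Set Plane} (hU : U ∈ 𝓝 x) : ∃ y ∈ U, a < D.ext k g y := by
  rcases eq_or_ne a 0 with rfl | h0
  · obtain ⟨y, hyU, hyr⟩ := mem_closure_iff_nhds.1 hx.1 U hU
    exact ⟨y, hyU, by rw [ext_of_mem (subset_closure hyr)]; exact H.pos_of_mem hyr⟩
  · have hxr := H.mem_region_of_value hx.1 (by rw [hx.2]; exact h0) (by rw [hx.2]; exact hak.ne)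
    obtain ⟨y, hyU, hycl, hlt⟩ := H.exists_near_region hxr (neg_ne_zero.2 one_ne_zero) hU
    rw [hx.2] at hlt
    exact ⟨y, hyU, by rw [ext_of_mem hycl]; linarith⟩

/-- Apply the intermediate value theorem on a ball around x, between x and a point of larger value.
-/
theorem exists_level_near (H : D.IsSolution c k g) (hak : a < k) (hx : x ∈ D.levelSet g a)
    {U : Set Plane} (hU : U ∈ 𝓝 x) :
    ∃ m, a < m ∧ ∀ t, a < t → t < m → ∃ y ∈ U, D.ext k g y = t := by
  obtain ⟨ε, hε, hball⟩ := Metric.mem_nhds_iff.1 hU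
  obtain ⟨y, hy, hlt⟩ := H.exists_higher hak hx (Metric.ball_mem_nhds x hε)
  refine ⟨_, hlt, fun t h1 h2 => ?_⟩
  obtain ⟨z, hz, hzt⟩ := (convex_ball x ε).isPreconnected.intermediate_value
    (Metric.mem_ball_self hε) hy H.continuous_ext.continuousOn
    (show t ∈ Icc _ _ from ⟨by rw [ext_of_levelSet hx]; exact h1.le, h2.le⟩)
  exact ⟨z, hball hz, hzt⟩

end IsSolution

namespace IsLevelCycle

theorem levelSet_inter_closure_inside (hC : D.IsLevelCycle g b C) (hab : a ≠ b) :
    inside C ∩ D.levelSet g a = closure (inside C) ∩ D.levelSet g a := by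
  refine Subset.antisymm (inter_subset_inter_left _ subset_closure) fun x hx => ⟨?_, hx.2⟩
  have h := hx.1
  rw [hC.1.closure_inside] at h
  exact h.resolve_right fun h' => hab (hx.2.2.symm.trans (hC.2 h').2)

theorem isCompact_inside_levelSet (H : D.IsSolution c k g) (hC : D.IsLevelCycle g b C)
    (hab : a ≠ b) : IsCompact (inside C ∩ D.levelSet g a) := by
  rw [hC.levelSet_inter_closure_inside hab]
  exact (isBounded_inside hC.1.isBounded).isCompact_closure.inter_right (isClosed_levelSet H a)

/-- The minimum of `ext` over the closed interior is not on C. If it exceeded a ≥ 0, it would be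
attained in Ω, where smaller values occur nearby. -/
theorem exists_ext_le (H : D.IsSolution c k g) (ha : 0 ≤ a) (hab : a < b)
    (hC : D.IsLevelCycle g b C) : ∃ x ∈ inside C, D.ext k g x ≤ a := by
  have hb0 := ha.trans_lt hab
  have hcomp : IsCompact (closure (inside C)) := (isBounded_inside hC.1.isBounded).isCompact_closure
  obtain ⟨q, hq⟩ := hC.1.inside_nonempty
  obtain ⟨p, hp, hmin⟩ := hcomp.exists_isMinOn ⟨q, subset_closure hq⟩ H.continuous_ext.continuousOn
  have hpb : D.ext k g p < b := lt_of_le_of_lt (hmin (subset_closure hq)) (hC.ext_lt H hb0 hq)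
  rw [hC.1.closure_inside] at hp
  have hpC := hp.resolve_right fun h => hpb.ne (hC.ext_eq h)
  refine ⟨p, hpC, ?_⟩
  by_contra! hlt
  have hpr := H.mem_region_of_ext (ha.trans_lt hlt)
    (H.ext_lt_iff.2 (hC.inside_subset_inside_outer hpC))
  obtain ⟨y, hy, hycl, hlt'⟩ := H.exists_near_region hpr one_ne_zero
    ((isOpen_inside hC.1.isClosed).mem_nhds hpC)
  have : D.ext k g p ≤ D.ext k g y := hmin (subset_closure hy)
  rw [ext_of_mem hycl, ext_of_mem (subset_closure hpr)] at this
  linarith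

/-- The intermediate value theorem gives an enclosed point with `ext` = a. For a = 0 this point may
lie in a hole, off the level set; then C encloses the boundary of that hole as well, which replaces
the point. -/
theorem inside_levelSet_nonempty (H : D.IsSolution c k g) (ha : 0 ≤ a) (hab : a < b) (hbk : b ≤ k)
    (hC : D.IsLevelCycle g b C) : (inside C ∩ D.levelSet g a).Nonempty := by
  have hb0 := ha.trans_lt hab
  obtain ⟨p, hp, hpa⟩ := hC.exists_ext_le H ha hab
  obtain ⟨w, hw⟩ := hC.1.isConnected.nonempty
  have hmid : ∃ z ∈ inside C, a < D.ext k g z := by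
    have hn : {z | a < D.ext k g z} ∈ 𝓝 w := (isOpen_lt continuous_const
      H.continuous_ext).mem_nhds (by change a < _; rw [hC.ext_eq hw]; exact hab)
    obtain ⟨z, hz, hz'⟩ := mem_closure_iff_nhds.1 (hC.1.subset_closure_inside hw) _ hn
    exact ⟨z, hz', hz⟩
  obtain ⟨z, hz, hza⟩ := hmid
  obtain ⟨y, hy, hya⟩ := hC.1.isConnected_inside.isPreconnected.intermediate_value hp hz
    H.continuous_ext.continuousOn (show a ∈ Icc _ _ from ⟨hpa, hza.le⟩)
  rcases ha.eq_or_lt with rfl | h0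
  · by_cases hycl : y ∈ closure D.region
    · exact ⟨y, hy, hycl, by rw [← hya, ext_of_mem hycl]⟩
    · rcases D.mem_of_notMem_closure hycl with h | ⟨i, hi⟩
      · rw [ext_of_outside h] at hya
        exact absurd hya H.pos.ne'
      · have hcl : closure (inside (D.inner i)) ⊆ inside C := by
          refine hC.subset_inside_of_meets H hb0 hab
            (D.inner_simple i).isConnected_inside.isPreconnected.closure
            (fun x hx => ?_) ⟨y, subset_closure hi, hy⟩
          rw [(D.inner_simple i).closure_inside] at hx
          rcases hx with hx | hx
          · rw [ext_of_hole hx]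
          · rw [ext_of_mem (D.inner_subset_closure i hx), H.value_inner hx]
        obtain ⟨x, hx⟩ := (D.inner_simple i).isConnected.nonempty
        exact ⟨x, hcl ((D.inner_simple i).subset_closure_inside hx), D.inner_subset_closure i hx,
          H.value_inner hx⟩
  · exact ⟨y, hy, (mem_levelSet_of_ext H h0 (hab.trans_le hbk) hya).2⟩

/-- The level set just below the values near `C` is connected inside `C`. -/
theorem isPreconnected_inside_levelSet (H : D.IsSolution c k g) (ha : 0 ≤ a) (hab : a < b)
    (hbk : b ≤ k) (hreg : ∀ r, a < r → r < b → r ∉ D.criticalValues g)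
    (hC : D.IsLevelCycle g b C) : IsPreconnected (inside C ∩ D.levelSet g a) := by
  have hak := hab.trans_le hbk
  have hZ := hC.isCompact_inside_levelSet H hab.ne
  refine isPreconnected_closed_iff.2 fun A B hA hB hcov hAne hBne => ?_
  by_contra hdis
  obtain ⟨UA, UB, hUA, hUB, hAUA, hBUB, hUU⟩ := SeparatedNhds.of_isCompact_isCompact
    (hZ.inter_right hA) (hZ.inter_right hB) (disjoint_left.2 fun x hx hx' =>
      hdis ⟨x, hx.1, hx.2, hx'.2⟩)
  have hF : IsCompact ((closure (inside C) ∩ (closure D.region ∩ {x | a ≤ D.ext k g x})) \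
      (UA ∪ UB)) :=
    ((isBounded_inside hC.1.isBounded).isCompact_closure.inter_right (isClosed_closure.inter
      (isClosed_le continuous_const H.continuous_ext))).diff (hUA.union hUB)
  -- By compactness the enclosed points of the closure of Ω with values in [a, m) all lie in UA ∪
  -- UB. The closure of Ω is needed because for a = 0 the holes also have the value a.
  obtain ⟨m, ham, hm⟩ : ∃ m, a < m ∧ ∀ x ∈ inside C, x ∈ closure D.region → a ≤ D.ext k g x →
      D.ext k g x < m → x ∈ UA ∪ UB := by
    rcases ((closure (inside C) ∩ (closure D.region ∩ {x | a ≤ D.ext k g x})) \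
      (UA ∪ UB)).eq_empty_or_nonempty with he | hne
    · refine ⟨b, hab, fun x hx hxr hxa _ => ?_⟩
      by_contra hnot
      exact notMem_empty x (he ▸ ⟨⟨subset_closure hx, hxr, hxa⟩, hnot⟩)
    · obtain ⟨p, hp, hmin⟩ := hF.exists_isMinOn hne H.continuous_ext.continuousOn
      refine ⟨D.ext k g p, lt_of_le_of_ne hp.1.2.2 fun he => ?_, fun x hx hxr hxa hlt => ?_⟩
      · have hpZ : p ∈ inside C ∩ D.levelSet g a := by
          rw [hC.levelSet_inter_closure_inside hab.ne]
          exact ⟨hp.1.1, hp.1.2.1, by rw [he, ext_of_mem hp.1.2.1]⟩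
        rcases hcov hpZ with h | h
        · exact hp.2 (Or.inl (hAUA ⟨hpZ, h⟩))
        · exact hp.2 (Or.inr (hBUB ⟨hpZ, h⟩))
      · by_contra hnot
        exact (hmin ⟨⟨subset_closure hx, hxr, hxa⟩, hnot⟩).not_gt hlt
  obtain ⟨p, hpZ, hpA⟩ := hAne
  obtain ⟨q, hqZ, hqB⟩ := hBne
  have hop := isOpen_inside hC.1.isClosed
  obtain ⟨m₁, hm₁, h₁⟩ := H.exists_level_near hak hpZ.2
    (Filter.inter_mem (hUA.mem_nhds (hAUA ⟨hpZ, hpA⟩)) (hop.mem_nhds hpZ.1))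
  obtain ⟨m₂, hm₂, h₂⟩ := H.exists_level_near hak hqZ.2
    (Filter.inter_mem (hUB.mem_nhds (hBUB ⟨hqZ, hqB⟩)) (hop.mem_nhds hqZ.1))
  -- Choose a regular level t just above a that is attained near p and near q. Inside C it is a
  -- single cycle, which lies in UA ∪ UB and meets both, a contradiction.
  obtain ⟨t, hat, ht⟩ := exists_between (lt_min (lt_min hab ham) (lt_min hm₁ hm₂))
  simp only [lt_min_iff] at ht
  obtain ⟨⟨htb, htm⟩, htm₁, htm₂⟩ := ht
  have ht0 := ha.trans_lt hat
  obtain ⟨p', hp', hp't⟩ := h₁ t hat htm₁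
  obtain ⟨q', hq', hq't⟩ := h₂ t hat htm₂
  have hreg' : ∀ r, t ≤ r → r < b → r ∉ D.criticalValues g := fun r h => hreg r (hat.trans_le h)
  have hpl := (mem_levelSet_of_ext H ht0 (htb.trans_le hbk) hp't).2
  have hL := IsLevelComponent.isLevelCycle H ht0 (htb.trans_le hbk) (hreg' t le_rfl htb)
    ⟨p', hpl, rfl⟩
  have hpL := mem_connectedComponentIn hpl
  have hqL := (hC.exists_lower_cycle H ht0 hbk htb hreg' hL ⟨p', hpL, hp'.2⟩).1 q' hq'.2 hq't
  have hLC := hC.subset_inside_of_meets H (ht0.trans htb) htb hL.1.isConnected.isPreconnected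
    (fun x hx => (hL.ext_eq hx).le) ⟨p', hpL, hp'.2⟩
  obtain ⟨z, -, hzA, hzB⟩ := hL.1.isConnected.isPreconnected UA UB hUA hUB (fun x hx =>
    hm x (hLC hx) (hL.2 hx).1 (by rw [hL.ext_eq hx]; exact hat.le)
      (by rw [hL.ext_eq hx]; exact htm)) ⟨p', hpL, hp'.1⟩ ⟨q', hqL, hq'.1⟩
  exact disjoint_left.1 hUU hzA hzB

theorem eq_of_encloses (H : D.IsSolution c k g) (ha : 0 ≤ a) (hab : a < b) (hbk : b ≤ k)
    (hreg : ∀ r, a < r → r < b → r ∉ D.criticalValues g) (hC : D.IsLevelCycle g b C)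
    (hS : D.IsLevelComponent g a S) (hCS : Encloses C S) : S = inside C ∩ D.levelSet g a := by
  obtain ⟨x, hx, rfl⟩ := hS
  have hxx := mem_connectedComponentIn hx
  exact Subset.antisymm (subset_inter hCS (connectedComponentIn_subset _ _))
    ((hC.isPreconnected_inside_levelSet H ha hab hbk hreg).subset_connectedComponentIn
      ⟨hCS hxx, hx⟩ inter_subset_right)

theorem existsUnique_component (H : D.IsSolution c k g) (ha : 0 ≤ a) (hab : a < b) (hbk : b ≤ k)
    (hreg : ∀ r, a < r → r < b → r ∉ D.criticalValues g) (hC : D.IsLevelCycle g b C) :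
    ∃! S, D.IsLevelComponent g a S ∧ Encloses C S := by
  obtain ⟨x, hxC, hx⟩ := hC.inside_levelSet_nonempty H ha hab hbk
  have hS : D.IsLevelComponent g a (connectedComponentIn (D.levelSet g a) x) := ⟨x, hx, rfl⟩
  have hCS : Encloses C (connectedComponentIn (D.levelSet g a) x) :=
    hC.subset_inside_of_meets H (ha.trans_lt hab) hab isPreconnected_connectedComponentIn
      (fun y hy => (ext_of_levelSet (connectedComponentIn_subset _ _ hy)).le)
      ⟨x, mem_connectedComponentIn hx, hxC⟩
  refine ⟨_, ⟨hS, hCS⟩, fun S' hS' => ?_⟩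
  rw [hC.eq_of_encloses H ha hab hbk hreg hS'.1 hS'.2,
    hC.eq_of_encloses H ha hab hbk hreg hS hCS]

/-- The points of value less than `a` inside `C` are enclosed by the level set of `a` in `C`. -/
theorem mem_inside_levelSet (H : D.IsSolution c k g) (hab : a < b) (hbk : b ≤ k)
    (hC : D.IsLevelCycle g b C) (hx : x ∈ inside C) (hxa : D.ext k g x < a) :
    x ∈ inside (inside C ∩ D.levelSet g a) := by
  have ha := (H.ext_mem_Icc x).1.trans_lt hxa
  have hb0 := ha.trans hab
  obtain ⟨V, hV, hxV⟩ := exists_lowComp (D := D) (k := k) (g := g) (t := a) hxa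
  obtain ⟨C', hC', rfl⟩ := hV.exists_cycle H ha (hab.le.trans hbk)
  have h1 : closure (inside C') ⊆ inside C :=
    hC.subset_inside_of_meets H hb0 hab hV.isConnected.isPreconnected.closure
      (fun y hy => hV.ext_le_of_closure H hy) ⟨x, subset_closure hxV, hx⟩
  refine mem_inside_of_subset (subset_inter (hC'.1.subset_closure_inside.trans h1) hC'.2) hxV
    fun h => hxa.ne (ext_of_levelSet h.2)

end IsLevelCycle

end CellularDomain

/-! ### Green's formula and flux-gradient lengths. -/

namespace CellularDomain

open scoped Classical

variable {D : CellularDomain} {c : Plane → Plane → ℝ} {k : ℝ} {g : Plane → ℝ} {t a b : ℝ}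
  {A B C L : Set Plane} {x y z : Plane}

open IsSolution

/-- The total Laplacian of `g` over the vertices in `A`. -/
noncomputable def netFlux (D : CellularDomain) (c : Plane → Plane → ℝ) (g : Plane → ℝ)
    (A : Set Plane) : ℝ :=
  ∑ v ∈ D.verts with v ∈ A, D.laplacian c g v

/-- Each edge occurs twice with opposite signs. -/
theorem sum_antisymm (hc : D.IsConductance c) (g : Plane → ℝ) (W : Finset Plane) :
    ∑ y ∈ W, ∑ z ∈ W with D.Adj y z, c y z * (g y - g z) = 0 := by
  have h : ∑ y ∈ W, ∑ z ∈ W with D.Adj y z, c y z * (g y - g z) =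
      -∑ y ∈ W, ∑ z ∈ W with D.Adj y z, c y z * (g y - g z) := by
    conv_lhs => simp only [Finset.sum_filter]
    rw [Finset.sum_comm, ← Finset.sum_neg_distrib]
    refine Finset.sum_congr rfl fun z _ => ?_
    rw [Finset.sum_filter, ← Finset.sum_neg_distrib]
    refine Finset.sum_congr rfl fun y _ => ?_
    by_cases hyz : D.Adj y z
    · rw [if_pos hyz, if_pos hyz.symm, hc.symm y z]; ring
    · rw [if_neg hyz, if_neg fun h => hyz h.symm, neg_zero]
  linarith

/-- Edges with both ends in A cancel, and only those leaving A remain. -/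
theorem netFlux_eq (hc : D.IsConductance c) (g : Plane → ℝ) (A : Set Plane) :
    netFlux D c g A = ∑ y ∈ D.verts with y ∈ A, ∑ z ∈ D.verts with D.Adj y z,
      if z ∈ A then 0 else c y z * (g y - g z) := by
  have h := sum_antisymm hc g (D.verts.filter (· ∈ A))
  rw [netFlux, ← sub_eq_zero, ← Finset.sum_sub_distrib]
  refine (Finset.sum_congr rfl fun y _ => ?_).trans h
  rw [laplacian, ← Finset.sum_sub_distrib, Finset.filter_filter]
  simp only [Finset.sum_filter]
  refine Finset.sum_congr rfl fun z _ => ?_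
  by_cases h1 : D.Adj y z <;> by_cases h2 : z ∈ A <;> simp [h1, h2]

/-- The Laplacian sums to zero over all vertices; this compares the two sides of a curve. -/
theorem netFlux_add_compl (hc : D.IsConductance c) (g : Plane → ℝ) (A : Set Plane) :
    netFlux D c g A + netFlux D c g Aᶜ = 0 := by
  rw [← sum_antisymm hc g D.verts]
  simp only [netFlux, mem_compl_iff]
  rw [Finset.sum_filter_add_sum_filter_not]
  rfl

/-- Harmonicity removes the interior vertices, so only the boundary vertices in A count. -/
theorem netFlux_congr (H : D.IsSolution c k g)
    (h : ∀ v ∈ frontier D.region, v ∈ A ↔ v ∈ B) : netFlux D c g A = netFlux D c g B := by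
  rw [netFlux, netFlux, Finset.sum_filter, Finset.sum_filter]
  refine Finset.sum_congr rfl fun v hv => ?_
  have hcl := vert_mem_closure hv
  rw [D.closure_eq] at hcl
  rcases hcl with hr | hf
  · rw [H.sol.harmonic v hv hr]; simp
  · simp only [h v hf]

theorem eq_of_vert_mem_segment (h : D.Joined y z) (hx : x ∈ D.verts) (hxs : x ∈ segment ℝ y z) :
    x = y ∨ x = z := by
  rw [← hull_pair] at hxs
  simpa using vert_mem_of_mem_hull hx h.2 hxs

theorem finite_inducedVerts (D : CellularDomain) (L : Set Plane) :
    (D.inducedVerts L).Finite := by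
  refine (D.verts.finite_toSet.union (Set.Finite.biUnion D.verts.finite_toSet fun y _ =>
    Set.Finite.biUnion D.verts.finite_toSet fun z _ =>
      (show {x | L ∩ segment ℝ y z = {x}}.Subsingleton from fun x hx x' hx' =>
        singleton_injective (hx.symm.trans hx')).finite)).subset ?_
  rintro x ⟨-, hx | ⟨y, z, h, -, hx⟩⟩
  · exact Or.inl hx
  · exact Or.inr (mem_biUnion (x := y) h.symm.1.mem_verts
      (mem_biUnion (x := z) h.1.mem_verts hx))

theorem IsSolution.g_openSegment (H : D.IsSolution c k g) (h : D.Joined y z)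
    (hx : x ∈ openSegment ℝ y z) :
    ∃ α β : ℝ, 0 < α ∧ 0 < β ∧ α + β = 1 ∧ g x = α * g y + β * g z := by
  obtain ⟨α, β, hα, hβ, hαβ, rfl⟩ := hx
  exact ⟨α, β, hα, hβ, hαβ, H.g_segment h.2 (by simp) (by simp) hα.le hβ.le hαβ⟩

/-- The factor g y - g x cancels: an edge cut at a new vertex carries the same flux as the whole
edge. -/
theorem inducedConductance_mul (H : D.IsSolution c k g) (hyL : y ∉ L)
    (hx : x ∈ D.inducedVerts L) : D.inducedConductance c g x y * (g x - g y) =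
      ∑ z ∈ D.verts with D.Adj y z, if x ∈ segment ℝ y z then c y z * (g z - g y) else 0 := by
  have hxy : x ≠ y := fun h => hyL (h ▸ hx.1)
  by_cases hxv : x ∈ D.verts
  · have h1 : ∀ z ∈ D.verts.filter (fun z => D.Adj y z),
        (if x ∈ segment ℝ y z then c y z * (g z - g y) else 0) =
          if x = z then c y z * (g z - g y) else 0 := fun z hz => by
      have hz := (Finset.mem_filter.1 hz).2
      have : x ∈ segment ℝ y z ↔ x = z :=
        ⟨fun h => (eq_of_vert_mem_segment hz.1 hxv h).resolve_left hxy,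
          fun h => h ▸ right_mem_segment ℝ _ _⟩
      simp only [this]
    rw [Finset.sum_congr rfl h1, Finset.sum_ite_eq, inducedConductance, if_pos hxv]
    by_cases h : D.Adj x y
    · rw [if_pos h, if_pos (Finset.mem_filter.2 ⟨hxv, h.symm⟩), H.cond.symm x y]
    · rw [if_neg h, if_neg fun h' => h (Finset.mem_filter.1 h').2.symm, zero_mul]
  · rw [inducedConductance, if_neg hxv, Finset.sum_mul, Finset.sum_filter, Finset.sum_filter]
    refine Finset.sum_congr rfl fun z hz => ?_
    by_cases hyz : D.Adj y z
    · have hxz : x ≠ z := fun h => hxv (h ▸ hz)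
      have hiff : x ∈ segment ℝ y z ↔ x ∈ openSegment ℝ y z :=
        ⟨mem_openSegment_of_ne_left_right hxy.symm hxz.symm,
          fun h => openSegment_subset_segment _ _ _ h⟩
      by_cases hxs : x ∈ openSegment ℝ y z
      · rw [if_pos ⟨hyz, hxs⟩, if_pos hyz, if_pos (hiff.2 hxs)]
        obtain ⟨α, β, hα, hβ, hαβ, hgx⟩ := H.g_openSegment hyz.1 hxs
        -- Here the quotient is a division by zero with default value 0; but g is then constant on
        -- the edge, so both sides vanish.
        by_cases he : g y = g x
        · have : β * (g z - g y) = 0 := by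
            have e : α = 1 - β := by linarith
            rw [e] at hgx
            linear_combination -hgx - he
          rcases mul_eq_zero.1 this with h | h
          · exact absurd h hβ.ne'
          · rw [he, sub_self, mul_zero, ← he, h, mul_zero]
        · have : g y - g x ≠ 0 := sub_ne_zero.2 he
          field_simp
          ring
      · rw [if_neg fun h => hxs h.2, if_pos hyz, if_neg fun h => hxs (hiff.1 h)]
    · rw [if_neg fun h => hyz h.1, if_neg hyz]

/-- `A` is a side of `L`: no edge with both ends in `A` crosses `L`. -/
structure IsSide (D : CellularDomain) (g : Plane → ℝ) (A L : Set Plane) : Prop where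
  disjoint : Disjoint A L
  frontier_subset : frontier A ⊆ L
  no_crossing : ∀ y z, D.Adj y z → y ∈ A → z ∈ A → ∀ x ∈ openSegment ℝ y z, x ∈ L → g y = g z

/-- An edge leaving A meets L in exactly one point, which is a vertex of the induced decomposition;
an edge with both ends in A meets none. Edges on which g is constant carry no flux. -/
theorem sum_crossing (H : D.IsSolution c k g) (hL : L ⊆ D.levelSet g t) (hA : IsSide D g A L)
    (hy : y ∈ A) (hyz : D.Adj y z) :
    (∑ x ∈ (finite_inducedVerts D L).toFinset,
      if x ∈ segment ℝ y z then c y z * (g z - g y) else 0) =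
      if z ∈ A then 0 else c y z * (g z - g y) := by
  by_cases he : g y = g z
  · simp [he]
  have hyL : y ∉ L := fun h => disjoint_left.1 hA.disjoint hy h
  split_ifs with hz
  · refine Finset.sum_eq_zero fun x hx => if_neg fun hxs => he ?_
    have hxL := ((finite_inducedVerts D L).mem_toFinset.1 hx).1
    exact hA.no_crossing y z hyz hy hz x (mem_openSegment_of_ne_left_right
      (fun h => hyL (h ▸ hxL)) (fun h => disjoint_left.1 hA.disjoint hz (h ▸ hxL)) hxs) hxL
  · obtain ⟨x, hxs, hxA⟩ : ∃ x ∈ segment ℝ y z, x ∈ frontier A := by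
      by_contra! hno
      exact hz (subset_of_disjoint_frontier (convex_segment y z).isPreconnected
        ⟨y, left_mem_segment ℝ _ _, hy⟩ (disjoint_left.2 hno) (right_mem_segment ℝ _ _))
    have hxL := hA.frontier_subset hxA
    have huniq : ∀ w ∈ L, w ∈ segment ℝ y z → w = x := fun w hw hws =>
      H.segment_level_unique hyz.1.2 (by simp) (by simp) he hws hxs
        ((hL hw).2.trans (hL hxL).2.symm)
    have hxI : x ∈ D.inducedVerts L := by
      refine ⟨hxL, ?_⟩
      by_cases hxz : x = z
      · exact Or.inl (hxz ▸ hyz.1.mem_verts)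
      · refine Or.inr ⟨y, z, hyz, mem_openSegment_of_ne_left_right (fun h => hyL (h ▸ hxL))
          (Ne.symm hxz) hxs, ?_⟩
        ext w
        exact ⟨fun h => huniq w h.1 h.2, fun h => by rw [mem_singleton_iff.1 h]; exact ⟨hxL, hxs⟩⟩
    rw [Finset.sum_eq_single x (fun w hw hwx => if_neg fun hws => hwx
      (huniq w ((finite_inducedVerts D L).mem_toFinset.1 hw).1 hws))
      (fun h => absurd ((finite_inducedVerts D L).mem_toFinset.2 hxI) h), if_pos hxs]

/-- Green's formula: the flux through `L` into `A` is the total Laplacian over `A`. -/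
theorem fluxLength_eq (H : D.IsSolution c k g) (hL : L ⊆ D.levelSet g t)
    (hA : IsSide D g A L) : D.fluxLength c g A L = |netFlux D c g A| := by
  rw [fluxLength, ← abs_neg, netFlux_eq H.cond,
    finsum_mem_eq_finite_toFinset_sum _ (finite_inducedVerts D L)]
  congr 1
  simp only [normalDerivative]
  rw [Finset.sum_comm, ← Finset.sum_neg_distrib]
  refine Finset.sum_congr rfl fun y hy => ?_
  have hyA := (Finset.mem_filter.1 hy).2
  rw [Finset.sum_congr rfl fun x hx => inducedConductance_mul (L := L) H
    (fun h => disjoint_left.1 hA.disjoint hyA h) ((finite_inducedVerts D L).mem_toFinset.1 hx),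
    Finset.sum_comm, ← Finset.sum_neg_distrib]
  refine Finset.sum_congr rfl fun z hz => ?_
  rw [sum_crossing H hL hA hyA (Finset.mem_filter.1 hz).2]
  split_ifs
  · exact neg_zero
  · ring

theorem isSide_inside (H : D.IsSolution c k g) (ht : 0 < t) (hK : IsCompact L)
    (hL : L ⊆ D.levelSet g t) : IsSide D g (inside L) L where
  disjoint := disjoint_left.2 fun _ hx hx' => hx.1 hx'
  frontier_subset := frontier_inside_subset hK.isClosed
  no_crossing y z hyz hy hz x hx hxL := by
    have hlt : ∀ w ∈ inside L, w ∈ D.verts → g w < t := fun w hw hwv => by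
      rw [← ext_of_mem (k := k) (g := g) (vert_mem_closure hwv)]
      exact ext_lt_of_mem_inside H ht hK hL hw
    exact absurd (hL hxL).2 (H.segment_no_level hyz.1.2 (by simp) (by simp)
      (Or.inl ⟨hlt y hy hyz.symm.1.mem_verts, hlt z hz hyz.1.mem_verts⟩)
      (openSegment_subset_segment _ _ _ hx))

/-- By `hlow` an edge crossing L with both ends outside has no end below t. A point of value t in
its interior then forces both ends to have value t. -/
theorem isSide_outside (H : D.IsSolution c k g) (hK : IsClosed L) (hL : L ⊆ D.levelSet g t)
    (hlow : ∀ y z, D.Adj y z → ∀ x ∈ openSegment ℝ y z, x ∈ L → g y < t → y ∈ inside L) :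
    IsSide D g (outside L) L where
  disjoint := disjoint_left.2 fun _ hx hx' => hx.1 hx'
  frontier_subset := frontier_outside_subset hK
  no_crossing y z hyz hy hz x hx hxL := by
    have hno : ∀ {w}, w ∈ outside L → w ∉ inside L := fun {w} h h' =>
      disjoint_left.1 disjoint_inside_outside h' h
    have h1 : t ≤ g y := not_lt.1 fun h => hno hy (hlow y z hyz x hx hxL h)
    have h2 : t ≤ g z := not_lt.1 fun h => hno hz (hlow z y hyz.symm x
      (by rw [openSegment_symm]; exact hx) hxL h)
    obtain ⟨α, β, hα, hβ, hαβ, hgx⟩ := H.g_openSegment hyz.1 hx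
    rw [(hL hxL).2] at hgx
    have e : α * (g y - t) + β * (g z - t) = 0 := by
      have : t = (α + β) * t := by rw [hαβ, one_mul]
      linear_combination -hgx + this
    have e1 := mul_nonneg hα.le (sub_nonneg.2 h1)
    have e2 := mul_nonneg hβ.le (sub_nonneg.2 h2)
    have f1 := (mul_eq_zero.1 (by linarith : α * (g y - t) = 0)).resolve_left hα.ne'
    have f2 := (mul_eq_zero.1 (by linarith : β * (g z - t) = 0)).resolve_left hβ.ne'
    linarith

theorem value_of_frontier (H : D.IsSolution c k g) (hx : x ∈ frontier D.region) :
    D.ext k g x = 0 ∨ D.ext k g x = k := by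
  rw [ext_of_mem (k := k) (frontier_subset_closure hx)]
  by_contra! h
  exact disjoint_left.1 D.disjoint_region_frontier
    (H.mem_region_of_value (frontier_subset_closure hx) h.1 h.2) hx

namespace IsLevelCycle

theorem ext_eq_zero_of_inside (H : D.IsSolution c k g) (hb : 0 < b) (hbk : b ≤ k)
    (hC : D.IsLevelCycle g b C) (hx : x ∈ frontier D.region) (hxC : x ∈ inside C) :
    D.ext k g x = 0 :=
  (value_of_frontier H hx).resolve_right ((hC.ext_lt H hb hxC).trans_le hbk).ne

/-- For b < k no boundary vertex lies on C, so the flux over the exterior is minus that over the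
interior. For b = k the cycle is E₁, whose exterior misses Ω. -/
theorem hasFluxLength (H : D.IsSolution c k g) (hb : 0 < b) (hbk : b ≤ k)
    (hC : D.IsLevelCycle g b C) : D.HasFluxLength c g C |netFlux D c g (inside C)| := by
  refine ⟨fun _ => fluxLength_eq H hC.2 (isSide_inside H hb hC.1.isCompact hC.2),
    fun ⟨p, hp, hpr⟩ => ?_⟩
  have hbk' : b < k := by
    refine hbk.lt_of_ne fun he => ?_
    subst he
    obtain ⟨x, hx⟩ := hC.1.inside_nonempty
    have := hC.eq_of_meets H hb (isLevelCycle_outer H) ⟨x, hx, hC.inside_subset_inside_outer hx⟩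
    rw [this] at hp
    exact disjoint_left.1 D.disjoint_closure_outside_outer (subset_closure hpr) hp
  rw [fluxLength_eq H hC.2 (isSide_outside H hC.1.isClosed hC.2 fun y z hyz x hx hxC hlt => ?_),
    eq_neg_of_add_eq_zero_left (netFlux_add_compl H.cond g (outside C)), abs_neg,
    netFlux_congr H (B := inside C) fun v hv => ?_]
  · refine ⟨fun h => ?_, fun h h' => disjoint_left.1 disjoint_inside_outside h h'⟩
    have hvC : v ∈ Cᶜ := fun hvC => by
      rcases value_of_frontier H hv with h | h <;> rw [hC.ext_eq hvC] at h <;> linarith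
    rw [compl_eq_inside_union_outside] at hvC
    exact hvC.resolve_right h
  · have hV := hC.isLowComp H hb
    obtain ⟨-, -, s, hs, hxs, a, ha, haV⟩ := hV.exists_tri_of_frontier H hb hbk'
      (by rw [hC.1.frontier_inside]; exact hxC)
    have hys : y ∈ s := subset_of_mem_openHull hyz.1.2 hs.1 ((mem_openHull_pair hyz.1.1).2 hx) hxs
      (by simp)
    exact hV.low_mem H hs.1 (subset_convexHull ℝ _ ha) haV (subset_convexHull ℝ _ hys) hlt

/-- The boundary vertices enclosed by C have value 0 < t, so L encloses them as well. -/
theorem netFlux_lower_cycle (H : D.IsSolution c k g) (h0 : 0 < t) (hbk : b ≤ k) (htb : t < b)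
    (hreg : ∀ r, t ≤ r → r < b → r ∉ D.criticalValues g) (hC : D.IsLevelCycle g b C)
    (hL : D.IsLevelCycle g t L) (hCL : Encloses C L) :
    netFlux D c g (inside L) = netFlux D c g (inside C) := by
  refine netFlux_congr H fun v hv =>
    ⟨fun h => inside_subset_of_subset_inside hC.1 hCL h, fun h => ?_⟩
  obtain ⟨x, hx⟩ := hL.1.isConnected.nonempty
  refine (hC.exists_lower_cycle H h0 hbk htb hreg hL ⟨x, hx, hCL hx⟩).2 v h ?_
  rw [hC.ext_eq_zero_of_inside H (h0.trans htb) hbk hv h]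
  exact h0

/-- S need not be a cycle, but it is the whole level set inside C. The boundary vertices enclosed by
C have value 0: they are enclosed by S if a > 0, and lie on S if a = 0, so the exterior of S misses
them in both cases. -/
theorem hasFluxLength_component (H : D.IsSolution c k g) (ha : 0 ≤ a) (hab : a < b) (hbk : b ≤ k)
    (hreg : ∀ r, a < r → r < b → r ∉ D.criticalValues g) (hC : D.IsLevelCycle g b C)
    {S : Set Plane} (hS : D.IsLevelComponent g a S) (hCS : Encloses C S) :
    D.HasFluxLength c g S |netFlux D c g (inside C)| := by
  have hb := ha.trans_lt hab
  have hSZ := hC.eq_of_encloses H ha hab hbk hreg hS hCS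
  have hSc : IsCompact S := by rw [hSZ]; exact hC.isCompact_inside_levelSet H hab.ne
  have hSL : S ⊆ D.levelSet g a := by rw [hSZ]; exact inter_subset_right
  have hlow : ∀ y ∈ inside C, D.ext k g y < a → y ∈ inside S := fun y hy hya => by
    rw [hSZ]; exact hC.mem_inside_levelSet H hab hbk hy hya
  have hin : inside S ⊆ inside C := inside_subset_of_subset_inside hC.1 hCS
  refine ⟨fun ⟨p, hp, hpr⟩ => ?_, fun _ => ?_⟩
  -- For a = 0 the component S is an inner boundary curve; its interior is a hole, which misses Ω.
  · have ha0 : 0 < a := by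
      refine ha.lt_of_ne fun he => ?_
      subst he
      obtain ⟨x, hx, hSx⟩ := hS
      obtain ⟨i, hi⟩ := H.mem_inner_of_value hx.1 hx.2
      have hxS : x ∈ S := hSx ▸ mem_connectedComponentIn hx
      have h1 : D.inner i ⊆ S := by
        rw [hSx]
        exact (D.inner_simple i).isConnected.isPreconnected.subset_connectedComponentIn hi
          fun y hy => ⟨D.inner_subset_closure i hy, H.value_inner hy⟩
      have h2 : S ⊆ D.bdry (some i) := by
        refine subset_of_iUnion_closed (fun o => (D.bdry_simple o).isClosed) D.bdry_disjoint
          (hSx ▸ isPreconnected_connectedComponentIn) (fun y hy => ?_) ⟨x, hxS, hi⟩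
        obtain ⟨j, hj⟩ := H.mem_inner_of_value (hSL hy).1 (hSL hy).2
        exact mem_iUnion.2 ⟨some j, hj⟩
      rw [Subset.antisymm h2 h1] at hp
      exact disjoint_left.1 (D.disjoint_closure_inside_inner i) (subset_closure hpr) hp
    rw [fluxLength_eq H hSL (isSide_inside H ha0 hSc hSL), netFlux_congr H fun v hv =>
      ⟨fun h => hin h, fun h => hlow v h (by
        rw [hC.ext_eq_zero_of_inside H hb hbk hv h]; exact ha0)⟩]
  · rw [fluxLength_eq H hSL (isSide_outside H hSc.isClosed hSL fun y z hyz x hx hxS hlt => ?_),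
      eq_neg_of_add_eq_zero_left (netFlux_add_compl H.cond g (outside S)), abs_neg,
      netFlux_congr H (B := inside C) fun v hv => ?_]
    · constructor
      · intro h
        by_cases hvS : v ∈ S
        · exact hCS hvS
        · have : v ∈ Sᶜ := hvS
          rw [compl_eq_inside_union_outside] at this
          exact hin (this.resolve_right h)
      · intro h h'
        have hv0 := hC.ext_eq_zero_of_inside H hb hbk hv h
        rcases ha.eq_or_lt with rfl | ha0
        · have hcl := frontier_subset_closure hv
          refine h'.1 ?_
          rw [hSZ]
          exact ⟨h, hcl, by rw [← hv0, ext_of_mem hcl]⟩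
        · exact disjoint_left.1 disjoint_inside_outside (hlow v h (by rw [hv0]; exact ha0)) h'
    -- On the segment from y to x the values stay at most a < b, and x is enclosed by C, so y is
    -- enclosed too.
    · have hf := hyz.1.2
      have hycl := vert_mem_closure hyz.symm.1.mem_verts
      refine hlow y ?_ (by rw [ext_of_mem hycl]; exact hlt)
      refine hC.subset_inside_of_meets H hb hab (convex_segment y x).isPreconnected ?_
        ⟨x, right_mem_segment ℝ _ _, hCS hxS⟩ (left_mem_segment ℝ _ _)
      have hxh : x ∈ hull {y, z} := by
        rw [hull_pair]; exact openSegment_subset_segment _ _ _ hx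
      have hyh : y ∈ hull {y, z} := subset_convexHull ℝ _ (by simp)
      rintro w ⟨α, β, hα, hβ, hαβ, rfl⟩
      rw [ext_of_mem (hull_subset_closure hf (convex_convexHull ℝ _ hyh hxh hα hβ hαβ)),
        H.sol.affine _ hf y hyh x hxh α β hα hβ hαβ, (hSL hxS).2]
      have : a = (α + β) * a := by rw [hαβ, one_mul]
      have := mul_le_mul_of_nonneg_left hlt.le hα
      linarith

end IsLevelCycle

end CellularDomain

/-! ### Enumeration of the critical values and conclusion. -/

theorem exists_strictAnti_enumeration {K : Set ℝ} (hK : K.Finite) {k : ℝ} (h0 : 0 ∈ K)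
    (hk : k ∈ K) (hle : ∀ x ∈ K, 0 ≤ x ∧ x ≤ k) :
    ∃ (N : ℕ) (κ : Fin (N + 1) → ℝ), StrictAnti κ ∧ κ 0 = k ∧ κ (Fin.last N) = 0 ∧ range κ = K := by
  have hcard : hK.toFinset.card = hK.toFinset.card - 1 + 1 :=
    (Nat.sub_add_cancel (Finset.card_pos.2 ⟨0, hK.mem_toFinset.2 h0⟩)).symm
  obtain ⟨N, κ, hanti, hrange⟩ : ∃ (N : ℕ) (κ : Fin (N + 1) → ℝ),
      StrictAnti κ ∧ range κ = K :=
    ⟨_, hK.toFinset.orderEmbOfFin hcard ∘ Fin.rev,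
      (hK.toFinset.orderEmbOfFin hcard).strictMono.comp_strictAnti Fin.rev_strictAnti,
      by rw [Fin.rev_surjective.range_comp, Finset.range_orderEmbOfFin, hK.coe_toFinset]⟩
  clear hcard
  subst hrange
  refine ⟨N, κ, hanti, ?_, ?_, rfl⟩
  · obtain ⟨j, hj⟩ := hk
    exact le_antisymm (hle _ (mem_range_self _)).2
      (hj.symm.le.trans (hanti.antitone (Fin.zero_le j)))
  · obtain ⟨j, hj⟩ := h0
    exact le_antisymm ((hanti.antitone (Fin.le_last j)).trans hj.le)
      (hle _ (mem_range_self _)).1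

theorem notMem_range_of_between {N : ℕ} {κ : Fin (N + 1) → ℝ} (hκ : StrictAnti κ) {i : Fin N}
    {r : ℝ} (h1 : κ i.succ < r) (h2 : r < κ i.castSucc) : r ∉ range κ := by
  rintro ⟨j, rfl⟩
  have e1 := hκ.lt_iff_gt.1 h1
  have e2 := hκ.lt_iff_gt.1 h2
  rw [Fin.lt_def] at e1 e2
  simp only [Fin.val_succ, Fin.val_castSucc] at e1 e2
  omega

namespace CellularDomain

theorem finite_criticalValues (D : CellularDomain) (g : Plane → ℝ) :
    (D.criticalValues g).Finite :=
  (D.verts.finite_toSet.image g).subset fun _ ⟨v, hv, _, _, h⟩ => ⟨v, hv, h⟩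

end CellularDomain

end PlanarNetwork

theorem mainTheorem6 (D : PlanarNetwork.CellularDomain)
    (c : PlanarNetwork.Plane → PlanarNetwork.Plane → ℝ) (hc : D.IsConductance c)
    (k : ℝ) (hk : 0 < k) (g : PlanarNetwork.Plane → ℝ) (hg : D.IsDirichletSolution c k g)
    (hnd : D.Nondegenerate g) :
    -- the values in `K = {κ 0 > κ 1 > ⋯ > κ N}`
    ∃ (N : ℕ) (κ : Fin (N + 1) → ℝ), StrictAnti κ ∧ κ 0 = k ∧ κ (Fin.last N) = 0 ∧
      Set.range κ = D.criticalValues g ∪ {0, k} ∧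
      -- level curves at values outside `K` are simple
      (∀ t, t ∉ Set.range κ → ∀ L, D.IsLevelComponent g t L →
        PlanarNetwork.IsSimpleClosedCurve L) ∧
      -- components at values between two consecutive elements of `K`
      (∀ i : Fin N, ∀ t, κ i.succ < t → t < κ i.castSucc → ∀ L, D.IsLevelComponent g t L →
        (∃! C, D.IsLevelCycle g (κ i.castSucc) C ∧ PlanarNetwork.Encloses C L) ∧
        ∀ C, D.IsLevelCycle g (κ i.castSucc) C → PlanarNetwork.Encloses C L →
          ∃ ℓ, D.HasFluxLength c g L ℓ ∧ D.HasFluxLength c g C ℓ) ∧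
      -- the component at the next lower value of `K`
      (∀ i : Fin N, ∀ C, D.IsLevelCycle g (κ i.castSucc) C →
        (∃! S, D.IsLevelComponent g (κ i.succ) S ∧ PlanarNetwork.Encloses C S) ∧
        ∀ S, D.IsLevelComponent g (κ i.succ) S → PlanarNetwork.Encloses C S →
          ∃ ℓ, D.HasFluxLength c g C ℓ ∧ D.HasFluxLength c g S ℓ) := by
  have H : D.IsSolution c k g := ⟨hc, hk, hg, hnd⟩
  obtain ⟨N, κ, hanti, hκ0, hκN, hrange⟩ := PlanarNetwork.exists_strictAnti_enumeration
    (K := D.criticalValues g ∪ {0, k}) ((D.finite_criticalValues g).union (by simp)) (k := k)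
    (by simp) (by simp) (by
      rintro x (⟨v, -, hv, -, rfl⟩ | rfl | rfl)
      · exact H.value_mem_Icc (subset_closure hv)
      · exact ⟨le_rfl, hk.le⟩
      · exact ⟨hk.le, le_rfl⟩)
  have hle : ∀ i, κ i ≤ k := fun i => hκ0 ▸ hanti.antitone (Fin.zero_le i)
  have hnn : ∀ i, 0 ≤ κ i := fun i => hκN ▸ hanti.antitone (Fin.le_last i)
  have hlt : ∀ i : Fin N, κ i.succ < κ i.castSucc := fun i => hanti i.castSucc_lt_succ
  have hreg : ∀ i : Fin N, ∀ r, κ i.succ < r → r < κ i.castSucc → r ∉ D.criticalValues g :=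
    fun i r h1 h2 hr => PlanarNetwork.notMem_range_of_between hanti h1 h2
      (hrange ▸ Or.inl hr)
  refine ⟨N, κ, hanti, hκ0, hκN, hrange, ?_, ?_, ?_⟩
  · intro t ht L hL
    rw [hrange, Set.mem_union, not_or] at ht
    obtain ⟨hcrit, hends⟩ := ht
    simp only [Set.mem_insert_iff, Set.mem_singleton_iff, not_or] at hends
    obtain ⟨x, hx, -⟩ := id hL
    -- A component is nonempty, so t is a value of g; being neither 0 nor k, it lies strictly
    -- between them.
    have hIcc := H.value_mem_Icc hx.1
    rw [hx.2] at hIcc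
    exact (hL.isLevelCycle H (hIcc.1.lt_of_ne' hends.1) (hIcc.2.lt_of_ne hends.2) hcrit).1
  · intro i t h1 h2 L hL
    have ht0 := (hnn i.succ).trans_lt h1
    refine ⟨PlanarNetwork.CellularDomain.existsUnique_cycle H ht0 h2 (hle _) hL,
      fun C hC hCL => ?_⟩
    have hLC := hL.isLevelCycle H ht0 (h2.trans_le (hle _)) (hreg i t h1 h2)
    refine ⟨_, ?_, hC.hasFluxLength H (ht0.trans h2) (hle _)⟩
    rw [← hC.netFlux_lower_cycle H ht0 (hle _) h2 (fun r hr => hreg i r (h1.trans_le hr)) hLC hCL]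
    exact hLC.hasFluxLength H ht0 (h2.le.trans (hle _))
  · intro i C hC
    refine ⟨hC.existsUnique_component H (hnn _) (hlt i) (hle _) (hreg i), fun S hS hCS => ?_⟩
    exact ⟨_, hC.hasFluxLength H ((hnn _).trans_lt (hlt i)) (hle _),
      hC.hasFluxLength_component H (hnn _) (hlt i) (hle _) (hreg i) hS hCS⟩
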